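/- Let $M\subset\mathbb R^3$ be a compact embedded $C^3$ surface without boundary, with the induced metric $g$, Levi-Civita connection $\nabla$ and area measure $d\mathrm{Vol}$, and let $c_q\in\mathbb R$. Let $H^2(TM)$ be the completion of the $C^2$ tangent vector fields for the norm $\|W\|_{L^2}+\|\nabla W\|_{L^2}+\|\nabla^2W\|_{L^2}$, and $|W|_{H^2(TM)}=\big(\int_M\langle\nabla^2W,\nabla^2W\rangle_g\,d\mathrm{Vol}\big)^{1/2}$. *Point clouds and local meshes.* For a finite $X\subset M$ put $h_{X,M}=\sup_{x\in M}\min_{y\in X}\|x-y\|$ and $q_X=\frac12\min_{y\ne z\in X}\|y-z\|$, and call $X$ quasi-uniform with constant $c_q$ if $q_X\le h_{X,M}\le c_q\,q_X$. For $x\in X$ let $K(x)\subset X$ consist of $m$ nearest neighbours of $x$ in $X$ (the point $x$ included), let $T(x)\subset T_xM$ be the set of orthogonal projections to $T_xM$ of the vectors $y-x$, $y\in K(x)$, and let $R(x)$ be the first ring of a Delaunay triangulation of $T(x)$, that is, the set of its triangles with a vertex at $0$. Let $\gamma_x$ be the local parametrization of $M$ as a graph over $T_xM$: $\gamma_x(v)$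 is the point $p$ of $M$ near $x$ such that $p-x$ projects to $v$. *Interpolation.* On the curved triangle $\gamma_x(T)\subset M$, $T\in R(x)$, write a continuous tangent field as $W=c_1\,\partial_{v_1}\gamma_x+c_2\,\partial_{v_2}\gamma_x$ and put $I_NW=(Ic_1)\,\partial_{v_1}\gamma_x+(Ic_2)\,\partial_{v_2}\gamma_x$, where $If=\sum_w f(w)e_w$ is the nodal interpolant of a function $f$ on $T$, the sum being over the vertices $w$ of $T$ and $e_w$ being the affine (hat) function equal to $1$ at $w$ and to $0$ at the other two vertices. The error is measured elementwise: for $k=0,1$, $$|I_NW-W|_{H^k(TM)}=\Big(\sum_{x\in X}\ \sum_{T\in R(x)}\int_{\gamma_x(T)}\big|\nabla^k(I_NW-W)\big|_g^2\,d\mathrm{Vol}\Big)^{1/2}.$$ **Statement.** There are constants $c,\delta>0$ and $m_0\in\mathbb N$, depending only on $M$ and $c_q$, such that every $W\in H^2(TM)$ has a continuous tangent representative (again denoted $W$, and used for the nodal values), for which $$|I_NW-W|_{H^k(TM)}\le c\,h_{X,M}^{\,2-k}\,|W|_{H^2(TM)},\qquad k=0,1,$$ for every finite $X\subset M$ that is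 quasi-uniform with constant $c_q$, every number $m\ge m_0$ of neighbours and all choices of nearest neighbours and of Delaunay triangulations as above, provided that $\|v\|\le\delta$ for all $v\in T(x)$, $x\in X$. -/

import Mathlib

open MeasureTheory Filter Topology
open scoped ENNReal

noncomputable section

namespace CurvedMesh

/-- The ambient Euclidean space `ℝ³`. -/
abbrev E3 := EuclideanSpace ℝ (Fin 3)

/-! ### Surfaces and tangential calculus -/

/-- `M` is a closed (compact, boundaryless) embedded surface of class `C³` in `ℝ³`: it is compact and
locally the zero set of a `C³` function without critical points. -/
def IsClosedC3Surface (M : Set E3) : Prop :=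
  IsCompact M ∧ ∀ p ∈ M, ∃ U : Set E3, IsOpen U ∧ p ∈ U ∧ ∃ φ : E3 → ℝ,
    ContDiffOn ℝ 3 φ U ∧ (∀ q ∈ U, fderiv ℝ φ q ≠ 0) ∧ M ∩ U = {q ∈ U | φ q = 0}

/-- The tangent plane `T_p M`, as a linear subspace of `ℝ³`. -/
def tangentPlane (M : Set E3) (p : E3) : Submodule ℝ E3 :=
  Submodule.span ℝ (tangentConeAt ℝ M p)

/-- The orthogonal projection `P_p` of `ℝ³` onto `T_p M`, with values in `ℝ³`. -/
def tangentProj (M : Set E3) (p : E3) : E3 →L[ℝ] E3 := (tangentPlane M p).starProjection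

/-- The orthogonal projection of `ℝ³` onto `T_p M`, with values in the plane `T_p M` itself. -/
def tangentCoord (M : Set E3) (p : E3) : E3 →L[ℝ] tangentPlane M p :=
  (tangentPlane M p).orthogonalProjectionOnto

/-- The surface (Riemannian area) measure of `M`. -/
def area (M : Set E3) : Measure E3 := (Measure.euclideanHausdorffMeasure 2).restrict M

/-- The derivative `u ↦ D_{P_p u} F (p)` along `M` of a map defined on `M`. The values of `F` off `M`
play no role. -/
def tangentialDeriv {G : Type*} [NormedAddCommGroup G] [NormedSpace ℝ G]
    (M : Set E3) (F : E3 → G) (p : E3) : E3 →L[ℝ] G :=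
  (fderivWithin ℝ F M p).comp (tangentProj M p)

/-- Every derivative of `F` within `M` gives the same derivative along `M`, so `tangentialDeriv` does
not depend on the one chosen by `fderivWithin`. -/
theorem tangentialDeriv_eq {G : Type*} [NormedAddCommGroup G] [NormedSpace ℝ G]
    {M : Set E3} {F : E3 → G} {p : E3} {F' : E3 →L[ℝ] G} (h : HasFDerivWithinAt F F' M p) :
    tangentialDeriv M F p = F'.comp (tangentProj M p) := by
  ext1 u
  have hs : Set.EqOn (fderivWithin ℝ F M p) F' (tangentPlane M p : Set E3) :=
    LinearMap.eqOn_span (f := (fderivWithin ℝ F M p).toLinearMap) (g := F'.toLinearMap)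
      (h.differentiableWithinAt.hasFDerivWithinAt.unique_on h)
  exact hs (Submodule.starProjection_apply_mem _ u)

/-- The vector field `V` is tangent to `M`. -/
def IsTangentField (M : Set E3) (V : E3 → E3) : Prop := ∀ p ∈ M, V p ∈ tangentPlane M p

/-- The (Levi-Civita) covariant derivative of a tangent field `V` of the surface `M`, at `p`:
`u ↦ P_p (D_{P_p u} V)`. -/
def covDeriv (M : Set E3) (V : E3 → E3) (p : E3) : E3 →L[ℝ] E3 :=
  (tangentProj M p).comp (tangentialDeriv M V p)

/-- The second covariant derivative of a tangent field `V`, that is the covariant derivative of the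
tensor field `∇V`, at `p`: `(u, w) ↦ P_p ((D_{P_p u} (∇V)) (P_p w))`. -/
def covDeriv₂ (M : Set E3) (V : E3 → E3) (p : E3) : E3 →L[ℝ] E3 →L[ℝ] E3 :=
  (ContinuousLinearMap.compL ℝ E3 E3 E3 (tangentProj M p)).comp
    (((ContinuousLinearMap.compL ℝ E3 E3 E3).flip (tangentProj M p)).comp
      (tangentialDeriv M (covDeriv M V) p))

theorem covDeriv₂_apply (M : Set E3) (V : E3 → E3) (p u w : E3) :
    covDeriv₂ M V p u w =
      tangentProj M p (tangentialDeriv M (covDeriv M V) p u (tangentProj M p w)) := rfl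

/-- The squared norm `⟨A, A⟩_g` of a tangential tensor `A`, such as `∇W (p)`. -/
def normSq₁ (A : E3 →L[ℝ] E3) : ℝ := ∑ i, ‖A (EuclideanSpace.single i 1)‖ ^ 2

/-- The squared norm `⟨B, B⟩_g` of a tangential tensor `B`, such as `∇²W (p)`. -/
def normSq₂ (B : E3 →L[ℝ] E3 →L[ℝ] E3) : ℝ :=
  ∑ i, ∑ j, ‖B (EuclideanSpace.single i 1) (EuclideanSpace.single j 1)‖ ^ 2

/-! ### The Sobolev space `H²(TM)` -/

/-- `W ∈ H²(TM)`, with `∇W = A` and `∇²W = B`: the space `H²(TM)` is the completion in `L²` of the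
space of `C²` tangent fields for the norm `‖V‖ + ‖∇V‖ + ‖∇²V‖` of `L²`, and `A` and `B` are the limits of
the covariant derivatives. -/
structure MemH2 (M : Set E3) (W : E3 → E3) (A : E3 → E3 →L[ℝ] E3)
    (B : E3 → E3 →L[ℝ] E3 →L[ℝ] E3) : Prop where
  memLp : MemLp W 2 (area M)
  memLp_grad : MemLp A 2 (area M)
  memLp_hess : MemLp B 2 (area M)
  approx : ∃ V : ℕ → E3 → E3, (∀ m, ContDiff ℝ 2 (V m) ∧ IsTangentField M (V m)) ∧
    Tendsto (fun m => eLpNorm (fun p => V m p - W p) 2 (area M)) atTop (𝓝 0) ∧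
    Tendsto (fun m => eLpNorm (fun p => covDeriv M (V m) p - A p) 2 (area M)) atTop (𝓝 0) ∧
    Tendsto (fun m => eLpNorm (fun p => covDeriv₂ M (V m) p - B p) 2 (area M)) atTop (𝓝 0)

/-- The seminorm `|W|_{H²(TM)} = (∫_M ⟨∇²W, ∇²W⟩_g dVol)^{1/2}`, as a function of `B = ∇²W`. -/
def seminormH2 (M : Set E3) (B : E3 → E3 →L[ℝ] E3 →L[ℝ] E3) : ℝ≥0∞ :=
  (∫⁻ p, ENNReal.ofReal (normSq₂ (B p)) ∂area M) ^ (1 / 2 : ℝ)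

/-! ### Point clouds, neighbours and local meshes -/

/-- The fill distance `h_{X,M} = sup_{x ∈ M} min_{y ∈ X} ‖x - y‖`. -/
def fillDist (M : Set E3) (X : Finset E3) : ℝ := ⨆ x : M, Metric.infDist (x : E3) (X : Set E3)

/-- The separation distance `q_X`, half the least distance between two points of `X`. -/
def sepDist (X : Finset E3) : ℝ := (1 / 2) * Set.infsep (X : Set E3)

/-- `q_X ≤ h_{X,M} ≤ c_q q_X`. -/
def QuasiUniform (M : Set E3) (X : Finset E3) (cq : ℝ) : Prop :=
  sepDist X ≤ fillDist M X ∧ fillDist M X ≤ cq * sepDist X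

/-- `K` consists of `k` nearest neighbours of `x` in `X`, the point `x` being one of them. -/
def IsNearest (X : Finset E3) (k : ℕ) (x : E3) (K : Finset E3) : Prop :=
  K ⊆ X ∧ x ∈ K ∧ K.card = k ∧ ∀ y ∈ K, ∀ z ∈ X, z ∉ K → dist y x ≤ dist z x

/-- The orthogonal projection of the points of `K` to the tangent plane at `x`, with origin `x`. -/
def projected (M : Set E3) (x : E3) (K : Finset E3) : Set (tangentPlane M x) :=
  (fun y => tangentCoord M x (y - x)) '' (K : Set E3)

/-- `R` is a Delaunay triangulation of the set `P` in a plane: it triangulates the convex hull of `P`,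
its vertices are the points of `P`, and no point of `P` is inside the circumcircle of a triangle. -/
def IsDelaunay {E : Type*} [NormedAddCommGroup E] [InnerProductSpace ℝ E] (P : Set E)
    (R : Geometry.SimplicialComplex ℝ E) : Prop :=
  R.vertices = P ∧ R.space = convexHull ℝ P ∧
    ∀ t ∈ R.faces, t.card = 3 → ∀ (z : E) (ρ : ℝ), (∀ v ∈ t, dist v z = ρ) →
      ∀ w ∈ P, ρ ≤ dist w z

/-- The first ring of a triangulation: its triangles with a vertex at the origin. -/
def firstRing {E : Type*} [NormedAddCommGroup E] [InnerProductSpace ℝ E]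
    (R : Geometry.SimplicialComplex ℝ E) : Set (Finset E) :=
  {t | t ∈ R.faces ∧ t.card = 3 ∧ 0 ∈ t}

/-! ### Local parametrization, hat functions and interpolation -/

/-- The local parametrization `γ_x` of `M` over its tangent plane at `x`, inverse to the projection of
the points of `M` near `x`: the point of `M` that projects to `v`, the nearest one to `x` if there are
several. -/
def graphParam (M : Set E3) (x : E3) (v : tangentPlane M x) : E3 :=
  Classical.epsilon fun p => p ∈ M ∧ tangentCoord M x (p - x) = v ∧
    ∀ q ∈ M, tangentCoord M x (q - x) = v → dist p x ≤ dist q x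

/-- The components `c` of a tangent vector `U = dγ_x (v) c` of `M` at `γ_x (v)` in the basis
`∂_1 γ_x, ∂_2 γ_x` are its components along `T_x M`, see `coeff_eq`. -/
def coeff (M : Set E3) (x : E3) (U : E3) : tangentPlane M x := tangentCoord M x U

theorem coeff_eq (M : Set E3) (x : E3) (v c : tangentPlane M x)
    (hγ : ∀ᶠ w in 𝓝 v, tangentCoord M x (graphParam M x w - x) = w)
    (hd : DifferentiableAt ℝ (graphParam M x) v) :
    coeff M x (fderiv ℝ (graphParam M x) v c) = c := by
  have h1 : HasFDerivAt (fun w => tangentCoord M x (graphParam M x w - x))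
      ((tangentCoord M x).comp (fderiv ℝ (graphParam M x) v)) v :=
    (tangentCoord M x).hasFDerivAt.comp v (hd.hasFDerivAt.sub_const x)
  have h2 : HasFDerivAt (fun w => tangentCoord M x (graphParam M x w - x))
      (ContinuousLinearMap.id ℝ _) v := (hasFDerivAt_id v).congr_of_eventuallyEq hγ
  exact congrArg (fun L : tangentPlane M x →L[ℝ] tangentPlane M x => L c) (h1.unique h2)

/-- The nodal hat function on the triangle with vertex set `t`: the affine function equal to `1` at the
vertex `w` and to `0` at the two others. -/
def hat {E : Type*} [NormedAddCommGroup E] [InnerProductSpace ℝ E] (t : Finset E) (w : E) :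
    E →ᵃ[ℝ] ℝ :=
  Classical.epsilon fun e : E →ᵃ[ℝ] ℝ => e w = 1 ∧ ∀ w' ∈ t, w' ≠ w → e w' = 0

/-- The curved triangle `γ_x (T)` on `M`, where `T` is the triangle with vertex set `t`. -/
def element (M : Set E3) (x : E3) (t : Finset (tangentPlane M x)) : Set E3 :=
  graphParam M x '' convexHull ℝ (t : Set (tangentPlane M x))

/-- The interpolant on the curved triangle `γ_x (T)` of the field `W`, namely the field
`(I c_1) ∂_1 γ_x + (I c_2) ∂_2 γ_x`, where `W = c_1 ∂_1 γ_x + c_2 ∂_2 γ_x` and where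
`I f = ∑_w f(w) e_w` is nodal interpolation of functions on `T` by hat functions. It depends on the
values of `W` at the three nodes only. -/
def interp (M : Set E3) (x : E3) (t : Finset (tangentPlane M x)) (W : E3 → E3) (q : E3) : E3 :=
  fderiv ℝ (graphParam M x) (tangentCoord M x (q - x))
    (∑ w ∈ t, hat t w (tangentCoord M x (q - x)) • coeff M x (W (graphParam M x w)))

/-- Elementwise `L²` norm: the square root of the sum, over all `x ∈ X` and all triangles in the first
ring at `x`, of the integrals over the curved triangles of a squared norm `f`. -/
def elementwise (M : Set E3) (X : Finset E3)
    (R : ∀ x : E3, Geometry.SimplicialComplex ℝ (tangentPlane M x))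
    (f : ∀ x : E3, Finset (tangentPlane M x) → E3 → ℝ) : ℝ≥0∞ :=
  (∑ x ∈ X, ∑' t : firstRing (R x),
    ∫⁻ q in element M x t, ENNReal.ofReal (f x t q) ∂area M) ^ (1 / 2 : ℝ)

/-- `|I_N W - W|_{H⁰(TM)}`. -/
def errorH0 (M : Set E3) (X : Finset E3)
    (R : ∀ x : E3, Geometry.SimplicialComplex ℝ (tangentPlane M x)) (W : E3 → E3) : ℝ≥0∞ :=
  elementwise M X R fun x t q => ‖interp M x t W q - W q‖ ^ 2

/-- `|I_N W - W|_{H¹(TM)}`, as a function of `W` and `A = ∇W`. -/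
def errorH1 (M : Set E3) (X : Finset E3)
    (R : ∀ x : E3, Geometry.SimplicialComplex ℝ (tangentPlane M x)) (W : E3 → E3)
    (A : E3 → E3 →L[ℝ] E3) : ℝ≥0∞ :=
  elementwise M X R fun x t q => normSq₁ (covDeriv M (interp M x t W) q - A q)

end CurvedMesh

end

open CurvedMesh

/-! The local part is the classical argument for linear interpolation. In a graph chart `g` over
`T_x M` the error field is `Dg` applied to a combination of Taylor remainders at the nodes, because
hat functions reproduce affine functions; the weights are the hat functions for k = 0, and their
gradients, of size 1/h, enter for k = 1. The remainder, expanded at the integration point and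
evaluated at a node, is at most a multiple of h² times the second derivative in L²
(`lintegral_taylorRem_le`). The gradient bound comes from the mesh: empty circumcircles and density
of the points give circumradius at most 2h, quasi-uniformity gives sides bounded below by a multiple
of h, and a height of a triangle is the product of the two adjacent sides over twice the
circumradius (`isHatFamily_of_circumradius`, `IsUniformSurface.exists_isGoodMesh`). The local bounds
are summed using bounded overlap.

This alone would give the full H² norm, since second derivatives in a chart involve V, ∇V and ∇²V.
The seminorm suffices because of a Poincaré inequality without kernel,
`IsUniformSurface.exists_lintegral_le_hessEnergy`. By the Ricci identity the antisymmetric part of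
∇²V is a curvature term applied to V. At a point of M of locally maximal distance to the origin the
curvature is positive, so near it ∇²V bounds V pointwise (`exists_norm_le_covDeriv₂`). From there
control in L² spreads: in small discs, V on the disc of radius 4ρ is bounded by V on the disc of
radius ρ and by ∇²V (`IsUniformSurface.exists_energy_le`). The set of points without control is thus
open and closed in M; if it were nonempty, its point farthest from the origin would be a local
maximum of the norm on M, where control holds (`IsUniformSurface.forall_isControlled`). Neither
connectedness of M nor a compact embedding is involved.

The same estimates bound the sup norm by ∇²V (`IsUniformSurface.exists_enorm_sq_le_hessEnergy`).
Hence an approximating sequence of C² fields converges uniformly, which yields the continuous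
representative and the convergence of nodal values. The error bound is then obtained by letting the
smooth fields tend to W with the mesh fixed (`IsUniformSurface.sum_setLIntegral_le_of_tendsto`). -/

noncomputable section

namespace CurvedMesh

set_option maxSynthPendingDepth 3

/-! ### Taylor remainders and affine approximation in L² on a Euclidean plane. -/

section Analysis

variable {E : Type*} [NormedAddCommGroup E] [InnerProductSpace ℝ E]
  {F : Type*} [NormedAddCommGroup F] [NormedSpace ℝ F]

theorem ofReal_norm_sq {F : Type*} [NormedAddCommGroup F] (x : F) :
    ENNReal.ofReal (‖x‖ ^ 2) = ‖x‖ₑ ^ 2 := by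
  rw [ENNReal.ofReal_pow (norm_nonneg x), ofReal_norm]

/-- The remainder of the first order Taylor expansion of `u` at `v`, evaluated at `q`. -/
def taylorRem (u : E → F) (q v : E) : F := u q - u v - fderiv ℝ u v (q - v)

/-- The segment runs from the evaluation point `q` (t = 0) to the expansion point `v` (t = 1), so
the weight is `t` and vanishes at `q`. This compensates the concentration of the homotheties `v ↦ q
+ t (v - q)` at `q` when the remainder is integrated in `v`. -/
theorem taylorRem_eq_integral [CompleteSpace F] {u : E → F} (hu : ContDiff ℝ 2 u) (q v : E) :
    taylorRem u q v =
      ∫ t in (0 : ℝ)..1, t • fderiv ℝ (fderiv ℝ u) (q + t • (v - q)) (v - q) (v - q) := by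
  have hu1 : ContDiff ℝ 1 (fderiv ℝ u) := hu.fderiv_right (by norm_num)
  have hd : Differentiable ℝ u := hu.differentiable (by norm_num)
  have hd1 : Differentiable ℝ (fderiv ℝ u) := hu1.differentiable (by norm_num)
  have hc2 : Continuous (fderiv ℝ (fderiv ℝ u)) := hu1.continuous_fderiv (by norm_num)
  have hline : ∀ t : ℝ, HasDerivAt (fun t : ℝ => q + t • (v - q)) (v - q) t := fun t => by
    simpa using ((hasDerivAt_id t).smul_const (v - q)).const_add q
  have h0 : ∀ t : ℝ, HasDerivAt (fun t : ℝ => u (q + t • (v - q)))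
      (fderiv ℝ u (q + t • (v - q)) (v - q)) t := fun t =>
    (hd _).hasFDerivAt.comp_hasDerivAt t (hline t)
  have h1 : ∀ t : ℝ, HasDerivAt (fun t : ℝ => fderiv ℝ u (q + t • (v - q)) (v - q))
      (fderiv ℝ (fderiv ℝ u) (q + t • (v - q)) (v - q) (v - q)) t := fun t => by
    simpa using ((hd1 _).hasFDerivAt.comp_hasDerivAt t (hline t)).clm_apply
      (hasDerivAt_const t (v - q))
  -- An antiderivative of the integrand: the two first order terms cancel on differentiation.
  have h2 : ∀ t : ℝ, HasDerivAt (fun t : ℝ => t • fderiv ℝ u (q + t • (v - q)) (v - q)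
      - u (q + t • (v - q)))
      (t • fderiv ℝ (fderiv ℝ u) (q + t • (v - q)) (v - q) (v - q)) t := fun t => by
    convert ((hasDerivAt_id t).smul (h1 t)).sub (h0 t) using 1
    · rfl
    · simp
  rw [intervalIntegral.integral_eq_sub_of_hasDerivAt (fun t _ => h2 t)]
  · simp only [taylorRem, one_smul, zero_smul, add_sub_cancel, add_zero]
    rw [← neg_sub v q, map_neg]
    abel
  · apply Continuous.intervalIntegrable
    fun_prop

theorem sq_lintegral_le {α : Type*} [MeasurableSpace α] (ν : Measure α) [IsProbabilityMeasure ν]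
    {f : α → ℝ≥0∞} (hf : AEMeasurable f ν) : (∫⁻ x, f x ∂ν) ^ 2 ≤ ∫⁻ x, f x ^ 2 ∂ν := by
  have h := ENNReal.lintegral_mul_le_Lp_mul_Lq ν Real.HolderConjugate.two_two hf
    (aemeasurable_const (b := (1 : ℝ≥0∞)))
  simp only [Pi.mul_apply, mul_one, ENNReal.one_rpow, lintegral_const, measure_univ] at h
  calc (∫⁻ x, f x ∂ν) ^ 2 ≤ ((∫⁻ x, f x ^ (2 : ℝ) ∂ν) ^ (1 / 2 : ℝ)) ^ 2 := by gcongr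
    _ = ∫⁻ x, f x ^ 2 ∂ν := by
      rw [← ENNReal.rpow_natCast, ← ENNReal.rpow_mul]
      norm_num

theorem enorm_sq_taylorRem_le [CompleteSpace F] {u : E → F} (hu : ContDiff ℝ 2 u) (q v : E) :
    ‖taylorRem u q v‖ₑ ^ 2 ≤ ∫⁻ t in Set.Ioc (0 : ℝ) 1, ENNReal.ofReal (t ^ 2) *
      (‖v - q‖ₑ ^ 4 * ‖fderiv ℝ (fderiv ℝ u) (q + t • (v - q))‖ₑ ^ 2) := by
  have hu1 : ContDiff ℝ 1 (fderiv ℝ u) := hu.fderiv_right (by norm_num)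
  have hc2 : Continuous (fderiv ℝ (fderiv ℝ u)) := hu1.continuous_fderiv (by norm_num)
  have : IsProbabilityMeasure (volume.restrict (Set.Ioc (0 : ℝ) 1)) := ⟨by simp⟩
  rw [taylorRem_eq_integral hu, intervalIntegral.integral_of_le zero_le_one]
  calc _ ≤ (∫⁻ t in Set.Ioc (0 : ℝ) 1,
          ‖t • fderiv ℝ (fderiv ℝ u) (q + t • (v - q)) (v - q) (v - q)‖ₑ) ^ 2 := by
        gcongr; exact enorm_integral_le_lintegral_enorm _
    _ ≤ ∫⁻ t in Set.Ioc (0 : ℝ) 1,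
          ‖t • fderiv ℝ (fderiv ℝ u) (q + t • (v - q)) (v - q) (v - q)‖ₑ ^ 2 := by
        apply sq_lintegral_le
        apply Continuous.aemeasurable
        fun_prop
    _ ≤ _ := by
        refine lintegral_mono fun t => ?_
        simp only
        rw [← ofReal_norm_sq, norm_smul, mul_pow, Real.norm_eq_abs, sq_abs,
          ENNReal.ofReal_mul (sq_nonneg t)]
        gcongr
        rw [ofReal_norm_sq]
        calc _ ≤ (‖fderiv ℝ (fderiv ℝ u) (q + t • (v - q))‖ₑ * ‖v - q‖ₑ * ‖v - q‖ₑ) ^ 2 := by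
              gcongr
              simp only [← ofReal_norm]
              rw [← ENNReal.ofReal_mul (by positivity), ← ENNReal.ofReal_mul (by positivity)]
              exact ENNReal.ofReal_le_ofReal (ContinuousLinearMap.le_opNorm₂ _ _ _)
          _ = _ := by ring

variable [FiniteDimensional ℝ E] [MeasurableSpace E] [BorelSpace E] (μ : Measure E)
  [μ.IsAddHaarMeasure]

/-- In dimension two the Jacobian t² of the homothety is exactly the weight produced by
`enorm_sq_taylorRem_le`, so the integral over t has no singularity at 0. -/
theorem lintegral_comp_homothety (hE : Module.finrank ℝ E = 2) (q : E) {t : ℝ} (ht : 0 < t)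
    {G : E → ℝ≥0∞} (hG : Measurable G) :
    ENNReal.ofReal (t ^ 2) * ∫⁻ v, G (q + t • (v - q)) ∂μ = ∫⁻ y, G y ∂μ := by
  have h1 : ∫⁻ v, G (q + t • (v - q)) ∂μ = ∫⁻ v, G (q + t • v) ∂μ :=
    lintegral_sub_right_eq_self (fun v => G (q + t • v)) q
  have h2 : ∫⁻ v, G (q + t • v) ∂μ = ∫⁻ y, G (q + y) ∂(μ.map (t • ·)) :=
    (lintegral_map (hG.comp (measurable_const_add q)) (measurable_const_smul t)).symm
  rw [h1, h2, Measure.map_addHaar_smul μ ht.ne', lintegral_smul_measure,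
    lintegral_add_left_eq_self (fun y => G y) q, smul_eq_mul, ← mul_assoc, hE,
    ← ENNReal.ofReal_mul (by positivity), abs_of_pos (by positivity),
    mul_inv_cancel₀ (by positivity), ENNReal.ofReal_one, one_mul]

/-- The Taylor remainder at a fixed point `q` is controlled in `L²` by the second derivative. -/
theorem lintegral_taylorRem_le [CompleteSpace F] (hE : Module.finrank ℝ E = 2) {u : E → F}
    (hu : ContDiff ℝ 2 u) {D : Set E} (hD : Convex ℝ D) (hDm : MeasurableSet D) {d : ℝ}
    {q : E} (hq : q ∈ D) (hd : ∀ v ∈ D, ‖v - q‖ ≤ d) :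
    ∫⁻ v in D, ‖taylorRem u q v‖ₑ ^ 2 ∂μ ≤
      ENNReal.ofReal d ^ 4 * ∫⁻ v in D, ‖fderiv ℝ (fderiv ℝ u) v‖ₑ ^ 2 ∂μ := by
  have hu1 : ContDiff ℝ 1 (fderiv ℝ u) := hu.fderiv_right (by norm_num)
  have hc2 : Continuous (fderiv ℝ (fderiv ℝ u)) := hu1.continuous_fderiv (by norm_num)
  set G : E → ℝ≥0∞ := D.indicator fun y => ‖fderiv ℝ (fderiv ℝ u) y‖ₑ ^ 2 with hG
  have hGm : Measurable G := (Continuous.measurable (by fun_prop)).indicator hDm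
  calc ∫⁻ v in D, ‖taylorRem u q v‖ₑ ^ 2 ∂μ
      ≤ ∫⁻ v in D, ENNReal.ofReal d ^ 4 * ∫⁻ t in Set.Ioc (0 : ℝ) 1, ENNReal.ofReal (t ^ 2) *
          G (q + t • (v - q)) ∂volume ∂μ := by
        refine setLIntegral_mono' hDm fun v hv => (enorm_sq_taylorRem_le hu q v).trans ?_
        rw [← lintegral_const_mul' _ _ (by finiteness)]
        refine setLIntegral_mono' measurableSet_Ioc fun t ht => ?_
        -- Convexity keeps the segment in `D`, so the second derivative may be cut off outside `D`
        -- before the integrals are exchanged.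
        have hmem : q + t • (v - q) ∈ D := hD.add_smul_sub_mem hq hv ⟨ht.1.le, ht.2⟩
        rw [hG, Set.indicator_of_mem hmem, mul_left_comm]
        gcongr
        rw [← ofReal_norm]
        exact ENNReal.ofReal_le_ofReal (hd v hv)
    _ ≤ ∫⁻ v, ENNReal.ofReal d ^ 4 * ∫⁻ t in Set.Ioc (0 : ℝ) 1, ENNReal.ofReal (t ^ 2) *
          G (q + t • (v - q)) ∂volume ∂μ := setLIntegral_le_lintegral _ _
    _ = ENNReal.ofReal d ^ 4 * ∫⁻ t in Set.Ioc (0 : ℝ) 1, ENNReal.ofReal (t ^ 2) *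
          ∫⁻ v, G (q + t • (v - q)) ∂μ := by
        rw [lintegral_const_mul' _ _ (by finiteness), lintegral_lintegral_swap]
        · congr 1
          refine lintegral_congr fun t => ?_
          rw [lintegral_const_mul' _ _ ENNReal.ofReal_ne_top]
        · apply Measurable.aemeasurable
          apply Measurable.mul
          · exact ENNReal.measurable_ofReal.comp (measurable_snd.pow_const 2)
          · exact hGm.comp (Continuous.measurable (by fun_prop))
    _ = ENNReal.ofReal d ^ 4 * ∫⁻ t in Set.Ioc (0 : ℝ) 1, ∫⁻ v, G v ∂μ := by
        congr 1
        refine setLIntegral_congr_fun measurableSet_Ioc fun t ht => ?_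
        exact lintegral_comp_homothety μ hE q ht.1 hGm
    _ = _ := by
        rw [setLIntegral_const, hG, lintegral_indicator hDm]
        simp

omit [InnerProductSpace ℝ E] [FiniteDimensional ℝ E] in
theorem setLIntegral_comp_add_right_le {S S' : Set E} (hS : MeasurableSet S)
    (hS' : MeasurableSet S') {e : E} (h : ∀ q ∈ S', q + e ∈ S) (f : E → ℝ≥0∞) :
    ∫⁻ q in S', f (q + e) ∂μ ≤ ∫⁻ q in S, f q ∂μ := by
  rw [← lintegral_indicator hS, ← lintegral_indicator hS',
    ← lintegral_add_right_eq_self (μ := μ) (S.indicator f) e]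
  refine lintegral_mono fun q => ?_
  by_cases hq : q ∈ S'
  · rw [Set.indicator_of_mem hq, Set.indicator_of_mem (h q hq)]
  · simp [hq]

omit [FiniteDimensional ℝ E] in
/-- The coefficients of an affine function are controlled by its `L²` norm over a small ball. -/
theorem measure_mul_affine_le {a : F} {L : E →L[ℝ] F} {v : E} {ρ : ℝ} (hρ : 0 < ρ)
    (hv : ‖v‖ ≤ 4 * ρ) :
    μ (Metric.closedBall 0 (ρ / 2)) * (‖a‖ₑ ^ 2 + ENNReal.ofReal ρ ^ 2 * ‖L‖ₑ ^ 2) ≤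
      2000 * ∫⁻ q in Metric.closedBall 0 ρ, ‖a + L (q - v)‖ₑ ^ 2 ∂μ := by
  -- A direction in which `L` attains at least half of its norm. Comparing the affine function at
  -- `q` and at `q + (ρ/2) e` recovers `L`, and then `a`.
  obtain ⟨e, he, hLe⟩ : ∃ e : E, ‖e‖ ≤ 1 ∧ ‖L‖ ≤ 2 * ‖L e‖ := by
    rcases (norm_nonneg L).eq_or_lt with h0 | h0
    · exact ⟨0, by simp, by simp [← h0]⟩
    · obtain ⟨e, he, h⟩ := L.exists_lt_apply_of_lt_opNorm (half_lt_self h0)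
      exact ⟨e, he.le, by linarith⟩
  set f : E → ℝ≥0∞ := fun q => ‖a + L (q - v)‖ₑ ^ 2 with hf
  have hfm : Measurable f := Continuous.measurable (by fun_prop)
  have key : ∀ q ∈ Metric.closedBall (0 : E) (ρ / 2),
      ‖a‖ₑ ^ 2 + ENNReal.ofReal ρ ^ 2 * ‖L‖ₑ ^ 2 ≤ 1000 * (f q + f (q + (ρ / 2) • e)) := by
    intro q hq
    rw [mem_closedBall_zero_iff] at hq
    set x := ‖a + L (q - v)‖ with hx
    set y := ‖a + L (q + (ρ / 2) • e - v)‖ with hy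
    have h1 : ρ * ‖L‖ ≤ 4 * (x + y) := by
      have h2 : (ρ / 2) • L e = (a + L (q + (ρ / 2) • e - v)) - (a + L (q - v)) := by
        rw [← L.map_smul, add_sub_add_left_eq_sub, ← map_sub]
        congr 1
        abel
      have h3 : ρ / 2 * ‖L e‖ ≤ y + x := by
        rw [← norm_smul_of_nonneg (by positivity), h2]
        exact norm_sub_le _ _
      nlinarith
    have h4 : ‖a‖ ≤ 21 * x + 20 * y := by
      have h5 : ‖a‖ ≤ x + ‖L‖ * ‖q - v‖ := by
        calc ‖a‖ = ‖(a + L (q - v)) - L (q - v)‖ := by rw [add_sub_cancel_right]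
          _ ≤ _ := (norm_sub_le _ _).trans (add_le_add_right (L.le_opNorm _) _)
      have h6 : ‖q - v‖ ≤ 5 * ρ := (norm_sub_le _ _).trans (by linarith)
      have h7 : ‖L‖ * ‖q - v‖ ≤ ‖L‖ * (5 * ρ) := by gcongr
      nlinarith
    have h8 : ‖a‖ ^ 2 + ρ ^ 2 * ‖L‖ ^ 2 ≤ 1000 * (x ^ 2 + y ^ 2) := by
      have hx0 : 0 ≤ x := norm_nonneg _
      have hy0 : 0 ≤ y := norm_nonneg _
      have h9 : ‖a‖ ^ 2 ≤ (21 * x + 20 * y) ^ 2 := by gcongr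
      have h10 : (ρ * ‖L‖) ^ 2 ≤ (4 * (x + y)) ^ 2 := by gcongr
      nlinarith [sq_nonneg (x - y)]
    have h11 := ENNReal.ofReal_le_ofReal h8
    rw [ENNReal.ofReal_add (by positivity) (by positivity), ENNReal.ofReal_mul (by positivity),
      ENNReal.ofReal_mul (by positivity), ENNReal.ofReal_add (by positivity) (by positivity),
      ENNReal.ofReal_pow hρ.le] at h11
    simpa only [ofReal_norm_sq, hx, hy, ENNReal.ofReal_ofNat] using h11
  calc _ = ∫⁻ _ in Metric.closedBall (0 : E) (ρ / 2),
        (‖a‖ₑ ^ 2 + ENNReal.ofReal ρ ^ 2 * ‖L‖ₑ ^ 2) ∂μ := by rw [setLIntegral_const, mul_comm]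
    _ ≤ ∫⁻ q in Metric.closedBall (0 : E) (ρ / 2), 1000 * (f q + f (q + (ρ / 2) • e)) ∂μ :=
        setLIntegral_mono' Metric.isClosed_closedBall.measurableSet key
    _ = 1000 * (∫⁻ q in Metric.closedBall (0 : E) (ρ / 2), f (q + 0) ∂μ +
          ∫⁻ q in Metric.closedBall (0 : E) (ρ / 2), f (q + (ρ / 2) • e) ∂μ) := by
        rw [lintegral_const_mul' _ _ (by finiteness), lintegral_add_left hfm]
        simp
    _ ≤ 1000 * (∫⁻ q in Metric.closedBall 0 ρ, f q ∂μ +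
          ∫⁻ q in Metric.closedBall 0 ρ, f q ∂μ) := by
        refine mul_le_mul_right (add_le_add ?_ ?_) _
        all_goals
          refine setLIntegral_comp_add_right_le μ Metric.isClosed_closedBall.measurableSet
            Metric.isClosed_closedBall.measurableSet (fun q hq => ?_) f
          rw [mem_closedBall_zero_iff] at hq ⊢
        · rw [add_zero]; linarith
        · refine (norm_add_le _ _).trans ?_
          rw [norm_smul_of_nonneg (by positivity)]
          nlinarith
    _ = _ := by
        rw [← two_mul, ← mul_assoc]
        norm_num

theorem enorm_add_sq_le {F : Type*} [NormedAddCommGroup F] (x y : F) :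
    ‖x + y‖ₑ ^ 2 ≤ 2 * (‖x‖ₑ ^ 2 + ‖y‖ₑ ^ 2) := by
  simp only [← ofReal_norm_sq]
  rw [← ENNReal.ofReal_add (by positivity) (by positivity), ← ENNReal.ofReal_ofNat 2,
    ← ENNReal.ofReal_mul (by positivity)]
  apply ENNReal.ofReal_le_ofReal
  have : ‖x + y‖ ^ 2 ≤ (‖x‖ + ‖y‖) ^ 2 := by gcongr; exact norm_add_le _ _
  nlinarith [sq_nonneg (‖x‖ - ‖y‖)]

/-- Up to second derivatives, `u` and its derivative on a ball are controlled by `u` on a smaller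
concentric ball. -/
theorem lintegral_closedBall_le [CompleteSpace F] (hE : Module.finrank ℝ E = 2) {u : E → F}
    (hu : ContDiff ℝ 2 u) {ρ : ℝ} (hρ : 0 < ρ) :
    ∫⁻ v in Metric.closedBall 0 (4 * ρ),
        (‖u v‖ₑ ^ 2 + ENNReal.ofReal ρ ^ 2 * ‖fderiv ℝ u v‖ₑ ^ 2) ∂μ ≤
      10 ^ 9 * (∫⁻ v in Metric.closedBall 0 ρ, ‖u v‖ₑ ^ 2 ∂μ +
        ENNReal.ofReal ρ ^ 4 *
          ∫⁻ v in Metric.closedBall 0 (4 * ρ), ‖fderiv ℝ (fderiv ℝ u) v‖ₑ ^ 2 ∂μ) := by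
  have hu1 : ContDiff ℝ 1 (fderiv ℝ u) := hu.fderiv_right (by norm_num)
  have hc0 : Continuous u := hu.continuous
  have hc1 : Continuous (fderiv ℝ u) := hu1.continuous
  set m := μ (Metric.closedBall (0 : E) (ρ / 2)) with hm
  have hm0 : m ≠ 0 := (Metric.measure_closedBall_pos μ _ (by positivity)).ne'
  have hmt : m ≠ ⊤ := (isCompact_closedBall _ _).measure_ne_top
  have hball : ∀ c : ℝ, 0 < c → μ (Metric.closedBall 0 (c * (ρ / 2))) =
      ENNReal.ofReal (c ^ 2) * m := fun c hc => by
    rw [Measure.addHaar_closedBall_mul μ 0 hc.le (by positivity), hE]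
  set D := Metric.closedBall (0 : E) (4 * ρ) with hD
  set S := Metric.closedBall (0 : E) ρ with hS
  have hDm : MeasurableSet D := Metric.isClosed_closedBall.measurableSet
  have hSm : MeasurableSet S := Metric.isClosed_closedBall.measurableSet
  have hμD : μ D = 64 * m := by
    rw [hD, show 4 * ρ = 8 * (ρ / 2) by ring, hball 8 (by norm_num)]; norm_num
  have hμS : μ S = 4 * m := by
    rw [hS, show Metric.closedBall (0 : E) ρ = Metric.closedBall 0 (2 * (ρ / 2)) by ring_nf,
      hball 2 (by norm_num)]; norm_num
  set I := ∫⁻ v in D, ‖fderiv ℝ (fderiv ℝ u) v‖ₑ ^ 2 ∂μ with hI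
  -- The affine Taylor polynomial of `u` at `v` is `u` minus the remainder. Its coefficients `u v`
  -- and `Du(v)` are read off on the small ball, where only `u` itself and the remainder occur.
  have hpt : ∀ v ∈ D, m * (‖u v‖ₑ ^ 2 + ENNReal.ofReal ρ ^ 2 * ‖fderiv ℝ u v‖ₑ ^ 2) ≤
      4000 * ∫⁻ q in S, (‖u q‖ₑ ^ 2 + ‖taylorRem u q v‖ₑ ^ 2) ∂μ := by
    intro v hv
    rw [hD, mem_closedBall_zero_iff] at hv
    refine (measure_mul_affine_le μ hρ hv).trans ?_
    rw [show (4000 : ℝ≥0∞) = 2000 * 2 by norm_num, mul_assoc]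
    gcongr
    rw [← lintegral_const_mul' _ _ (by finiteness)]
    refine lintegral_mono fun q => ?_
    have : u v + fderiv ℝ u v (q - v) = u q + -taylorRem u q v := by
      rw [taylorRem]; abel
    rw [this]
    simpa only [enorm_neg] using enorm_add_sq_le (u q) (-taylorRem u q v)
  have hint : m * ∫⁻ v in D, (‖u v‖ₑ ^ 2 + ENNReal.ofReal ρ ^ 2 * ‖fderiv ℝ u v‖ₑ ^ 2) ∂μ ≤
      m * (10 ^ 9 * (∫⁻ v in S, ‖u v‖ₑ ^ 2 ∂μ + ENNReal.ofReal ρ ^ 4 * I)) := by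
    calc _ ≤ ∫⁻ v in D, 4000 * ∫⁻ q in S, (‖u q‖ₑ ^ 2 + ‖taylorRem u q v‖ₑ ^ 2) ∂μ ∂μ := by
          rw [← lintegral_const_mul' _ _ hmt]
          exact setLIntegral_mono' hDm hpt
      -- Exchanging the integrals fixes the evaluation point `q` and lets the expansion point `v`
      -- vary, the setting of `lintegral_taylorRem_le`.
      _ = 4000 * ∫⁻ q in S, (μ D * ‖u q‖ₑ ^ 2 + ∫⁻ v in D, ‖taylorRem u q v‖ₑ ^ 2 ∂μ) ∂μ := by
          rw [lintegral_const_mul' _ _ (by finiteness), lintegral_lintegral_swap]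
          · congr 1
            refine lintegral_congr fun q => ?_
            rw [lintegral_add_left measurable_const, setLIntegral_const, mul_comm]
          · apply Continuous.aemeasurable
            unfold taylorRem Function.uncurry
            fun_prop
      _ ≤ 4000 * ∫⁻ q in S, (μ D * ‖u q‖ₑ ^ 2 + ENNReal.ofReal (8 * ρ) ^ 4 * I) ∂μ := by
          gcongr 4000 * ?_
          refine setLIntegral_mono' hSm fun q hq => ?_
          gcongr
          refine lintegral_taylorRem_le μ hE hu (convex_closedBall _ _) hDm ?_ fun v hv => ?_
          · exact Metric.closedBall_subset_closedBall (by linarith) hq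
          · rw [mem_closedBall_zero_iff] at hv
            rw [hS, mem_closedBall_zero_iff] at hq
            exact (norm_sub_le _ _).trans (by linarith)
      _ = 4000 * (64 * m * ∫⁻ q in S, ‖u q‖ₑ ^ 2 ∂μ +
            (4096 * ENNReal.ofReal ρ ^ 4 * I) * (4 * m)) := by
          rw [lintegral_add_right _ measurable_const, setLIntegral_const, hμD, hμS,
            lintegral_const_mul' _ _ (by finiteness), ENNReal.ofReal_mul (by norm_num), mul_pow]
          norm_num
      _ = m * (256000 * ∫⁻ q in S, ‖u q‖ₑ ^ 2 ∂μ + 65536000 * (ENNReal.ofReal ρ ^ 4 * I)) := by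
          ring
      _ ≤ _ := by
          rw [mul_add (10 ^ 9 : ℝ≥0∞)]
          gcongr <;> norm_num
  exact (ENNReal.mul_le_mul_iff_right hm0 hmt).1 hint

end Analysis

/-! ### Local equations, tangent planes and the field of tangent projections. -/

section Charts

/-! ### Graph charts of a closed surface -/

/-- `φ` is a `C³` local equation of `M` on the open set `U`. -/
structure IsLocalEquation (M U : Set E3) (φ : E3 → ℝ) : Prop where
  isOpen : IsOpen U
  contDiffOn : ContDiffOn ℝ 3 φ U
  fderiv_ne_zero : ∀ q ∈ U, fderiv ℝ φ q ≠ 0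
  inter_eq : M ∩ U = {q ∈ U | φ q = 0}

namespace IsLocalEquation

variable {M U : Set E3} {φ : E3 → ℝ}

theorem mem_iff (h : IsLocalEquation M U φ) {q : E3} (hq : q ∈ U) : q ∈ M ↔ φ q = 0 := by
  have := Set.ext_iff.1 h.inter_eq q
  simp only [Set.mem_inter_iff, hq, and_true, Set.mem_ofPred_eq, true_and] at this
  exact this

theorem contDiffAt (h : IsLocalEquation M U φ) {q : E3} (hq : q ∈ U) : ContDiffAt ℝ 3 φ q :=
  h.contDiffOn.contDiffAt (h.isOpen.mem_nhds hq)

theorem hasFDerivAt (h : IsLocalEquation M U φ) {q : E3} (hq : q ∈ U) :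
    HasFDerivAt φ (fderiv ℝ φ q) q :=
  ((h.contDiffAt hq).differentiableAt (by norm_num)).hasFDerivAt

theorem gradient_ne_zero (h : IsLocalEquation M U φ) {q : E3} (hq : q ∈ U) :
    gradient φ q ≠ 0 := by
  simpa [gradient] using h.fderiv_ne_zero q hq

theorem inner_gradient (φ : E3 → ℝ) (q w : E3) :
    inner ℝ (gradient φ q) w = fderiv ℝ φ q w := by
  simp [gradient]

theorem contDiffAt_gradient (h : IsLocalEquation M U φ) {q : E3} (hq : q ∈ U) :
    ContDiffAt ℝ 2 (gradient φ) q := by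
  have h1 : ContDiffAt ℝ 2 (fderiv ℝ φ) q := (h.contDiffAt hq).fderiv_right (by norm_num)
  exact (InnerProductSpace.toDual ℝ E3).symm.contDiff.contDiffAt.comp q h1

/-- Both the base point and the direction are parameters: the equation `φ (y + s n) = 0` is solved
for `s` near `((p, ∇φ p), 0)`, where its derivative in `s` is `‖∇φ p‖²`. A single implicit function
thus serves the graphs over the tangent planes at all points near `p`, which makes the chart bounds
uniform. -/
theorem exists_implicit (h : IsLocalEquation M U φ) {p : E3} (hpM : p ∈ M) (hpU : p ∈ U) :
    ∃ σ : E3 × E3 → ℝ, ContDiffAt ℝ 3 σ (p, gradient φ p) ∧ σ (p, gradient φ p) = 0 ∧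
      ∀ᶠ w in 𝓝 ((p, gradient φ p), (0 : ℝ)), φ (w.1.1 + w.2 • w.1.2) = 0 ↔ σ w.1 = w.2 := by
  set N := gradient φ p with hN
  set f : (E3 × E3) × ℝ → ℝ := fun w => φ (w.1.1 + w.2 • w.1.2) with hf
  have hp0 : φ p = 0 := (h.mem_iff hpU).1 hpM
  have hfu : f ((p, N), 0) = 0 := by simp [hf, hp0]
  have hcd : ContDiffAt ℝ 3 f ((p, N), 0) := by
    have h1 : ContDiffAt ℝ 3 φ ((fun w : (E3 × E3) × ℝ => w.1.1 + w.2 • w.1.2) ((p, N), 0)) := by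
      simpa using h.contDiffAt hpU
    exact ContDiffAt.comp (g := φ) (f := fun w : (E3 × E3) × ℝ => w.1.1 + w.2 • w.1.2) _ h1
      (by fun_prop)
  have hder : (fderiv ℝ f ((p, N), 0) ∘L .inr ℝ (E3 × E3) ℝ) 1 = ‖N‖ ^ 2 := by
    have h1 : HasDerivAt (fun s : ℝ => f ((p, N), s)) (‖N‖ ^ 2) 0 := by
      have h2 : HasDerivAt (fun s : ℝ => p + s • N) N 0 := by
        simpa using ((hasDerivAt_id (0 : ℝ)).smul_const N).const_add p
      have h3 : HasFDerivAt φ (fderiv ℝ φ p) (p + (0 : ℝ) • N) := by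
        simpa using h.hasFDerivAt hpU
      have h4 := h3.comp_hasDerivAt (0 : ℝ) h2
      rwa [← inner_gradient, real_inner_self_eq_norm_sq] at h4
    have h2 : HasDerivAt (fun s : ℝ => f ((p, N), s))
        (fderiv ℝ f ((p, N), 0) ((0 : E3 × E3), (1 : ℝ))) 0 :=
      (hcd.differentiableAt (by norm_num)).hasFDerivAt.comp_hasDerivAt (0 : ℝ)
        ((hasDerivAt_const (0 : ℝ) (p, N)).prodMk (hasDerivAt_id (0 : ℝ)))
    simpa using h2.unique h1
  have hinv : (fderiv ℝ f ((p, N), 0) ∘L .inr ℝ (E3 × E3) ℝ).IsInvertible := by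
    have hne : (fderiv ℝ f ((p, N), 0) ∘L .inr ℝ (E3 × E3) ℝ) 1 ≠ 0 := by
      rw [hder]
      exact pow_ne_zero _ (norm_ne_zero_iff.2 (h.gradient_ne_zero hpU))
    refine ⟨ContinuousLinearEquiv.unitsEquivAut ℝ (Units.mk0 _ hne), ?_⟩
    ext
    simp
  refine ⟨hcd.implicitFunction (by norm_num) hinv, hcd.contDiffAt_implicitFunction _ hinv,
    hcd.implicitFunction_apply_self _ hinv, ?_⟩
  simpa only [hfu] using hcd.eventually_apply_eq_iff_implicitFunction (by norm_num) hinv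

end IsLocalEquation

theorem mem_tangentPlane_of_hasFDerivAt {E : Type*} [NormedAddCommGroup E] [NormedSpace ℝ E]
    {M : Set E3} {γ : E → E3} {γ' : E →L[ℝ] E3} {v : E} (h : HasFDerivAt γ γ' v)
    (hM : ∀ᶠ w in 𝓝 v, γ w ∈ M) (e : E) : γ' e ∈ tangentPlane M (γ v) := by
  refine Submodule.subset_span ?_
  have h1 := (h.hasFDerivWithinAt (s := {w | γ w ∈ M})).mapsTo_tangent_cone
    (show e ∈ _ by rw [tangentConeAt_of_mem_nhds hM]; trivial)
  exact tangentConeAt_mono (Set.image_subset_iff.2 fun w hw => hw) h1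

namespace IsLocalEquation

variable {M U : Set E3} {φ : E3 → ℝ}

/-- Since `φ` vanishes on `M`, zero is a derivative of `φ` within `M`, so tangent vectors are
orthogonal to the gradient. Conversely, for `w` orthogonal to the gradient `N`, the line `x + t w`
is pushed onto `M` along `N`; its velocity `w + d N` is annihilated by the derivative of `φ`, which
forces `d = 0`. -/
theorem tangentPlane_eq (h : IsLocalEquation M U φ) {x : E3} (hxM : x ∈ M) (hxU : x ∈ U) :
    tangentPlane M x = (Submodule.span ℝ {gradient φ x})ᗮ := by
  apply le_antisymm
  · refine Submodule.span_le.2 fun y hy => ?_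
    rw [SetLike.mem_coe, Submodule.mem_orthogonal_singleton_iff_inner_right, inner_gradient]
    have h0 : HasFDerivWithinAt φ (0 : E3 →L[ℝ] ℝ) M x := by
      refine (hasFDerivWithinAt_const (0 : ℝ) x M).congr_of_eventuallyEq ?_
        ((h.mem_iff hxU).1 hxM)
      filter_upwards [self_mem_nhdsWithin, mem_nhdsWithin_of_mem_nhds (h.isOpen.mem_nhds hxU)]
        with q hq hqU using (h.mem_iff hqU).1 hq
    exact (h.hasFDerivAt hxU).hasFDerivWithinAt.unique_on h0 hy
  · intro w hw
    rw [Submodule.mem_orthogonal_singleton_iff_inner_right] at hw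
    set N := gradient φ x with hN
    obtain ⟨σ, hσ, hσ0, hev⟩ := h.exists_implicit hxM hxU
    have hline1 : HasDerivAt (fun t : ℝ => x + t • w) w 0 := by
      simpa using ((hasDerivAt_id (0 : ℝ)).smul_const w).const_add x
    have hline : HasDerivAt (fun t : ℝ => (x + t • w, N)) (w, 0) 0 :=
      hline1.prodMk (hasDerivAt_const _ _)
    have hσ' : HasFDerivAt σ (fderiv ℝ σ (x, N)) (x + (0 : ℝ) • w, N) := by
      simpa using (hσ.differentiableAt (by norm_num)).hasFDerivAt
    set d := fderiv ℝ σ (x, N) (w, 0) with hd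
    have hs : HasDerivAt (fun t : ℝ => σ (x + t • w, N)) d 0 := hσ'.comp_hasDerivAt (0 : ℝ) hline
    set γ : ℝ → E3 := fun t => x + t • w + σ (x + t • w, N) • N with hγ
    have hγ0 : γ 0 = x := by simp [hγ, hσ0, hN]
    have hγd : HasDerivAt γ (w + d • N) 0 :=
      hline1.add (hs.smul_const N)
    have hcont : ContinuousAt (fun t : ℝ => ((x + t • w, N), σ (x + t • w, N))) 0 :=
      (hline.continuousAt).prodMk hs.continuousAt
    have hφ : ∀ᶠ t in 𝓝 (0 : ℝ), φ (γ t) = 0 := by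
      have : Tendsto (fun t : ℝ => ((x + t • w, N), σ (x + t • w, N))) (𝓝 0)
          (𝓝 ((x, N), 0)) := by
        simpa [ContinuousAt, hσ0, hN] using hcont
      filter_upwards [this.eventually hev] with t ht
      exact ht.2 rfl
    have hmem : ∀ᶠ t in 𝓝 (0 : ℝ), γ t ∈ M := by
      have hU : ∀ᶠ t in 𝓝 (0 : ℝ), γ t ∈ U :=
        hγd.continuousAt.eventually_mem (by rw [hγ0]; exact h.isOpen.mem_nhds hxU)
      filter_upwards [hφ, hU] with t ht htU using (h.mem_iff htU).2 ht
    have hd0 : d = 0 := by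
      have h1 : HasDerivAt (fun t => φ (γ t)) (fderiv ℝ φ x (w + d • N)) 0 := by
        have h2 : HasFDerivAt φ (fderiv ℝ φ x) (γ 0) := by rw [hγ0]; exact h.hasFDerivAt hxU
        exact h2.comp_hasDerivAt (0 : ℝ) hγd
      have h2 := h1.unique ((hasDerivAt_const (0 : ℝ) (0 : ℝ)).congr_of_eventuallyEq hφ)
      rw [← inner_gradient, inner_add_right, hw, zero_add, inner_smul_right] at h2
      exact (mul_eq_zero.1 h2).resolve_right
        (inner_self_ne_zero.2 (h.gradient_ne_zero hxU))
    have := mem_tangentPlane_of_hasFDerivAt hγd.hasFDerivAt hmem 1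
    simpa [hd0, hγ0] using this

theorem finrank_tangentPlane (h : IsLocalEquation M U φ) {x : E3} (hxM : x ∈ M) (hxU : x ∈ U) :
    Module.finrank ℝ (tangentPlane M x) = 2 := by
  have : Fact (Module.finrank ℝ E3 = 2 + 1) := ⟨by simp⟩
  rw [h.tangentPlane_eq hxM hxU]
  exact Submodule.finrank_orthogonal_span_singleton (h.gradient_ne_zero hxU)

/-- The formula makes sense off `M` as well and shows that the projection is as regular as the
gradient, that is C². -/
theorem tangentProj_eq (h : IsLocalEquation M U φ) {x : E3} (hxM : x ∈ M) (hxU : x ∈ U) :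
    tangentProj M x = ContinuousLinearMap.id ℝ E3 - (‖gradient φ x‖ ^ 2)⁻¹ •
      ((innerSL ℝ (gradient φ x)).smulRight (gradient φ x)) := by
  rw [tangentProj]
  ext1 w
  have h1 : (tangentPlane M x).starProjection w =
      (Submodule.span ℝ {gradient φ x})ᗮ.starProjection w := by
    simp only [h.tangentPlane_eq hxM hxU]
  rw [h1, Submodule.starProjection_orthogonal_val, Submodule.starProjection_singleton]
  simp [smul_smul, div_eq_inv_mul]

end IsLocalEquation

theorem IsClosedC3Surface.exists_localEquation {M : Set E3} (hM : IsClosedC3Surface M) {p : E3}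
    (hp : p ∈ M) : ∃ U φ, IsLocalEquation M U φ ∧ p ∈ U := by
  obtain ⟨U, hU, hpU, φ, h1, h2, h3⟩ := hM.2 p hp
  exact ⟨U, φ, ⟨hU, h1, h2, h3⟩, hpU⟩

theorem IsClosedC3Surface.finrank_tangentPlane {M : Set E3} (hM : IsClosedC3Surface M) {x : E3}
    (hx : x ∈ M) : Module.finrank ℝ (tangentPlane M x) = 2 := by
  obtain ⟨U, φ, h, hxU⟩ := hM.exists_localEquation hx
  exact h.finrank_tangentPlane hx hxU

open scoped Manifold ContDiff in
/-- The field of orthogonal projections to the tangent planes extends to a `C²` field on `ℝ³`. -/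
theorem IsClosedC3Surface.exists_contDiff_tangentProj {M : Set E3} (hM : IsClosedC3Surface M) :
    ∃ Q : E3 → E3 →L[ℝ] E3, ContDiff ℝ 2 Q ∧ ∀ q ∈ M, Q q = tangentProj M q := by
  -- The constraint is a single point on `M` and void off `M`, hence convex, so a partition of unity
  -- glues the local formulas.
  set t : E3 → Set (E3 →L[ℝ] E3) := fun q => {P | q ∈ M → P = tangentProj M q} with ht
  have hconv : ∀ q, Convex ℝ (t q) := fun q P hP P' hP' a b _ _ hab hq => by
    rw [hP hq, hP' hq]; exact Convex.combo_self hab _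
  have hloc : ∀ q : E3, ∃ U ∈ 𝓝 q, ∃ g : E3 → E3 →L[ℝ] E3,
      ContMDiffOn 𝓘(ℝ, E3) 𝓘(ℝ, E3 →L[ℝ] E3) 2 g U ∧ ∀ y ∈ U, g y ∈ t y := by
    intro q
    by_cases hq : q ∈ M
    · obtain ⟨U, φ, h, hqU⟩ := hM.exists_localEquation hq
      refine ⟨U, h.isOpen.mem_nhds hqU, fun x => ContinuousLinearMap.id ℝ E3 -
        (‖gradient φ x‖ ^ 2)⁻¹ • ((innerSL ℝ (gradient φ x)).smulRight (gradient φ x)), ?_,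
        fun y hy hyM => (h.tangentProj_eq hyM hy).symm⟩
      refine ContDiffOn.contMDiffOn fun x hx => ContDiffAt.contDiffWithinAt ?_
      have h1 := h.contDiffAt_gradient hx
      have h2 : ContDiffAt ℝ 2 (fun x => (‖gradient φ x‖ ^ 2)⁻¹) x :=
        (h1.norm_sq ℝ).inv (by simpa using h.gradient_ne_zero hx)
      have h3 : ContDiffAt ℝ 2 (fun x => innerSL ℝ (gradient φ x)) x :=
        (innerSL ℝ).contDiff.contDiffAt.comp x h1
      exact contDiffAt_const.sub (h2.smul (h3.smulRight h1))
    · refine ⟨Mᶜ, hM.1.isClosed.isOpen_compl.mem_nhds hq, fun _ => 0, contMDiffOn_const,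
        fun y hy hyM => absurd hyM hy⟩
  obtain ⟨Q, hQ⟩ := exists_contMDiffMap_forall_mem_convex_of_local (n := 2) 𝓘(ℝ, E3) hconv hloc
  exact ⟨Q, Q.contMDiff.contDiff, fun q hq => hQ q hq⟩

end Charts

/-! ### Graph charts with uniform radius and C² bounds. -/

section ChartExistence

/-- `g` is a `C²` map, inverse on the ball of radius `r` to the projection of `M` to the tangent plane
at `x`, with first and second derivatives bounded by `C` there. -/
structure IsGraphChart (M : Set E3) (x : E3) (r C : ℝ) (g : tangentPlane M x → E3) : Prop where
  contDiff : ContDiff ℝ 2 g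
  mem : ∀ v, ‖v‖ < r → g v ∈ M
  coord : ∀ v, ‖v‖ < r → tangentCoord M x (g v - x) = v
  eq_of_mem : ∀ q ∈ M, dist q x < r → g (tangentCoord M x (q - x)) = q
  norm_fderiv_le : ∀ v, ‖v‖ < r → ‖fderiv ℝ g v‖ ≤ C
  norm_fderiv_fderiv_le : ∀ v, ‖v‖ < r → ‖fderiv ℝ (fderiv ℝ g) v‖ ≤ C

theorem IsGraphChart.mono {M : Set E3} {x : E3} {r r' C C' : ℝ} {g : tangentPlane M x → E3}
    (h : IsGraphChart M x r C g) (hr : r' ≤ r) (hC : C ≤ C') : IsGraphChart M x r' C' g where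
  contDiff := h.contDiff
  mem v hv := h.mem v (hv.trans_le hr)
  coord v hv := h.coord v (hv.trans_le hr)
  eq_of_mem q hq hd := h.eq_of_mem q hq (hd.trans_le hr)
  norm_fderiv_le v hv := (h.norm_fderiv_le v (hv.trans_le hr)).trans hC
  norm_fderiv_fderiv_le v hv := (h.norm_fderiv_fderiv_le v (hv.trans_le hr)).trans hC

/-- A map which is `C²` on a ball agrees on a smaller ball with a map which is `C²` everywhere. -/
theorem exists_contDiff_eqOn_ball {E F : Type*} [NormedAddCommGroup E] [InnerProductSpace ℝ E]
    [NormedAddCommGroup F] [NormedSpace ℝ F] {f : E → F} {r : ℝ}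
    (hr : 0 < r) (hf : ∀ v, ‖v‖ < r → ContDiffAt ℝ 2 f v) :
    ∃ g : E → F, ContDiff ℝ 2 g ∧ ∀ v, ‖v‖ < r / 2 → g =ᶠ[𝓝 v] f := by
  let χ : ContDiffBump (0 : E) := ⟨r / 2, 3 * r / 4, by positivity, by linarith⟩
  refine ⟨fun v => χ v • f v, contDiff_iff_contDiffAt.2 fun v => ?_, fun v hv => ?_⟩
  · by_cases hv : ‖v‖ < r
    · exact χ.contDiffAt.smul (hf v hv)
    · refine (contDiffAt_const (c := (0 : F))).congr_of_eventuallyEq ?_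
      have : {w : E | 3 * r / 4 < ‖w‖} ∈ 𝓝 v :=
        (isOpen_lt continuous_const continuous_norm).mem_nhds
          (show 3 * r / 4 < ‖v‖ by linarith [not_lt.1 hv])
      filter_upwards [this] with w hw
      rw [χ.zero_of_le_dist (by simpa [χ] using (show 3 * r / 4 < ‖w‖ from hw).le), zero_smul]
  · have := χ.eventuallyEq_one_of_mem_ball (x := v) (by simpa [χ] using hv)
    filter_upwards [this] with w hw
    simp [hw]

variable {M : Set E3}

theorem norm_tangentCoord_le (M : Set E3) (x w : E3) : ‖tangentCoord M x w‖ ≤ ‖w‖ :=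
  (tangentPlane M x).norm_orthogonalProjectionOnto_apply_le w

theorem tangentCoord_coe (M : Set E3) (x : E3) (v : tangentPlane M x) :
    tangentCoord M x (v : E3) = v :=
  (tangentPlane M x).orthogonalProjectionOnto_mem_subspace_eq_self v

theorem tangentCoord_eq_zero {x w : E3} (h : w ∈ (tangentPlane M x)ᗮ) :
    tangentCoord M x w = 0 :=
  Submodule.orthogonalProjectionOnto_apply_of_mem_orthogonal h

theorem sub_tangentCoord_mem (M : Set E3) (x w : E3) :
    w - tangentCoord M x w ∈ (tangentPlane M x)ᗮ :=
  (tangentPlane M x).sub_starProjection_mem_orthogonal w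

/-- Derivatives of the composition of `Γ` with an affine map which is at most `1`-Lipschitz. -/
theorem norm_fderiv_comp_affine_le {E E' F : Type*} [NormedAddCommGroup E] [NormedSpace ℝ E]
    [NormedAddCommGroup E'] [NormedSpace ℝ E'] [NormedAddCommGroup F] [NormedSpace ℝ F]
    {Γ : E' → F} {J : E →L[ℝ] E'} (hJ : ‖J‖ ≤ 1) {a : E'} {C : ℝ} {v : E}
    (hC1 : ‖fderiv ℝ Γ (a + J v)‖ ≤ C) (hC2 : ‖fderiv ℝ (fderiv ℝ Γ) (a + J v)‖ ≤ C)
    (hΓ : ContDiffAt ℝ 2 Γ (a + J v)) :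
    ‖fderiv ℝ (fun v => Γ (a + J v)) v‖ ≤ C ∧
      ‖fderiv ℝ (fderiv ℝ (fun v => Γ (a + J v))) v‖ ≤ C := by
  have hC : 0 ≤ C := (norm_nonneg _).trans hC1
  have hj : ∀ w, HasFDerivAt (fun v => a + J v) J w := fun w => J.hasFDerivAt.const_add a
  have hd : ∀ w, DifferentiableAt ℝ Γ (a + J w) →
      fderiv ℝ (fun v => Γ (a + J v)) w = (fderiv ℝ Γ (a + J w)).comp J := fun w hw =>
    (hw.hasFDerivAt.comp w (hj w)).fderiv
  have hev : ∀ᶠ w in 𝓝 v, DifferentiableAt ℝ Γ (a + J w) := by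
    have h1 : ∀ᶠ y in 𝓝 (a + J v), ContDiffAt ℝ 2 Γ y := hΓ.eventually (by norm_num)
    filter_upwards [(hj v).continuousAt.eventually h1] with w hw
    exact hw.differentiableAt (by norm_num)
  constructor
  · rw [hd v (hΓ.differentiableAt (by norm_num))]
    refine ((fderiv ℝ Γ (a + J v)).opNorm_comp_le J).trans ?_
    nlinarith [norm_nonneg J, norm_nonneg (fderiv ℝ Γ (a + J v))]
  · have h1 : DifferentiableAt ℝ (fderiv ℝ Γ) (a + J v) :=
      (hΓ.fderiv_right (m := 1) (by norm_num)).differentiableAt (by norm_num)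
    have h2 : HasFDerivAt (fun w => (fderiv ℝ Γ (a + J w)).comp J)
        (((ContinuousLinearMap.compL ℝ E E' F).flip J).comp
          ((fderiv ℝ (fderiv ℝ Γ) (a + J v)).comp J)) v :=
      ((ContinuousLinearMap.compL ℝ E E' F).flip J).hasFDerivAt.comp v
        (h1.hasFDerivAt.comp v (hj v))
    have h3 : fderiv ℝ (fun v => Γ (a + J v)) =ᶠ[𝓝 v] fun w => (fderiv ℝ Γ (a + J w)).comp J := by
      filter_upwards [hev] with w hw using hd w hw
    rw [h3.fderiv_eq, h2.fderiv]
    refine ContinuousLinearMap.opNorm_le_bound₂ _ hC fun e e' => ?_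
    have h4 : ∀ e, ‖J e‖ ≤ ‖e‖ := fun e => (J.le_of_opNorm_le hJ e).trans_eq (one_mul _)
    calc ‖fderiv ℝ (fderiv ℝ Γ) (a + J v) (J e) (J e')‖
        ≤ ‖fderiv ℝ (fderiv ℝ Γ) (a + J v)‖ * ‖J e‖ * ‖J e'‖ :=
          ContinuousLinearMap.le_opNorm₂ _ _ _
      _ ≤ C * ‖e‖ * ‖e'‖ := by gcongr <;> exact h4 _

/-- With `Γ (y, n) = y + σ (y, n) n`, the chart over `T_x M` is `v ↦ Γ (x + v, ∇φ x)`. It is `Γ`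
composed with an affine map of norm at most 1, so bounds for `Γ` near `(p, ∇φ p)` hold for all `x`
near `p` at once. -/
theorem IsLocalEquation.exists_isGraphChart {U : Set E3} {φ : E3 → ℝ}
    (h : IsLocalEquation M U φ) {p : E3} (hpM : p ∈ M) (hpU : p ∈ U) :
    ∃ r C : ℝ, 0 < r ∧ ∀ x ∈ M, dist x p < r → ∃ g, IsGraphChart M x r C g := by
  set N := gradient φ p with hN
  have hNpos : 0 < ‖N‖ := norm_pos_iff.2 (h.gradient_ne_zero hpU)
  obtain ⟨σ, hσ, hσ0, hev⟩ := h.exists_implicit hpM hpU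
  set Γ : E3 × E3 → E3 := fun w => w.1 + σ w • w.2 with hΓdef
  have hΓ : ContDiffAt ℝ 2 Γ (p, N) :=
    contDiffAt_fst.add ((hσ.of_le (by norm_num)).smul contDiffAt_snd)
  have hΓ0 : Γ (p, N) = p := by simp [hΓdef, hσ0, hN]
  have hΓ1 : ContDiffAt ℝ 1 (fderiv ℝ Γ) (p, N) := hΓ.fderiv_right (by norm_num)
  have hΓ2 : ContDiffAt ℝ 0 (fderiv ℝ (fderiv ℝ Γ)) (p, N) := hΓ1.fderiv_right (by norm_num)
  set C := max ‖fderiv ℝ Γ (p, N)‖ ‖fderiv ℝ (fderiv ℝ Γ) (p, N)‖ + 1 with hC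
  have e1 : ∀ᶠ w in 𝓝 (p, N), ContDiffAt ℝ 2 Γ w := hΓ.eventually (by norm_num)
  have e2 : ∀ᶠ w in 𝓝 (p, N), ‖fderiv ℝ Γ w‖ < C :=
    hΓ1.continuousAt.norm.eventually_lt_const ((le_max_left _ _).trans_lt (lt_add_one _))
  have e3 : ∀ᶠ w in 𝓝 (p, N), ‖fderiv ℝ (fderiv ℝ Γ) w‖ < C :=
    hΓ2.continuousAt.norm.eventually_lt_const ((le_max_right _ _).trans_lt (lt_add_one _))
  have e4 : ∀ᶠ w in 𝓝 (p, N), Γ w ∈ U :=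
    hΓ.continuousAt.eventually_mem (by rw [hΓ0]; exact h.isOpen.mem_nhds hpU)
  have e5 : ∀ᶠ w in 𝓝 (p, N), φ (Γ w) = 0 := by
    have : Tendsto (fun w => (w, σ w)) (𝓝 (p, N)) (𝓝 ((p, N), (0 : ℝ))) := by
      have := continuousAt_id.prodMk hσ.continuousAt
      simpa only [ContinuousAt, hσ0, id] using this
    filter_upwards [this.eventually hev] with w hw using hw.2 rfl
  obtain ⟨ε₁, hε₁, H1⟩ := Metric.eventually_nhds_iff.1 (e1.and (e2.and (e3.and (e4.and e5))))
  obtain ⟨ε₂, hε₂, H2⟩ := Metric.eventually_nhds_iff.1 hev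
  have hgrad : ContinuousAt (gradient φ) p := (h.contDiffAt_gradient hpU).continuousAt
  obtain ⟨ε₃, hε₃, H3⟩ := Metric.eventually_nhds_iff.1
    ((hgrad.eventually (Metric.ball_mem_nhds N (show 0 < min (min ε₁ ε₂) (‖N‖ / 2) by positivity))).and
      (h.isOpen.mem_nhds hpU))
  -- The last term bounds the height `s` of a nearby point over `T_x M`: `|s| ‖n‖` is at most the
  -- distance to `x`, and `‖n‖ > ‖N‖ / 2`.
  set r := min (min (ε₁ / 2) (ε₂ / 2)) (min (ε₃ / 2) (ε₂ * ‖N‖ / 4)) with hr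
  have hr0 : 0 < r := by positivity
  have hr1 : r ≤ ε₁ / 2 := (min_le_left _ _).trans (min_le_left _ _)
  have hr2 : r ≤ ε₂ / 2 := (min_le_left _ _).trans (min_le_right _ _)
  have hr3 : r ≤ ε₃ / 2 := (min_le_right _ _).trans (min_le_left _ _)
  have hr4 : r ≤ ε₂ * ‖N‖ / 4 := (min_le_right _ _).trans (min_le_right _ _)
  refine ⟨r / 2, C, by positivity, fun x hxM hxp => ?_⟩
  obtain ⟨hNx, hxU⟩ := H3 (show dist x p < ε₃ by linarith)
  set n := gradient φ x with hn
  have hn1 : dist n N < ε₁ := hNx.trans_le ((min_le_left _ _).trans (min_le_left _ _))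
  have hn2 : dist n N < ε₂ := hNx.trans_le ((min_le_left _ _).trans (min_le_right _ _))
  have hn3 : ‖N‖ / 2 < ‖n‖ := by
    have h1 : dist n N < ‖N‖ / 2 := hNx.trans_le (min_le_right _ _)
    rw [dist_eq_norm] at h1
    have h2 : ‖N‖ ≤ ‖n‖ + ‖n - N‖ := by
      simpa [norm_sub_rev] using norm_le_norm_add_norm_sub' N n
    linarith
  have hT := h.tangentPlane_eq hxM hxU
  have hn_mem : n ∈ (tangentPlane M x)ᗮ := by
    rw [hT, Submodule.orthogonal_orthogonal]
    exact Submodule.mem_span_singleton_self n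
  have hperp : ∀ w ∈ (tangentPlane M x)ᗮ, ∃ s : ℝ, s • n = w := fun w hw => by
    rw [hT, Submodule.orthogonal_orthogonal] at hw
    exact Submodule.mem_span_singleton.1 hw
  set J : tangentPlane M x →L[ℝ] E3 × E3 :=
    (ContinuousLinearMap.inl ℝ E3 E3).comp (tangentPlane M x).subtypeL with hJdef
  have hJv : ∀ v : tangentPlane M x, (x, n) + J v = (x + v, n) := fun v => by simp [hJdef]
  have hJ : ‖J‖ ≤ 1 := by
    refine ContinuousLinearMap.opNorm_le_bound _ zero_le_one fun v => ?_
    simp [hJdef, Prod.norm_def]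
  have hdist : ∀ v : tangentPlane M x, ‖v‖ < r → dist ((x, n) + J v) (p, N) < ε₁ := by
    intro v hv
    rw [hJv, Prod.dist_eq]
    refine max_lt ?_ hn1
    calc dist (x + v) p ≤ dist (x + (v : E3)) x + dist x p := dist_triangle _ _ _
      _ < r + r := by
        refine add_lt_add ?_ (hxp.trans (by linarith))
        simpa [dist_eq_norm] using hv
      _ ≤ ε₁ := by linarith
  -- A cutoff makes the chart C² on the whole plane, at the price of halving the radius.
  obtain ⟨g, hg, hgeq⟩ := exists_contDiff_eqOn_ball (f := fun v => Γ ((x, n) + J v)) hr0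
    (fun v hv =>
      ContDiffAt.comp (g := Γ) (f := fun v => (x, n) + J v) v (H1 (hdist v hv)).1
        (contDiffAt_const.add J.contDiff.contDiffAt))
  have hgv : ∀ v, ‖v‖ < r / 2 → g v = Γ (x + v, n) := fun v hv => by
    rw [(hgeq v hv).eq_of_nhds, hJv]
  refine ⟨g, hg, fun v hv => ?_, fun v hv => ?_, fun q hq hqx => ?_, fun v hv => ?_,
    fun v hv => ?_⟩
  · have h1 := H1 (hdist v (by linarith))
    rw [hgv v hv, ← hJv]
    exact (h.mem_iff h1.2.2.2.1).2 h1.2.2.2.2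
  · rw [hgv v hv]
    simp only [hΓdef]
    rw [add_assoc, add_sub_cancel_left, map_add, map_smul, tangentCoord_coe,
      tangentCoord_eq_zero hn_mem, smul_zero, add_zero]
  · set v := tangentCoord M x (q - x) with hv
    have hvr : ‖v‖ < r / 2 := by
      refine (norm_tangentCoord_le M x _).trans_lt ?_
      rwa [← dist_eq_norm]
    obtain ⟨s, hs⟩ := hperp _ (sub_tangentCoord_mem M x (q - x))
    have hqs : q = x + v + s • n := by rw [hs]; abel
    have hqU : q ∈ U := (H3 (show dist q p < ε₃ by
      linarith [dist_triangle q x p])).2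
    have hs1 : |s| < ε₂ := by
      have h1 : ‖s • n‖ ≤ ‖q - x‖ := by
        rw [hs]
        have h2 := (tangentPlane M x)ᗮ.norm_starProjection_apply_le (q - x)
        rwa [Submodule.starProjection_orthogonal_val] at h2
      rw [norm_smul, Real.norm_eq_abs, ← dist_eq_norm] at h1
      by_contra hcon
      have h3 : ε₂ * (‖N‖ / 2) ≤ |s| * ‖n‖ := by
        gcongr
        exact not_lt.1 hcon
      nlinarith
    have hclose : dist (((x + v, n), s) : (E3 × E3) × ℝ) ((p, N), 0) < ε₂ := by
      rw [Prod.dist_eq, Prod.dist_eq]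
      refine max_lt (max_lt ?_ hn2) (by simpa using hs1)
      calc dist (x + v) p ≤ dist (x + (v : E3)) x + dist x p := dist_triangle _ _ _
        _ < r + r := by
          refine add_lt_add ?_ (hxp.trans (by linarith))
          have : ‖v‖ < r := by linarith
          simpa [dist_eq_norm] using this
        _ ≤ ε₂ := by linarith
    -- Uniqueness in the implicit function theorem: a point `x + v + s n` of `M` close to `x` has `s
    -- = σ (x + v, n)`.
    have h4 := (H2 hclose).1 (by
      simp only
      rw [← hqs]
      exact (h.mem_iff hqU).1 hq)
    rw [hgv v hvr]
    simp only [hΓdef] at h4 ⊢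
    rw [h4, ← hqs]
  all_goals
    have h1 := H1 (hdist v (by linarith))
    have h2 := norm_fderiv_comp_affine_le hJ h1.2.1.le h1.2.2.1.le h1.1
  · rw [(hgeq v hv).fderiv_eq]
    exact h2.1
  · rw [(hgeq v hv).fderiv.fderiv_eq]
    exact h2.2

/-- The surface has graph charts over all its tangent planes, with uniform radius and bounds. -/
theorem IsClosedC3Surface.exists_uniform_isGraphChart (hM : IsClosedC3Surface M) :
    ∃ r C : ℝ, 0 < r ∧ 1 ≤ C ∧ ∀ x ∈ M, ∃ g, IsGraphChart M x r C g := by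
  set P : Set E3 → Prop := fun S =>
    ∃ r C : ℝ, 0 < r ∧ ∀ x ∈ S ∩ M, ∃ g, IsGraphChart M x r C g with hP
  have : P M := by
    refine hM.1.induction_on (p := P) ⟨1, 0, one_pos, by simp⟩
      (fun S S' hS ⟨r, C, hr, h⟩ => ⟨r, C, hr, fun x hx => h x ⟨hS hx.1, hx.2⟩⟩)
      (fun S S' ⟨r, C, hr, h⟩ ⟨r', C', hr', h'⟩ => ⟨min r r', max C C', lt_min hr hr', ?_⟩) ?_
    · rintro x ⟨hx | hx, hxM⟩
      · obtain ⟨g, hg⟩ := h x ⟨hx, hxM⟩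
        exact ⟨g, hg.mono (min_le_left _ _) (le_max_left _ _)⟩
      · obtain ⟨g, hg⟩ := h' x ⟨hx, hxM⟩
        exact ⟨g, hg.mono (min_le_right _ _) (le_max_right _ _)⟩
    · intro p hp
      obtain ⟨U, φ, h, hpU⟩ := hM.exists_localEquation hp
      obtain ⟨r, C, hr, hx⟩ := h.exists_isGraphChart hp hpU
      exact ⟨Metric.ball p r, mem_nhdsWithin_of_mem_nhds (Metric.ball_mem_nhds p hr), r, C, hr,
        fun x hx' => hx x hx'.2 hx'.1⟩
  obtain ⟨r, C, hr, h⟩ := this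
  refine ⟨r, max C 1, hr, le_max_right _ _, fun x hx => ?_⟩
  obtain ⟨g, hg⟩ := h x ⟨hx, hx⟩
  exact ⟨g, hg.mono le_rfl (le_max_left _ _)⟩

end ChartExistence

/-! ### Charts as inverses of the projection, and extensions of covariant derivatives. -/

section ChartConsequences

variable {M : Set E3} {x : E3} {r C : ℝ} {g : tangentPlane M x → E3}

/-- The tool for differentiating an identity known on `M` only: it may be differentiated in tangent
directions. -/
theorem eq_of_hasFDerivAt_of_eqOn {G : Type*} [NormedAddCommGroup G] [NormedSpace ℝ G]
    {F₁ F₂ : E3 → G} {F₁' F₂' : E3 →L[ℝ] G} {q : E3} (hq : q ∈ M) (h₁ : HasFDerivAt F₁ F₁' q)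
    (h₂ : HasFDerivAt F₂ F₂' q) (h : ∀ p ∈ M, F₁ p = F₂ p) {t : E3}
    (ht : t ∈ tangentPlane M q) : F₁' t = F₂' t := by
  have h₁' : HasFDerivWithinAt F₂ F₁' M q :=
    h₁.hasFDerivWithinAt.congr (fun p hp => (h p hp).symm) (h q hq).symm
  exact LinearMap.eqOn_span (f := F₁'.toLinearMap) (g := F₂'.toLinearMap)
    (h₁'.unique_on h₂.hasFDerivWithinAt) ht

theorem tangentProj_apply_of_mem {q t : E3} (ht : t ∈ tangentPlane M q) :
    tangentProj M q t = t :=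
  Submodule.starProjection_eq_self_iff.2 ht

theorem tangentProj_mem (M : Set E3) (q t : E3) : tangentProj M q t ∈ tangentPlane M q :=
  Submodule.starProjection_apply_mem _ _

theorem norm_tangentProj_apply_le (M : Set E3) (q t : E3) : ‖tangentProj M q t‖ ≤ ‖t‖ :=
  Submodule.norm_starProjection_apply_le _ _

namespace IsGraphChart

theorem differentiable (h : IsGraphChart M x r C g) : Differentiable ℝ g :=
  h.contDiff.differentiable (by norm_num)

theorem lipschitzOnWith (h : IsGraphChart M x r C g) :
    LipschitzOnWith C.toNNReal g (Metric.ball 0 r) := by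
  refine (convex_ball (0 : tangentPlane M x) r).lipschitzOnWith_of_nnnorm_fderiv_le
    (𝕜 := ℝ) (fun v _ => h.differentiable v) fun v hv => ?_
  rw [← NNReal.coe_le_coe, coe_nnnorm]
  exact (h.norm_fderiv_le v (mem_ball_zero_iff.1 hv)).trans (Real.le_coe_toNNReal C)

theorem dist_le (h : IsGraphChart M x r C g) (hC : 1 ≤ C) {v w : tangentPlane M x}
    (hv : ‖v‖ < r) (hw : ‖w‖ < r) : dist (g v) (g w) ≤ C * dist v w := by
  have := h.lipschitzOnWith.dist_le_mul v (mem_ball_zero_iff.2 hv) w (mem_ball_zero_iff.2 hw)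
  rwa [Real.coe_toNNReal C (by linarith)] at this

theorem apply_zero (h : IsGraphChart M x r C g) (hx : x ∈ M) (hr : 0 < r) : g 0 = x := by
  have := h.eq_of_mem x hx (by simpa using hr)
  simpa using this

theorem dist_base_le (h : IsGraphChart M x r C g) (hx : x ∈ M) (hC : 1 ≤ C)
    {v : tangentPlane M x} (hv : ‖v‖ < r) : dist (g v) x ≤ C * ‖v‖ := by
  have hr : 0 < r := (norm_nonneg v).trans_lt hv
  have := h.dist_le hC hv (w := 0) (by simpa using hr)
  rwa [h.apply_zero hx hr, dist_zero_right] at this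

theorem lt_of_lt_div (hC : 1 ≤ C) {s : ℝ} (hs0 : 0 ≤ s) (hs : s < r / C) : s < r ∧ C * s < r := by
  have h1 : s * C < r := (lt_div_iff₀ (by linarith)).1 hs
  exact ⟨by nlinarith, by linarith⟩

theorem dist_base_lt (h : IsGraphChart M x r C g) (hx : x ∈ M) (hC : 1 ≤ C)
    {v : tangentPlane M x} (hv : ‖v‖ < r / C) : dist (g v) x < r :=
  (h.dist_base_le hx hC (lt_of_lt_div hC (norm_nonneg v) hv).1).trans_lt
    (lt_of_lt_div hC (norm_nonneg v) hv).2

/-- For `‖v‖ < r / C` the chart value lies within `r` of `x`. Any point of `M` over `v` that is at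
least as close lies in the region where the projection is inverted by `g`, so the nearest point
selected by `graphParam` is `g v`. -/
theorem graphParam_eq (h : IsGraphChart M x r C g) (hx : x ∈ M) (hC : 1 ≤ C)
    {v : tangentPlane M x} (hv : ‖v‖ < r / C) : graphParam M x v = g v := by
  have hvr := (lt_of_lt_div hC (norm_nonneg v) hv).1
  have hd := h.dist_base_lt hx hC hv
  have huniq : ∀ q ∈ M, tangentCoord M x (q - x) = v → dist q x < r → q = g v :=
    fun q hq hqv hqr => by rw [← h.eq_of_mem q hq hqr, hqv]
  have hex : ∃ p, p ∈ M ∧ tangentCoord M x (p - x) = v ∧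
      ∀ q ∈ M, tangentCoord M x (q - x) = v → dist p x ≤ dist q x := by
    refine ⟨g v, h.mem v hvr, h.coord v hvr, fun q hq hqv => ?_⟩
    by_contra hlt
    rw [huniq q hq hqv ((not_le.1 hlt).trans hd)] at hlt
    exact hlt le_rfl
  obtain ⟨h1, h2, h3⟩ := Classical.epsilon_spec hex
  exact huniq _ h1 h2 ((h3 _ (h.mem v hvr) (h.coord v hvr)).trans_lt hd)

theorem graphParam_eventuallyEq (h : IsGraphChart M x r C g) (hx : x ∈ M) (hC : 1 ≤ C)
    {v : tangentPlane M x} (hv : ‖v‖ < r / C) : graphParam M x =ᶠ[𝓝 v] g := by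
  filter_upwards [continuous_norm.continuousAt.eventually_lt_const hv] with w hw
  exact h.graphParam_eq hx hC hw

theorem fderiv_mem (h : IsGraphChart M x r C g) {v : tangentPlane M x} (hv : ‖v‖ < r)
    (e : tangentPlane M x) : fderiv ℝ g v e ∈ tangentPlane M (g v) := by
  refine mem_tangentPlane_of_hasFDerivAt (h.differentiable v).hasFDerivAt ?_ e
  filter_upwards [continuous_norm.continuousAt.eventually_lt_const hv] with w hw
  exact h.mem w hw

/-- The composition of `g` with the projection is the identity of `M` near `x`; this is its
derivative in tangent directions. -/
theorem fderiv_tangentCoord (h : IsGraphChart M x r C g) {v : tangentPlane M x} (hv : ‖v‖ < r)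
    (hd : dist (g v) x < r) {t : E3} (ht : t ∈ tangentPlane M (g v)) :
    fderiv ℝ g v (tangentCoord M x t) = t := by
  set q := g v with hq
  have hv' : tangentCoord M x (q - x) = v := h.coord v hv
  have h1 : HasFDerivAt (fun p => g (tangentCoord M x (p - x)))
      ((fderiv ℝ g v).comp (tangentCoord M x)) q := by
    have h2 : HasFDerivAt g (fderiv ℝ g v) (tangentCoord M x (q - x)) := by
      rw [hv']; exact (h.differentiable v).hasFDerivAt
    exact h2.comp q ((tangentCoord M x).hasFDerivAt.comp q ((hasFDerivAt_id q).sub_const x))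
  have h3 : HasFDerivWithinAt (fun p => p) ((fderiv ℝ g v).comp (tangentCoord M x)) M q := by
    refine h1.hasFDerivWithinAt.congr_of_eventuallyEq ?_ ?_
    · have : Metric.ball x r ∈ 𝓝[M] q :=
        mem_nhdsWithin_of_mem_nhds (Metric.isOpen_ball.mem_nhds hd)
      filter_upwards [self_mem_nhdsWithin, this] with p hp hpx
      exact (h.eq_of_mem p hp hpx).symm
    · exact (h.eq_of_mem q (h.mem v hv) hd).symm
  exact LinearMap.eqOn_span
    (f := ((fderiv ℝ g v).comp (tangentCoord M x)).toLinearMap)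
    (g := (ContinuousLinearMap.id ℝ E3).toLinearMap)
    (h3.unique_on (hasFDerivWithinAt_id q M)) ht

end IsGraphChart

/-! ### Covariant derivatives of `C²` fields -/

/-- `Q` is a `C²` extension of the field of tangent projections of `M`, with first and second
derivatives bounded by `K` on `M`. -/
structure IsProjExtension (M : Set E3) (Q : E3 → E3 →L[ℝ] E3) (K : ℝ) : Prop where
  contDiff : ContDiff ℝ 2 Q
  eq_tangentProj : ∀ q ∈ M, Q q = tangentProj M q
  norm_fderiv_le : ∀ q ∈ M, ‖fderiv ℝ Q q‖ ≤ K
  norm_fderiv_fderiv_le : ∀ q ∈ M, ‖fderiv ℝ (fderiv ℝ Q) q‖ ≤ K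

theorem IsClosedC3Surface.exists_isProjExtension (hM : IsClosedC3Surface M) :
    ∃ Q K, 1 ≤ K ∧ IsProjExtension M Q K := by
  obtain ⟨Q, hQ, hQM⟩ := hM.exists_contDiff_tangentProj
  have h1 : ContDiff ℝ 1 (fderiv ℝ Q) := hQ.fderiv_right (by norm_num)
  obtain ⟨K₁, hK₁⟩ := hM.1.exists_bound_of_continuousOn h1.continuous.continuousOn
  obtain ⟨K₂, hK₂⟩ := hM.1.exists_bound_of_continuousOn
    (h1.continuous_fderiv (by norm_num)).continuousOn
  exact ⟨Q, max 1 (max K₁ K₂), le_max_left _ _, hQ, hQM,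
    fun q hq => (hK₁ q hq).trans ((le_max_left _ _).trans (le_max_right _ _)),
    fun q hq => (hK₂ q hq).trans ((le_max_right _ _).trans (le_max_right _ _))⟩

/-- A `C²` vector field on `ℝ³` tangent to `M`. -/
structure IsSmoothTangent (M : Set E3) (V : E3 → E3) : Prop where
  contDiff : ContDiff ℝ 2 V
  tangent : IsTangentField M V

/-- The extension `Q ∘ DV ∘ Q` of the covariant derivative of `V`. -/
def covExt (Q : E3 → E3 →L[ℝ] E3) (V : E3 → E3) (q : E3) : E3 →L[ℝ] E3 :=
  (Q q).comp ((fderiv ℝ V q).comp (Q q))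

variable {Q : E3 → E3 →L[ℝ] E3} {K : ℝ} {V : E3 → E3}

namespace IsProjExtension

theorem apply_of_mem (hQ : IsProjExtension M Q K) {q t : E3} (hq : q ∈ M)
    (ht : t ∈ tangentPlane M q) : Q q t = t := by
  rw [hQ.eq_tangentProj q hq, tangentProj_apply_of_mem ht]

theorem apply_mem (hQ : IsProjExtension M Q K) {q : E3} (hq : q ∈ M) (t : E3) :
    Q q t ∈ tangentPlane M q := by
  rw [hQ.eq_tangentProj q hq]
  exact tangentProj_mem M q t

theorem norm_apply_le (hQ : IsProjExtension M Q K) {q : E3} (hq : q ∈ M) (t : E3) :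
    ‖Q q t‖ ≤ ‖t‖ := by
  rw [hQ.eq_tangentProj q hq]
  exact norm_tangentProj_apply_le M q t

theorem hasFDerivAt (hQ : IsProjExtension M Q K) (q : E3) : HasFDerivAt Q (fderiv ℝ Q q) q :=
  (hQ.contDiff.differentiable (by norm_num) q).hasFDerivAt

theorem contDiff_covExt (hQ : IsProjExtension M Q K) (hV : IsSmoothTangent M V) :
    ContDiff ℝ 1 (covExt Q V) := by
  have h1 : ContDiff ℝ 1 (fderiv ℝ V) := hV.contDiff.fderiv_right (by norm_num)
  have h2 : ContDiff ℝ 1 Q := hQ.contDiff.of_le (by norm_num)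
  exact h2.clm_comp (h1.clm_comp h2)

theorem covDeriv_eq (hQ : IsProjExtension M Q K) (hV : IsSmoothTangent M V) {q : E3}
    (hq : q ∈ M) : covDeriv M V q = covExt Q V q := by
  have h1 : HasFDerivAt V (fderiv ℝ V q) q :=
    (hV.contDiff.differentiable (by norm_num) q).hasFDerivAt
  rw [covDeriv, tangentialDeriv_eq h1.hasFDerivWithinAt, covExt, hQ.eq_tangentProj q hq]

theorem covDeriv₂_apply_eq (hQ : IsProjExtension M Q K) (hV : IsSmoothTangent M V) {q : E3}
    (hq : q ∈ M) (u w : E3) :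
    covDeriv₂ M V q u w = Q q (fderiv ℝ (covExt Q V) q (Q q u) (Q q w)) := by
  have h1 : HasFDerivAt (covExt Q V) (fderiv ℝ (covExt Q V) q) q :=
    ((hQ.contDiff_covExt hV).differentiable (by norm_num) q).hasFDerivAt
  have h2 : HasFDerivWithinAt (covDeriv M V) (fderiv ℝ (covExt Q V) q) M q :=
    h1.hasFDerivWithinAt.congr (fun p hp => hQ.covDeriv_eq hV hp) (hQ.covDeriv_eq hV hq)
  rw [covDeriv₂_apply, tangentialDeriv_eq h2, hQ.eq_tangentProj q hq]
  rfl

theorem idem (hQ : IsProjExtension M Q K) {q : E3} (hq : q ∈ M) : (Q q).comp (Q q) = Q q := by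
  ext1 t
  exact hQ.apply_of_mem hq (hQ.apply_mem hq t)

/-- Obtained by differentiating `V = Q V` along `M`. The full derivative along `M` is the covariant
one plus a term of order zero in `V`. -/
theorem fderiv_apply_eq (hQ : IsProjExtension M Q K) (hV : IsSmoothTangent M V) {q t : E3}
    (hq : q ∈ M) (ht : t ∈ tangentPlane M q) :
    fderiv ℝ V q t = fderiv ℝ Q q t (V q) + covExt Q V q t := by
  have h1 : HasFDerivAt V (fderiv ℝ V q) q :=
    (hV.contDiff.differentiable (by norm_num) q).hasFDerivAt
  have h2 := (hQ.hasFDerivAt q).clm_apply h1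
  have h3 := eq_of_hasFDerivAt_of_eqOn hq h1 h2
    (fun p hp => (hQ.apply_of_mem hp (hV.tangent p hp)).symm) ht
  rw [h3, covExt]
  simp [hQ.apply_of_mem hq ht, add_comm]

/-- The derivative of the extended covariant derivative along `M`, in terms of `∇²V`. -/
theorem fderiv_covExt_apply (hQ : IsProjExtension M Q K) (hV : IsSmoothTangent M V) {q t : E3}
    (hq : q ∈ M) (ht : t ∈ tangentPlane M q) :
    fderiv ℝ (covExt Q V) q t = (fderiv ℝ Q q t).comp (covExt Q V q) +
      (covDeriv₂ M V q t + (covExt Q V q).comp (fderiv ℝ Q q t)) := by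
  have h1 : HasFDerivAt (covExt Q V) (fderiv ℝ (covExt Q V) q) q :=
    ((hQ.contDiff_covExt hV).differentiable (by norm_num) q).hasFDerivAt
  have h2 := (hQ.hasFDerivAt q).clm_comp (h1.clm_comp (hQ.hasFDerivAt q))
  -- The covariant derivative is unchanged by the projections on either side. When this is
  -- differentiated, the derivative falling on the middle factor is `∇²V`, the other two terms are
  -- of lower order.
  have hA : ∀ p ∈ M, (Q p).comp ((covExt Q V p).comp (Q p)) = covExt Q V p := fun p hp => by
    ext1 w
    simp only [covExt, ContinuousLinearMap.comp_apply]
    rw [hQ.apply_of_mem hp (hQ.apply_mem hp w), hQ.apply_of_mem hp (hQ.apply_mem hp _)]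
  have h3 := eq_of_hasFDerivAt_of_eqOn hq h1 h2 (fun p hp => (hA p hp).symm) ht
  rw [h3]
  ext1 w
  simp only [add_apply, ContinuousLinearMap.comp_apply,
    ContinuousLinearMap.compL_apply, ContinuousLinearMap.flip_apply, map_add]
  rw [hQ.covDeriv₂_apply_eq hV hq, hQ.apply_of_mem hq ht]
  have hB : covExt Q V q (Q q w) = covExt Q V q w := by
    simp only [covExt, ContinuousLinearMap.comp_apply]
    rw [hQ.apply_of_mem hq (hQ.apply_mem hq w)]
  have hC : ∀ w, Q q (covExt Q V q w) = covExt Q V q w := fun w =>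
    hQ.apply_of_mem hq (hQ.apply_mem hq _)
  rw [hB, hC]
  abel

end IsProjExtension

end ChartConsequences

/-! ### Chart derivatives against covariant derivatives, and area against plane measure. -/

section FieldInChart

variable {M : Set E3} {x : E3} {r C : ℝ} {g : tangentPlane M x → E3}
  {Q : E3 → E3 →L[ℝ] E3} {K : ℝ} {V : E3 → E3}

theorem second_derivative_constant_le {K C a b c : ℝ} (hK : 1 ≤ K) (hC : 1 ≤ C) (ha0 : 0 ≤ a)
    (hb0 : 0 ≤ b) (hc0 : 0 ≤ c) :
    (K * C ^ 2 + K * C) * a + K ^ 2 * C ^ 2 * (a + b) + (2 * K * b + c) * C ^ 2 + b * C ≤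
      4 * K ^ 2 * C ^ 2 * (a + b + c) := by
  have k1 : K ≤ K ^ 2 := by nlinarith
  have k2 : C ≤ C ^ 2 := by nlinarith
  have k3 : 1 ≤ K ^ 2 := by nlinarith
  have e1 : K * C ^ 2 * a ≤ K ^ 2 * C ^ 2 * a := by gcongr
  have e2 : K * C * a ≤ K ^ 2 * C ^ 2 * a := by gcongr
  have e3 : K * C ^ 2 * b ≤ K ^ 2 * C ^ 2 * b := by gcongr
  have e4 : 1 * C ^ 2 * c ≤ K ^ 2 * C ^ 2 * c := by gcongr
  have e5 : 1 * C * b ≤ K ^ 2 * C ^ 2 * b := by gcongr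
  have e6 : 0 ≤ K ^ 2 * C ^ 2 * a := by positivity
  have e7 : 0 ≤ K ^ 2 * C ^ 2 * c := by positivity
  linarith

namespace IsGraphChart

theorem contDiff_comp (h : IsGraphChart M x r C g) (hV : IsSmoothTangent M V) :
    ContDiff ℝ 2 (fun v => V (g v)) :=
  hV.contDiff.comp h.contDiff

theorem fderiv_comp_apply (h : IsGraphChart M x r C g) (hV : IsSmoothTangent M V)
    (v e : tangentPlane M x) :
    fderiv ℝ (fun v => V (g v)) v e = fderiv ℝ V (g v) (fderiv ℝ g v e) := by
  have h1 : HasFDerivAt V (fderiv ℝ V (g v)) (g v) :=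
    (hV.contDiff.differentiable (by norm_num) _).hasFDerivAt
  have h2 : HasFDerivAt (fun v => V (g v)) _ v := h1.comp v (h.differentiable v).hasFDerivAt
  rw [h2.fderiv]
  rfl

theorem fderiv_comp_apply_eq (h : IsGraphChart M x r C g) (hQ : IsProjExtension M Q K)
    (hV : IsSmoothTangent M V) {v : tangentPlane M x} (hv : ‖v‖ < r) (e : tangentPlane M x) :
    fderiv ℝ (fun v => V (g v)) v e =
      fderiv ℝ Q (g v) (fderiv ℝ g v e) (V (g v)) + covExt Q V (g v) (fderiv ℝ g v e) := by
  rw [h.fderiv_comp_apply hV, hQ.fderiv_apply_eq hV (h.mem v hv) (h.fderiv_mem hv e)]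

theorem norm_fderiv_apply_le (h : IsGraphChart M x r C g) {v : tangentPlane M x} (hv : ‖v‖ < r)
    (e : tangentPlane M x) : ‖fderiv ℝ g v e‖ ≤ C * ‖e‖ :=
  (fderiv ℝ g v).le_of_opNorm_le (h.norm_fderiv_le v hv) e

theorem norm_fderiv_comp_le (h : IsGraphChart M x r C g) (hQ : IsProjExtension M Q K)
    (hV : IsSmoothTangent M V) (hC : 1 ≤ C) (hK : 1 ≤ K) {v : tangentPlane M x} (hv : ‖v‖ < r) :
    ‖fderiv ℝ (fun v => V (g v)) v‖ ≤ K * C * (‖V (g v)‖ + ‖covExt Q V (g v)‖) := by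
  refine ContinuousLinearMap.opNorm_le_bound _ (by positivity) fun e => ?_
  have ht := h.norm_fderiv_apply_le hv e
  rw [h.fderiv_comp_apply_eq hQ hV hv]
  calc _ ≤ ‖fderiv ℝ Q (g v)‖ * ‖fderiv ℝ g v e‖ * ‖V (g v)‖ +
        ‖covExt Q V (g v)‖ * ‖fderiv ℝ g v e‖ :=
        (norm_add_le _ _).trans (add_le_add (ContinuousLinearMap.le_opNorm₂ _ _ _)
          (ContinuousLinearMap.le_opNorm _ _))
    _ ≤ K * (C * ‖e‖) * ‖V (g v)‖ + ‖covExt Q V (g v)‖ * (K * (C * ‖e‖)) := by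
        gcongr
        · exact hQ.norm_fderiv_le _ (h.mem v hv)
        · exact ht.trans (le_mul_of_one_le_left (by positivity) hK)
    _ = _ := by ring

/-- The covariant derivative is controlled by the derivative in the chart. -/
theorem norm_covExt_le (h : IsGraphChart M x r C g) (hQ : IsProjExtension M Q K)
    (hV : IsSmoothTangent M V) {v : tangentPlane M x} (hv : ‖v‖ < r) (hd : dist (g v) x < r) :
    ‖covExt Q V (g v)‖ ≤ ‖fderiv ℝ (fun v => V (g v)) v‖ := by
  refine ContinuousLinearMap.opNorm_le_bound _ (norm_nonneg _) fun w => ?_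
  have hq := h.mem v hv
  have h1 : fderiv ℝ V (g v) (Q (g v) w) =
      fderiv ℝ (fun v => V (g v)) v (tangentCoord M x (Q (g v) w)) := by
    rw [h.fderiv_comp_apply hV, h.fderiv_tangentCoord hv hd (hQ.apply_mem hq w)]
  calc ‖covExt Q V (g v) w‖ ≤ ‖fderiv ℝ V (g v) (Q (g v) w)‖ := hQ.norm_apply_le hq _
    _ ≤ ‖fderiv ℝ (fun v => V (g v)) v‖ * ‖tangentCoord M x (Q (g v) w)‖ := by
        rw [h1]; exact ContinuousLinearMap.le_opNorm _ _
    _ ≤ ‖fderiv ℝ (fun v => V (g v)) v‖ * ‖w‖ := by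
        gcongr
        exact (norm_tangentCoord_le M x _).trans (hQ.norm_apply_le hq w)

theorem norm_fderiv_covExt_apply_le (hQ : IsProjExtension M Q K) (hV : IsSmoothTangent M V)
    {q t : E3} (hq : q ∈ M) (ht : t ∈ tangentPlane M q) :
    ‖fderiv ℝ (covExt Q V) q t‖ ≤ (2 * K * ‖covExt Q V q‖ + ‖covDeriv₂ M V q‖) * ‖t‖ := by
  rw [hQ.fderiv_covExt_apply hV hq ht]
  have h1 : ‖fderiv ℝ Q q t‖ ≤ K * ‖t‖ :=
    (fderiv ℝ Q q).le_of_opNorm_le (hQ.norm_fderiv_le q hq) t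
  calc _ ≤ ‖fderiv ℝ Q q t‖ * ‖covExt Q V q‖ + (‖covDeriv₂ M V q‖ * ‖t‖ +
        ‖covExt Q V q‖ * ‖fderiv ℝ Q q t‖) := by
        refine (norm_add_le _ _).trans (add_le_add (ContinuousLinearMap.opNorm_comp_le _ _)
          ((norm_add_le _ _).trans (add_le_add ?_ (ContinuousLinearMap.opNorm_comp_le _ _))))
        exact (covDeriv₂ M V q).le_opNorm t
    _ ≤ (K * ‖t‖) * ‖covExt Q V q‖ + (‖covDeriv₂ M V q‖ * ‖t‖ +
        ‖covExt Q V q‖ * (K * ‖t‖)) := by gcongr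
    _ = _ := by ring

/-- The first order identity `fderiv_comp_apply_eq` is differentiated in the direction `e'`. Only
derivatives along `M` occur on the right, so the normal derivatives of the ambient extension of `V`,
which nothing controls, never enter. -/
theorem fderiv_fderiv_comp_apply (h : IsGraphChart M x r C g) (hQ : IsProjExtension M Q K)
    (hV : IsSmoothTangent M V) {v : tangentPlane M x} (hv : ‖v‖ < r) (e' e : tangentPlane M x) :
    fderiv ℝ (fderiv ℝ (fun v => V (g v))) v e' e =
      ((fderiv ℝ (fderiv ℝ Q) (g v) (fderiv ℝ g v e') (fderiv ℝ g v e) +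
          fderiv ℝ Q (g v) (fderiv ℝ (fderiv ℝ g) v e' e)) (V (g v)) +
        fderiv ℝ Q (g v) (fderiv ℝ g v e) (fderiv ℝ (fun v => V (g v)) v e')) +
      (fderiv ℝ (covExt Q V) (g v) (fderiv ℝ g v e') (fderiv ℝ g v e) +
        covExt Q V (g v) (fderiv ℝ (fderiv ℝ g) v e' e)) := by
  have hu := h.contDiff_comp hV
  have hline : HasDerivAt (fun s : ℝ => v + s • e') e' 0 := by
    simpa using ((hasDerivAt_id (0 : ℝ)).smul_const e').const_add v
  have hv0 : v + (0 : ℝ) • e' = v := by simp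
  have along : ∀ {G : Type} [NormedAddCommGroup G] [NormedSpace ℝ G] {f : tangentPlane M x → G},
      DifferentiableAt ℝ f v → HasDerivAt (fun s : ℝ => f (v + s • e')) (fderiv ℝ f v e') 0 := by
    intro G _ _ f hf
    have : HasFDerivAt f (fderiv ℝ f v) (v + (0 : ℝ) • e') := by rw [hv0]; exact hf.hasFDerivAt
    exact this.comp_hasDerivAt (0 : ℝ) hline
  have hg := along (h.differentiable v)
  have hDg : HasDerivAt (fun s : ℝ => fderiv ℝ g (v + s • e') e) (fderiv ℝ (fderiv ℝ g) v e' e) 0 := by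
    have := (along (f := fderiv ℝ g)
      (((h.contDiff.fderiv_right (m := 1) (by norm_num)).differentiable (by norm_num)) v)).clm_apply
      (hasDerivAt_const (0 : ℝ) e)
    simpa using this
  have hDu : HasDerivAt (fun s : ℝ => fderiv ℝ (fun v => V (g v)) (v + s • e') e)
      (fderiv ℝ (fderiv ℝ (fun v => V (g v))) v e' e) 0 := by
    have := (along (f := fderiv ℝ (fun v => V (g v)))
      (((hu.fderiv_right (m := 1) (by norm_num)).differentiable (by norm_num)) v)).clm_apply
      (hasDerivAt_const (0 : ℝ) e)
    simpa using this
  have hU := along (hu.differentiable (by norm_num) v)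
  have hDQ : HasDerivAt (fun s : ℝ => fderiv ℝ Q (g (v + s • e')))
      (fderiv ℝ (fderiv ℝ Q) (g v) (fderiv ℝ g v e')) 0 := by
    have h1 : HasFDerivAt (fderiv ℝ Q) (fderiv ℝ (fderiv ℝ Q) (g v)) (g (v + (0 : ℝ) • e')) := by
      rw [hv0]
      exact ((hQ.contDiff.fderiv_right (m := 1) (by norm_num)).differentiable
        (by norm_num) _).hasFDerivAt
    exact h1.comp_hasDerivAt (0 : ℝ) hg
  have hA : HasDerivAt (fun s : ℝ => covExt Q V (g (v + s • e')))
      (fderiv ℝ (covExt Q V) (g v) (fderiv ℝ g v e')) 0 := by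
    have h1 : HasFDerivAt (covExt Q V) (fderiv ℝ (covExt Q V) (g v)) (g (v + (0 : ℝ) • e')) := by
      rw [hv0]
      exact ((hQ.contDiff_covExt hV).differentiable (by norm_num) _).hasFDerivAt
    exact h1.comp_hasDerivAt (0 : ℝ) hg
  have hR := ((hDQ.clm_apply hDg).clm_apply hU).add (hA.clm_apply hDg)
  have hev : (fun s : ℝ => fderiv ℝ (fun v => V (g v)) (v + s • e') e) =ᶠ[𝓝 0]
      fun s => fderiv ℝ Q (g (v + s • e')) (fderiv ℝ g (v + s • e') e) (V (g (v + s • e'))) +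
        covExt Q V (g (v + s • e')) (fderiv ℝ g (v + s • e') e) := by
    have : ∀ᶠ s in 𝓝 (0 : ℝ), ‖v + s • e'‖ < r :=
      hline.continuousAt.norm.eventually_lt_const (by simpa using hv)
    filter_upwards [this] with s hs using h.fderiv_comp_apply_eq hQ hV hs e
  have := hDu.unique (hR.congr_of_eventuallyEq hev)
  simpa only [hv0] using this

set_option maxHeartbeats 800000 in
/-- Second derivatives in the chart are controlled by covariant derivatives. -/
theorem norm_fderiv_fderiv_comp_le (h : IsGraphChart M x r C g) (hQ : IsProjExtension M Q K)
    (hV : IsSmoothTangent M V) (hC : 1 ≤ C) (hK : 1 ≤ K) {v : tangentPlane M x} (hv : ‖v‖ < r) :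
    ‖fderiv ℝ (fderiv ℝ (fun v => V (g v))) v‖ ≤
      4 * K ^ 2 * C ^ 2 * (‖V (g v)‖ + ‖covExt Q V (g v)‖ + ‖covDeriv₂ M V (g v)‖) := by
  have hq := h.mem v hv
  refine ContinuousLinearMap.opNorm_le_bound₂ _ (by positivity) fun e' e => ?_
  rw [h.fderiv_fderiv_comp_apply hQ hV hv]
  set a := ‖V (g v)‖ with ha
  set b := ‖covExt Q V (g v)‖ with hb
  set c := ‖covDeriv₂ M V (g v)‖ with hc
  have ha0 : 0 ≤ a := norm_nonneg _
  have hb0 : 0 ≤ b := norm_nonneg _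
  have hc0 : 0 ≤ c := norm_nonneg _
  have ht := h.norm_fderiv_apply_le hv e
  have ht' := h.norm_fderiv_apply_le hv e'
  have hg2 : ‖fderiv ℝ (fderiv ℝ g) v e' e‖ ≤ C * ‖e'‖ * ‖e‖ :=
    (ContinuousLinearMap.le_opNorm₂ _ _ _).trans (by
      gcongr; exact h.norm_fderiv_fderiv_le v hv)
  have hQ1 := hQ.norm_fderiv_le _ hq
  have hQ2 := hQ.norm_fderiv_fderiv_le _ hq
  have hu1 : ‖fderiv ℝ (fun v => V (g v)) v e'‖ ≤ K * C * (a + b) * ‖e'‖ :=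
    ContinuousLinearMap.le_of_opNorm_le _ (h.norm_fderiv_comp_le hQ hV hC hK hv) e'
  have n1 : ‖fderiv ℝ (fderiv ℝ Q) (g v) (fderiv ℝ g v e') (fderiv ℝ g v e)‖ ≤
      K * (C * ‖e'‖) * (C * ‖e‖) :=
    (ContinuousLinearMap.le_opNorm₂ _ _ _).trans (by gcongr)
  have n2 : ‖fderiv ℝ Q (g v) (fderiv ℝ (fderiv ℝ g) v e' e)‖ ≤ K * (C * ‖e'‖ * ‖e‖) :=
    (ContinuousLinearMap.le_opNorm _ _).trans (by gcongr)
  have n3 : ‖fderiv ℝ Q (g v) (fderiv ℝ g v e) (fderiv ℝ (fun v => V (g v)) v e')‖ ≤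
      K * (C * ‖e‖) * (K * C * (a + b) * ‖e'‖) :=
    (ContinuousLinearMap.le_opNorm₂ _ _ _).trans (by gcongr)
  have n4 : ‖fderiv ℝ (covExt Q V) (g v) (fderiv ℝ g v e') (fderiv ℝ g v e)‖ ≤
      (2 * K * b + c) * (C * ‖e'‖) * (C * ‖e‖) :=
    (ContinuousLinearMap.le_opNorm _ _).trans (mul_le_mul
      ((norm_fderiv_covExt_apply_le hQ hV hq (h.fderiv_mem hv e')).trans (by gcongr)) ht
      (norm_nonneg _) (by positivity))
  have n5 : ‖covExt Q V (g v) (fderiv ℝ (fderiv ℝ g) v e' e)‖ ≤ b * (C * ‖e'‖ * ‖e‖) :=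
    (ContinuousLinearMap.le_opNorm _ _).trans (by gcongr)
  have n12 : ‖(fderiv ℝ (fderiv ℝ Q) (g v) (fderiv ℝ g v e') (fderiv ℝ g v e) +
          fderiv ℝ Q (g v) (fderiv ℝ (fderiv ℝ g) v e' e)) (V (g v))‖ ≤
      (K * (C * ‖e'‖) * (C * ‖e‖) + K * (C * ‖e'‖ * ‖e‖)) * a :=
    (ContinuousLinearMap.le_opNorm _ _).trans (mul_le_mul_of_nonneg_right
      ((norm_add_le _ _).trans (add_le_add n1 n2)) ha0)
  have key := second_derivative_constant_le hK hC ha0 hb0 hc0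
  calc _ ≤ ((K * (C * ‖e'‖) * (C * ‖e‖) + K * (C * ‖e'‖ * ‖e‖)) * a +
        K * (C * ‖e‖) * (K * C * (a + b) * ‖e'‖)) +
        ((2 * K * b + c) * (C * ‖e'‖) * (C * ‖e‖) + b * (C * ‖e'‖ * ‖e‖)) :=
        (norm_add_le _ _).trans (add_le_add ((norm_add_le _ _).trans (add_le_add n12 n3))
          ((norm_add_le _ _).trans (add_le_add n4 n5)))
    _ = ((K * C ^ 2 + K * C) * a + K ^ 2 * C ^ 2 * (a + b) + (2 * K * b + c) * C ^ 2 + b * C) *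
        (‖e'‖ * ‖e‖) := by ring
    _ ≤ 4 * K ^ 2 * C ^ 2 * (a + b + c) * (‖e'‖ * ‖e‖) := by gcongr
    _ = _ := by ring

end IsGraphChart

/-! ### The area measure in a chart -/

/-- Applied to the chart, which is `C`-Lipschitz, and to the projection, which is 1-Lipschitz, this
compares area with plane measure in both directions without an area formula. -/
theorem euclideanHausdorffMeasure_image_le {X Y : Type*} [MetricSpace X] [MeasurableSpace X]
    [BorelSpace X] [MetricSpace Y] [MeasurableSpace Y] [BorelSpace Y] {f : X → Y} {L : NNReal}
    {s : Set X} (hf : LipschitzOnWith L f s) :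
    Measure.euclideanHausdorffMeasure 2 (f '' s) ≤
      (L : ℝ≥0∞) ^ 2 * Measure.euclideanHausdorffMeasure 2 s := by
  simp only [Measure.euclideanHausdorffMeasure_def, Measure.smul_apply, ENNReal.smul_def,
    smul_eq_mul]
  have h := hf.hausdorffMeasure_image_le (d := ((2 : ℕ) : ℝ)) (by norm_num)
  rw [ENNReal.rpow_natCast] at h
  calc _ ≤ _ := mul_le_mul_right h _
    _ = _ := by ring

/-- The area measure of the plane `T_x M`. -/
abbrev planeArea (M : Set E3) (x : E3) : Measure (tangentPlane M x) :=
  Measure.euclideanHausdorffMeasure 2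

namespace IsGraphChart

theorem lintegral_image_le (h : IsGraphChart M x r C g) {s : Set (tangentPlane M x)}
    (hsr : ∀ v ∈ s, ‖v‖ < r) (f : E3 → ℝ≥0∞) :
    ∫⁻ q in g '' s, f q ∂area M ≤ ENNReal.ofReal C ^ 2 * ∫⁻ v in s, f (g v) ∂planeArea M x := by
  have hgm : Measurable g := h.contDiff.continuous.measurable
  have hle : (area M).restrict (g '' s) ≤
      ENNReal.ofReal C ^ 2 • ((planeArea M x).restrict s).map g := by
    refine Measure.le_iff.2 fun A hA => ?_
    rw [Measure.smul_apply, Measure.map_apply hgm hA, Measure.restrict_apply (hgm hA),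
      Measure.restrict_apply hA, smul_eq_mul]
    have h1 : A ∩ g '' s = g '' (g ⁻¹' A ∩ s) := by rw [Set.inter_comm, Set.inter_comm (g ⁻¹' A),
      Set.image_inter_preimage]
    rw [h1]
    refine (Measure.restrict_apply_le _ _).trans ?_
    exact euclideanHausdorffMeasure_image_le (h.lipschitzOnWith.mono fun v hv =>
      mem_ball_zero_iff.2 (hsr v hv.2))
  calc _ ≤ ∫⁻ q, f q ∂(ENNReal.ofReal C ^ 2 • ((planeArea M x).restrict s).map g) :=
        lintegral_mono' hle le_rfl
    _ ≤ _ := by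
        rw [lintegral_smul_measure, smul_eq_mul]
        gcongr
        exact lintegral_map_le _ _

/-- The projection is a left inverse of the chart and does not increase distances, whence the
constant 1. -/
theorem lintegral_comp_le (h : IsGraphChart M x r C g) (hM : IsClosed M)
    {s : Set (tangentPlane M x)} (hs : IsCompact s) (hsr : ∀ v ∈ s, ‖v‖ < r) (f : E3 → ℝ≥0∞) :
    ∫⁻ v in s, f (g v) ∂planeArea M x ≤ ∫⁻ q in g '' s, f q ∂area M := by
  set π : E3 → tangentPlane M x := fun q => tangentCoord M x (q - x) with hπ
  have hπg : ∀ v ∈ s, π (g v) = v := fun v hv => h.coord v (hsr v hv)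
  have hπm : Measurable π := by fun_prop
  have hle : (planeArea M x).restrict s ≤ ((area M).restrict (g '' s)).map π := by
    refine Measure.le_iff.2 fun A hA => ?_
    rw [Measure.map_apply hπm hA, Measure.restrict_apply hA, Measure.restrict_apply (hπm hA), area,
      Measure.restrict_apply' hM.measurableSet]
    have hL : LipschitzOnWith 1 π (g '' (A ∩ s)) := by
      refine LipschitzWith.lipschitzOnWith (LipschitzWith.of_dist_le_mul fun p q => ?_)
      rw [NNReal.coe_one, one_mul, dist_eq_norm, dist_eq_norm, hπ, ← map_sub]
      simpa using norm_tangentCoord_le M x (p - q)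
    have h1 := euclideanHausdorffMeasure_image_le hL
    rw [Set.image_image] at h1
    calc planeArea M x (A ∩ s) = planeArea M x ((fun v => π (g v)) '' (A ∩ s)) := by
          congr 1
          ext v
          constructor
          · exact fun hv => ⟨v, hv, hπg v hv.2⟩
          · rintro ⟨w, hw, rfl⟩
            simpa only [hπg w hw.2] using hw
      _ ≤ Measure.euclideanHausdorffMeasure 2 (g '' (A ∩ s)) := by simpa using h1
      _ ≤ _ := by
          refine measure_mono ?_
          rintro _ ⟨v, hv, rfl⟩
          refine ⟨⟨?_, v, hv.2, rfl⟩, h.mem v (hsr v hv.2)⟩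
          rw [Set.mem_preimage, hπg v hv.2]
          exact hv.1
  calc _ ≤ ∫⁻ v, f (g v) ∂(((area M).restrict (g '' s)).map π) := lintegral_mono' hle le_rfl
    _ ≤ ∫⁻ q in g '' s, f (g (π q)) ∂area M := lintegral_map_le _ _
    _ = _ := by
        refine setLIntegral_congr_fun (hs.image h.contDiff.continuous).isClosed.measurableSet ?_
        rintro _ ⟨v, hv, rfl⟩
        simp only
        rw [hπg v hv]

end IsGraphChart

theorem isAddHaarMeasure_planeArea (hx : Module.finrank ℝ (tangentPlane M x) = 2) :
    (planeArea M x).IsAddHaarMeasure := by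
  have h := isAddHaarMeasure_euclideanHausdorffMeasure (E := tangentPlane M x)
  rwa [hx] at h

theorem planeArea_closedBall (hx : Module.finrank ℝ (tangentPlane M x) = 2) {ρ : ℝ} (hρ : 0 ≤ ρ) :
    planeArea M x (Metric.closedBall 0 ρ) = ENNReal.ofReal (Real.pi * ρ ^ 2) := by
  have h : planeArea M x = volume := by
    have h := InnerProductSpace.euclideanHausdorffMeasure_eq_volume (V := tangentPlane M x)
    rwa [hx] at h
  have : Nontrivial (tangentPlane M x) :=
    Module.nontrivial_of_finrank_pos (R := ℝ) (by rw [hx]; norm_num)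
  rw [h, InnerProductSpace.volume_closedBall_of_dim_even (k := 1) (by rw [hx])]
  rw [ENNReal.ofReal_mul Real.pi_pos.le, ENNReal.ofReal_pow hρ, hx]
  simp [mul_comm]

end FieldInChart

/-! ### The second fundamental form, the Ricci identity and curvature at a point of locally maximal
norm. -/

section Curvature

variable {M : Set E3} {x : E3} {r C : ℝ} {g : tangentPlane M x → E3}
  {Q : E3 → E3 →L[ℝ] E3} {K : ℝ} {V : E3 → E3}

namespace IsProjExtension

/-- Differentiating `Q² = Q` along `M` gives it. Thus `DQ(u) t` is normal for tangent `u` and `t`: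
it is the second fundamental form. -/
theorem apply_fderiv_apply (hQ : IsProjExtension M Q K) {q u t : E3} (hq : q ∈ M)
    (hu : u ∈ tangentPlane M q) (ht : t ∈ tangentPlane M q) : Q q (fderiv ℝ Q q u t) = 0 := by
  have h := eq_of_hasFDerivAt_of_eqOn hq (hQ.hasFDerivAt q)
    ((hQ.hasFDerivAt q).clm_comp (hQ.hasFDerivAt q)) (fun p hp => (hQ.idem hp).symm) hu
  have h1 := congrArg (fun L : E3 →L[ℝ] E3 => L t) h
  simp only [add_apply, ContinuousLinearMap.comp_apply, ContinuousLinearMap.compL_apply,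
    ContinuousLinearMap.flip_apply, hQ.apply_of_mem hq ht] at h1
  simpa using h1

theorem inner_apply (hQ : IsProjExtension M Q K) {q : E3} (hq : q ∈ M) (a b : E3) :
    inner ℝ (Q q a) b = inner ℝ a (Q q b) := by
  rw [hQ.eq_tangentProj q hq]
  exact Submodule.inner_starProjection_left_eq_right _ _ _

theorem inner_fderiv_apply (hQ : IsProjExtension M Q K) {q u : E3} (hq : q ∈ M)
    (hu : u ∈ tangentPlane M q) (a b : E3) :
    inner ℝ (fderiv ℝ Q q u a) b = inner ℝ a (fderiv ℝ Q q u b) := by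
  have h1 : HasFDerivAt (fun p => inner ℝ (Q p a) b) _ q :=
    ((hQ.hasFDerivAt q).clm_apply (hasFDerivAt_const a q)).inner ℝ (hasFDerivAt_const b q)
  have h2 : HasFDerivAt (fun p => inner ℝ a (Q p b)) _ q :=
    (hasFDerivAt_const a q).inner ℝ ((hQ.hasFDerivAt q).clm_apply (hasFDerivAt_const b q))
  have h := eq_of_hasFDerivAt_of_eqOn hq h1 h2 (fun p hp => hQ.inner_apply hp a b) hu
  simpa using h

end IsProjExtension

namespace IsGraphChart

/-- The Gauss formula in a graph chart. -/
theorem fderiv_fderiv_eq (h : IsGraphChart M x r C g) (hQ : IsProjExtension M Q K)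
    {v : tangentPlane M x} (hv : ‖v‖ < r) (e' e : tangentPlane M x) :
    fderiv ℝ (fderiv ℝ g) v e' e =
      fderiv ℝ Q (g v) (fderiv ℝ g v e') (fderiv ℝ g v e) +
        Q (g v) (fderiv ℝ (fderiv ℝ g) v e' e) := by
  have hg1 : HasFDerivAt (fun w => fderiv ℝ g w e)
      ((fderiv ℝ (fderiv ℝ g) v).flip e) v := by
    have := (((h.contDiff.fderiv_right (m := 1) (by norm_num)).differentiable
      (by norm_num)) v).hasFDerivAt.clm_apply (hasFDerivAt_const e v)
    simpa using this
  have h1 : HasFDerivAt (fun w => Q (g w)) ((fderiv ℝ Q (g v)).comp (fderiv ℝ g v)) v :=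
    (hQ.hasFDerivAt (g v)).comp v (h.differentiable v).hasFDerivAt
  have h2 := h1.clm_apply hg1
  have hev : (fun w => fderiv ℝ g w e) =ᶠ[𝓝 v] fun w => Q (g w) (fderiv ℝ g w e) := by
    filter_upwards [continuous_norm.continuousAt.eventually_lt_const hv] with w hw
    rw [hQ.apply_of_mem (h.mem w hw) (h.fderiv_mem hw e)]
  have h3 := congrArg (fun L : tangentPlane M x →L[ℝ] E3 => L e')
    (hg1.unique (h2.congr_of_eventuallyEq hev))
  simpa [add_comm] using h3

theorem fderiv_fderiv_symm (h : IsGraphChart M x r C g) (v e' e : tangentPlane M x) :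
    fderiv ℝ (fderiv ℝ g) v e' e = fderiv ℝ (fderiv ℝ g) v e e' :=
  (h.contDiff.contDiffAt.isSymmSndFDerivAt (by simp)).eq e' e

theorem fderiv_zero (h : IsGraphChart M x r C g) (hx : x ∈ M) (hr : 0 < r)
    (e : tangentPlane M x) : fderiv ℝ g 0 e = e := by
  have h0 := h.apply_zero hx hr
  have := h.fderiv_tangentCoord (v := 0) (by simpa using hr) (by rw [h0]; simpa using hr)
    (t := (e : E3)) (by rw [h0]; exact e.2)
  rwa [tangentCoord_coe] at this

/-- The second fundamental form is symmetric. -/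
theorem fderiv_proj_symm (h : IsGraphChart M x r C g) (hQ : IsProjExtension M Q K) (hx : x ∈ M)
    (hr : 0 < r) {u w : E3} (hu : u ∈ tangentPlane M x) (hw : w ∈ tangentPlane M x) :
    fderiv ℝ Q x u w = fderiv ℝ Q x w u := by
  have h0 := h.apply_zero hx hr
  -- At 0 the derivative of the chart is the inclusion of the tangent plane. In the two Gauss
  -- formulas the tangential parts agree by symmetry of `D²g`, hence so do the normal parts.
  have h1 := h.fderiv_fderiv_eq hQ (v := 0) (by simpa using hr) ⟨u, hu⟩ ⟨w, hw⟩
  have h2 := h.fderiv_fderiv_eq hQ (v := 0) (by simpa using hr) ⟨w, hw⟩ ⟨u, hu⟩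
  rw [h.fderiv_zero hx hr, h.fderiv_zero hx hr, h0] at h1 h2
  rw [h.fderiv_fderiv_symm 0 ⟨w, hw⟩ ⟨u, hu⟩] at h2
  exact add_right_cancel (h1.symm.trans h2)

end IsGraphChart

/-- The Ricci identity: the antisymmetric part of `∇²V` does not involve derivatives of `V`. -/
theorem covDeriv₂_sub_covDeriv₂ (hQ : IsProjExtension M Q K) (hV : IsSmoothTangent M V) {q : E3}
    (hq : q ∈ M) (hsymm : ∀ u ∈ tangentPlane M q, ∀ w ∈ tangentPlane M q,
      fderiv ℝ Q q u w = fderiv ℝ Q q w u) {u w : E3}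
    (hu : u ∈ tangentPlane M q) (hw : w ∈ tangentPlane M q) :
    covDeriv₂ M V q u w - covDeriv₂ M V q w u =
      Q q (fderiv ℝ Q q u (fderiv ℝ Q q w (V q)) - fderiv ℝ Q q w (fderiv ℝ Q q u (V q))) := by
  have hDV : HasFDerivAt (fderiv ℝ V) (fderiv ℝ (fderiv ℝ V) q) q :=
    ((hV.contDiff.fderiv_right (m := 1) (by norm_num)).differentiable (by norm_num) q).hasFDerivAt
  have hd : HasFDerivAt (covExt Q V) _ q :=
    (hQ.hasFDerivAt q).clm_comp (hDV.clm_comp (hQ.hasFDerivAt q))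
  -- Of the three terms, the second is symmetric in `u, w` by symmetry of `D²V` and the third by
  -- symmetry of the second fundamental form; only the first survives antisymmetrization.
  have key : ∀ u ∈ tangentPlane M q, ∀ w ∈ tangentPlane M q, covDeriv₂ M V q u w =
      Q q (fderiv ℝ Q q u (fderiv ℝ Q q w (V q))) + Q q (fderiv ℝ (fderiv ℝ V) q u w) +
        Q q (fderiv ℝ V q (fderiv ℝ Q q u w)) := by
    intro u hu w hw
    rw [hQ.covDeriv₂_apply_eq hV hq, hd.fderiv, hQ.apply_of_mem hq hu, hQ.apply_of_mem hq hw]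
    simp only [add_apply, ContinuousLinearMap.comp_apply, ContinuousLinearMap.compL_apply,
      ContinuousLinearMap.flip_apply, hQ.apply_of_mem hq hw, map_add]
    have hz : Q q (fderiv ℝ Q q u (covExt Q V q w)) = 0 :=
      hQ.apply_fderiv_apply hq hu (hQ.apply_mem hq _)
    rw [hQ.fderiv_apply_eq hV hq hw, map_add, map_add, hz, add_zero,
      hQ.apply_of_mem hq (hQ.apply_mem hq _), hQ.apply_of_mem hq (hQ.apply_mem hq _)]
    abel
  rw [key u hu w hw, key w hw u hu, hsymm w hw u hu,
    (hV.contDiff.contDiffAt.isSymmSndFDerivAt (by simp)).eq w u, map_sub]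
  abel

/-- The bilinear map `(u, w) ↦ [DQ(Qu), DQ(Qw)]`, which gives the curvature of `M`. -/
def curvatureOp (Q : E3 → E3 →L[ℝ] E3) (q : E3) : E3 →L[ℝ] E3 →L[ℝ] E3 →L[ℝ] E3 :=
  (((ContinuousLinearMap.compL ℝ E3 E3 E3).comp ((fderiv ℝ Q q).comp (Q q))).flip.comp
      ((fderiv ℝ Q q).comp (Q q))).flip -
    ((ContinuousLinearMap.compL ℝ E3 E3 E3).comp ((fderiv ℝ Q q).comp (Q q))).flip.comp
      ((fderiv ℝ Q q).comp (Q q))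

theorem curvatureOp_apply (Q : E3 → E3 →L[ℝ] E3) (q u w v : E3) :
    curvatureOp Q q u w v = fderiv ℝ Q q (Q q u) (fderiv ℝ Q q (Q q w) v) -
      fderiv ℝ Q q (Q q w) (fderiv ℝ Q q (Q q u) v) := rfl

theorem continuous_curvatureOp (hQ : ContDiff ℝ 2 Q) : Continuous (curvatureOp Q) := by
  have h0 : Continuous Q := hQ.continuous
  have h1 : Continuous (fderiv ℝ Q) := (hQ.fderiv_right (m := 1) (by norm_num)).continuous
  have h2 : Continuous fun q => (fderiv ℝ Q q).comp (Q q) := h1.clm_comp h0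
  have h3 : Continuous fun q => (ContinuousLinearMap.compL ℝ E3 E3 E3).comp
      ((fderiv ℝ Q q).comp (Q q)) := continuous_const.clm_comp h2
  have h4 := (((ContinuousLinearMap.flipₗᵢ ℝ E3 (E3 →L[ℝ] E3) (E3 →L[ℝ] E3)).continuous.comp
    h3).clm_comp h2)
  exact ((ContinuousLinearMap.flipₗᵢ ℝ E3 E3 (E3 →L[ℝ] E3)).continuous.comp h4).sub h4

/-- A positive second derivative would make the point a local minimum too, hence the function
locally constant, with vanishing second derivative. -/
theorem deriv_deriv_nonpos_of_isLocalMax {f : ℝ → ℝ} {a : ℝ} (h : IsLocalMax f a)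
    (hf : ContinuousAt f a) : deriv (deriv f) a ≤ 0 := by
  by_contra hpos
  have hmin := isLocalMin_of_deriv_deriv_pos (not_le.1 hpos) h.deriv_eq_zero hf
  have hconst : f =ᶠ[𝓝 a] fun _ => f a := by
    filter_upwards [h, hmin] with y h1 h2 using le_antisymm h1 h2
  rw [hconst.deriv.deriv_eq] at hpos
  simp at hpos

/-- First and second order conditions for the maximum of `‖g (s e)‖²` at `s = 0`. -/
theorem IsGraphChart.deriv_conditions_of_isMax (h : IsGraphChart M x r C g) (hx : x ∈ M)
    (hr : 0 < r) (hmax : ∀ᶠ y in 𝓝[M] x, ‖y‖ ≤ ‖x‖) (e : tangentPlane M x) :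
    inner ℝ x (e : E3) = 0 ∧ inner ℝ x (fderiv ℝ (fderiv ℝ g) 0 e e) ≤ -‖e‖ ^ 2 := by
  set γ : ℝ → E3 := fun s => g (s • e) with hγ
  have h0 : γ 0 = x := by simp [hγ, h.apply_zero hx hr]
  have hline : ∀ s : ℝ, HasDerivAt (fun s : ℝ => s • e) e s := fun s => by
    simpa using (hasDerivAt_id s).smul_const e
  have hγ1 : ∀ s, HasDerivAt γ (fderiv ℝ g (s • e) e) s := fun s =>
    (h.differentiable _).hasFDerivAt.comp_hasDerivAt s (hline s)
  have hγ2 : HasDerivAt (fun s : ℝ => fderiv ℝ g (s • e) e) (fderiv ℝ (fderiv ℝ g) 0 e e) 0 := by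
    have h1 : HasFDerivAt (fderiv ℝ g) (fderiv ℝ (fderiv ℝ g) 0) ((0 : ℝ) • e) := by
      rw [zero_smul]
      exact (((h.contDiff.fderiv_right (m := 1) (by norm_num)).differentiable
        (by norm_num)) 0).hasFDerivAt
    have h2 : HasDerivAt (fun s : ℝ => fderiv ℝ g (s • e)) (fderiv ℝ (fderiv ℝ g) 0 e) 0 :=
      h1.comp_hasDerivAt (0 : ℝ) (hline 0)
    have h3 := h2.clm_apply (hasDerivAt_const (0 : ℝ) e)
    rwa [map_zero, add_zero] at h3
  set ψ : ℝ → ℝ := fun s => inner ℝ (γ s) (γ s) with hψ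
  have hψ1 : deriv ψ = fun s => 2 * inner ℝ (γ s) (fderiv ℝ g (s • e) e) := by
    funext s
    rw [((hγ1 s).inner ℝ (hγ1 s)).deriv, real_inner_comm (γ s), two_mul]
  have hg0 : fderiv ℝ g ((0 : ℝ) • e) e = e := by rw [zero_smul, h.fderiv_zero hx hr]
  have hψ2 : deriv (deriv ψ) 0 = 2 * (inner ℝ x (fderiv ℝ (fderiv ℝ g) 0 e e) + ‖e‖ ^ 2) := by
    rw [hψ1, (((hγ1 0).inner ℝ hγ2).const_mul 2).deriv, h0, hg0, real_inner_self_eq_norm_sq]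
    rfl
  have hloc : IsLocalMax ψ 0 := by
    have h1 : Tendsto γ (𝓝 0) (𝓝[M] x) := by
      rw [← h0]
      refine tendsto_nhdsWithin_iff.2 ⟨(hγ1 0).continuousAt, ?_⟩
      have : ∀ᶠ s in 𝓝 (0 : ℝ), ‖s • e‖ < r :=
        (hline 0).continuousAt.norm.eventually_lt_const (by simpa using hr)
      filter_upwards [this] with s hs using h.mem _ hs
    filter_upwards [h1.eventually hmax] with s hs
    simp only [hψ, real_inner_self_eq_norm_sq, h0]
    gcongr
  have hd0 := hloc.deriv_eq_zero
  rw [hψ1] at hd0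
  simp only [h0, hg0] at hd0
  have hdd := deriv_deriv_nonpos_of_isLocalMax hloc ((hγ1 0).inner ℝ (hγ1 0)).continuousAt
  rw [hψ2] at hdd
  exact ⟨by linarith, by linarith⟩

/-- At a point of locally maximal norm, the second fundamental form is definite. -/
theorem IsGraphChart.second_fundamental_form_le (h : IsGraphChart M x r C g)
    (hQ : IsProjExtension M Q K)
    (hx : x ∈ M) (hr : 0 < r) (hmax : ∀ᶠ y in 𝓝[M] x, ‖y‖ ≤ ‖x‖) {t : E3}
    (ht : t ∈ tangentPlane M x) : inner ℝ x (fderiv ℝ Q x t t) ≤ -‖t‖ ^ 2 := by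
  have h1 := (h.deriv_conditions_of_isMax hx hr hmax ⟨t, ht⟩).2
  have h2 := h.fderiv_fderiv_eq hQ (v := 0) (by simpa using hr) ⟨t, ht⟩ ⟨t, ht⟩
  -- The position vector is normal at such a point, so the tangential part in the Gauss formula does
  -- not contribute.
  have h3 : inner ℝ x (Q x (fderiv ℝ (fderiv ℝ g) 0 ⟨t, ht⟩ ⟨t, ht⟩)) = 0 :=
    (h.deriv_conditions_of_isMax hx hr hmax ⟨_, hQ.apply_mem hx _⟩).1
  rw [h.fderiv_zero hx hr, h.apply_zero hx hr] at h2
  rwa [h2, inner_add_right, h3, add_zero] at h1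

theorem exists_smul_eq_of_mem_orthogonal (hT : Module.finrank ℝ (tangentPlane M x) = 2)
    (hx0 : x ≠ 0) (hxT : ∀ t ∈ tangentPlane M x, inner ℝ x t = 0) {w : E3}
    (hw : w ∈ (tangentPlane M x)ᗮ) : ∃ s : ℝ, w = s • x := by
  have h1 := (tangentPlane M x).finrank_add_finrank_orthogonal
  rw [hT, finrank_euclideanSpace_fin] at h1
  have h2 : Module.finrank ℝ (tangentPlane M x)ᗮ = 1 := by omega
  have hxm : x ∈ (tangentPlane M x)ᗮ := (Submodule.mem_orthogonal' _ _).2 hxT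
  obtain ⟨s, hs⟩ := (finrank_eq_one_iff_of_nonzero' (⟨x, hxm⟩ : (tangentPlane M x)ᗮ)
    (by simpa [Subtype.ext_iff] using hx0)).1 h2 ⟨w, hw⟩
  exact ⟨s, by simpa [Subtype.ext_iff] using hs.symm⟩

/-- At a point of locally maximal norm, the curvature operator is nondegenerate. -/
theorem IsGraphChart.exists_le_inner_curvatureOp (h : IsGraphChart M x r C g)
    (hQ : IsProjExtension M Q K) (hx : x ∈ M) (hr : 0 < r)
    (hT : Module.finrank ℝ (tangentPlane M x) = 2) (hmax : ∀ᶠ y in 𝓝[M] x, ‖y‖ ≤ ‖x‖) :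
    x ≠ 0 ∧ ∀ v ∈ tangentPlane M x, ∃ z ∈ tangentPlane M x, ‖z‖ = 1 ∧
      ‖v‖ ^ 2 ≤ ‖x‖ ^ 2 * inner ℝ (curvatureOp Q x z v v) z := by
  have hxT : ∀ t ∈ tangentPlane M x, inner ℝ x t = 0 := fun t ht =>
    (h.deriv_conditions_of_isMax hx hr hmax ⟨t, ht⟩).1
  have hb : ∀ t ∈ tangentPlane M x, inner ℝ x (fderiv ℝ Q x t t) ≤ -‖t‖ ^ 2 := fun t ht =>
    h.second_fundamental_form_le hQ hx hr hmax ht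
  have hx0 : x ≠ 0 := by
    rintro hx0
    have : Nontrivial (tangentPlane M x) :=
      Module.nontrivial_of_finrank_pos (R := ℝ) (by rw [hT]; norm_num)
    obtain ⟨t, ht⟩ := exists_ne (0 : tangentPlane M x)
    have h1 := hb t t.2
    have h2 : ∀ w : E3, inner ℝ x w = 0 := fun w => by rw [hx0, inner_zero_left]
    rw [h2] at h1
    have : 0 < ‖(t : E3)‖ := by simpa using ht
    nlinarith
  refine ⟨hx0, fun v hv => ?_⟩
  have hxn : 0 < ‖x‖ := norm_pos_iff.2 hx0
  set b : E3 → E3 → ℝ := fun u w => inner ℝ x (fderiv ℝ Q x u w) with hbdef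
  have hII : ∀ u ∈ tangentPlane M x, ∀ w ∈ tangentPlane M x,
      -- The normal line is spanned by `x` itself, so the second fundamental form is the scalar form
      -- `b`, up to normalization.
      ‖x‖ ^ 2 • fderiv ℝ Q x u w = b u w • x := by
    intro u hu w hw
    have h1 : fderiv ℝ Q x u w ∈ (tangentPlane M x)ᗮ := by
      refine (Submodule.mem_orthogonal' _ _).2 fun t ht => ?_
      rw [← hQ.apply_of_mem hx ht, ← hQ.inner_apply hx, hQ.apply_fderiv_apply hx hu hw,
        inner_zero_left]
    obtain ⟨s, hs⟩ := exists_smul_eq_of_mem_orthogonal hT hx0 hxT h1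
    simp only [hbdef]
    rw [hs, inner_smul_right, real_inner_self_eq_norm_sq, smul_smul, mul_comm]
  have hprod : ∀ u ∈ tangentPlane M x, ∀ w ∈ tangentPlane M x, ∀ u' ∈ tangentPlane M x,
      ∀ w' ∈ tangentPlane M x,
      ‖x‖ ^ 2 * inner ℝ (fderiv ℝ Q x u w) (fderiv ℝ Q x u' w') = b u w * b u' w' := by
    intro u hu w hw u' hu' w' hw'
    rw [← real_inner_smul_left, hII u hu w hw, real_inner_smul_left]
  -- In a plane the linear form `b v` has a nonzero kernel; such a `z` removes the mixed term of the
  -- Gauss equation.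
  obtain ⟨z, hz1, hz2⟩ : ∃ z : tangentPlane M x, ‖z‖ = 1 ∧ b v z = 0 := by
    set L : tangentPlane M x →ₗ[ℝ] ℝ :=
      ((innerSL ℝ x).comp ((fderiv ℝ Q x v).comp (tangentPlane M x).subtypeL)).toLinearMap with hL
    have hker : L.ker ≠ ⊥ := LinearMap.ker_ne_bot_of_finrank_lt (by rw [hT]; simp)
    obtain ⟨z, hzL, hz0⟩ := Submodule.exists_mem_ne_zero_of_ne_bot hker
    have hzn : ‖z‖ ≠ 0 := norm_ne_zero_iff.2 hz0
    refine ⟨‖z‖⁻¹ • z, by rw [norm_smul, norm_inv, norm_norm, inv_mul_cancel₀ hzn], ?_⟩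
    have h1 : b v z = 0 := hzL
    simp only [hbdef] at h1 ⊢
    rw [Submodule.coe_smul, map_smul, inner_smul_right, h1, mul_zero]
  refine ⟨z, z.2, hz1, ?_⟩
  have hz2' : b z v = 0 := by
    rw [← hz2]
    simp only [hbdef]
    rw [h.fderiv_proj_symm hQ hx hr hv z.2]
  have hzn : ‖(z : E3)‖ = 1 := hz1
  -- The Gauss equation, `b(v,v) b(z,z) - b(v,z)²` with `b(v,z) = 0`. As `b(v,v) ≤ -‖v‖²` and
  -- `b(z,z) ≤ -1`, the product is at least `‖v‖²`.
  have key : ‖x‖ ^ 2 * inner ℝ (curvatureOp Q x z v v) (z : E3) = b v v * b z z := by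
    rw [curvatureOp_apply, hQ.apply_of_mem hx hv, hQ.apply_of_mem hx z.2, inner_sub_left,
      hQ.inner_fderiv_apply hx z.2 (fderiv ℝ Q x v v),
      hQ.inner_fderiv_apply hx hv (fderiv ℝ Q x z v), mul_sub,
      hprod v hv v hv z z.2 z z.2, hprod z z.2 v hv v hv z z.2, hz2, hz2']
    ring
  rw [key]
  have h1 := hb v hv
  have h2 := hb z z.2
  rw [hzn] at h2
  simp only [hbdef]
  nlinarith [sq_nonneg ‖v‖]

theorem neg_inner_le {a b : E3} {α β : ℝ} (ha : ‖a‖ ≤ α) (hb : ‖b‖ ≤ β) :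
    -inner ℝ a b ≤ α * β :=
  (neg_le_abs _).trans ((abs_real_inner_le_norm a b).trans
    (mul_le_mul ha hb (norm_nonneg b) ((norm_nonneg a).trans ha)))

set_option maxHeartbeats 400000 in
/-- Near a point of locally maximal norm, `∇²V` controls `V` pointwise. -/
theorem exists_norm_le_covDeriv₂ (hQ : IsProjExtension M Q K) (hr : 0 < r)
    (hch : ∀ q ∈ M, ∃ g, IsGraphChart M q r C g) {p : E3} (hp : p ∈ M)
    (hT : Module.finrank ℝ (tangentPlane M p) = 2) (hmax : ∀ᶠ y in 𝓝[M] p, ‖y‖ ≤ ‖p‖) :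
    ∃ ρ A : ℝ, 0 < ρ ∧ 0 ≤ A ∧ ∀ V, IsSmoothTangent M V → ∀ q ∈ M, dist q p < ρ →
      ‖V q‖ ≤ A * ‖covDeriv₂ M V q‖ := by
  obtain ⟨g, hg⟩ := hch p hp
  obtain ⟨hp0, hlow⟩ := hg.exists_le_inner_curvatureOp hQ hp hr hT hmax
  have hpn : 0 < ‖p‖ := norm_pos_iff.2 hp0
  set T : E3 → E3 →L[ℝ] E3 →L[ℝ] E3 →L[ℝ] E3 := curvatureOp Q with hTdef
  set κ : ℝ := (‖p‖ ^ 2)⁻¹ with hκ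
  have hκ0 : 0 < κ := by positivity
  have hcont : Continuous fun q => ‖T q - T p‖ + 2 * ‖T p‖ * ‖Q q - Q p‖ :=
    ((continuous_curvatureOp hQ.contDiff).sub continuous_const).norm.add
      (continuous_const.mul (hQ.contDiff.continuous.sub continuous_const).norm)
  have hcont2 : Continuous fun q => ‖Q q - Q p‖ :=
    (hQ.contDiff.continuous.sub continuous_const).norm
  have hev : ∀ᶠ q in 𝓝 p, ‖T q - T p‖ + 2 * ‖T p‖ * ‖Q q - Q p‖ < κ / 4 ∧
      ‖Q q - Q p‖ < 1 / 2 :=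
    (hcont.continuousAt.eventually_lt_const (by simpa using hκ0)).and
      (hcont2.continuousAt.eventually_lt_const (by simp))
  obtain ⟨ρ, hρ, H⟩ := Metric.eventually_nhds_iff.1 hev
  refine ⟨ρ, 8 * ‖p‖ ^ 2, hρ, by positivity, fun V hV q hq hqp => ?_⟩
  obtain ⟨h1, h2⟩ := H hqp
  obtain ⟨gq, hgq⟩ := hch q hq
  set η := ‖Q q - Q p‖ with hη
  set ω := ‖T q - T p‖ with hω
  set v := V q with hv
  set v' := Q p v with hv'
  set B := ‖covDeriv₂ M V q‖ with hB
  have hvT : Q q v = v := hQ.apply_of_mem hq (hV.tangent q hq)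
  have hvv' : ‖v - v'‖ ≤ η * ‖v‖ := by
    have : v - v' = (Q q - Q p) v := by rw [sub_apply, hvT]
    rw [this]
    exact ContinuousLinearMap.le_opNorm _ _
  have hv'le : ‖v'‖ ≤ ‖v‖ := hQ.norm_apply_le hp v
  have hv'ge : ‖v‖ / 2 ≤ ‖v'‖ := by
    have h3 : ‖v‖ ≤ ‖v'‖ + ‖v - v'‖ := by
      simpa using norm_add_le v' (v - v')
    nlinarith [norm_nonneg v]
  obtain ⟨z, hz, hz1, hzle⟩ := hlow v' (hQ.apply_mem hp v)
  have hzq : ‖Q q z - z‖ ≤ η := by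
    have : Q q z - z = (Q q - Q p) z := by rw [sub_apply, hQ.apply_of_mem hp hz]
    rw [this]
    simpa [hz1] using (Q q - Q p).le_opNorm z
  have hQz : ‖Q q z‖ ≤ 1 := hz1 ▸ hQ.norm_apply_le hq z
  -- By the Ricci identity the tangential part of the curvature term at `q` is a commutator of
  -- `∇²V`, hence bounded by `B`.
  have hcomm : Q q (T q z v' v) =
      covDeriv₂ M V q (Q q z) (Q q v') - covDeriv₂ M V q (Q q v') (Q q z) := by
    rw [covDeriv₂_sub_covDeriv₂ hQ hV hq
      (fun u hu w hw => hgq.fderiv_proj_symm hQ hq hr hu hw) (hQ.apply_mem hq z)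
      (hQ.apply_mem hq v')]
    rfl
  have hup : inner ℝ (T q z v' v) (Q q z) ≤ 2 * B * ‖v'‖ := by
    have hQz' : Q q (Q q z) = Q q z := hQ.apply_of_mem hq (hQ.apply_mem hq z)
    have hb : ∀ a b : E3, ‖covDeriv₂ M V q (Q q a) (Q q b)‖ ≤ B * ‖a‖ * ‖b‖ := fun a b => by
      refine (ContinuousLinearMap.le_opNorm₂ _ _ _).trans ?_
      gcongr <;> exact hQ.norm_apply_le hq _
    calc inner ℝ (T q z v' v) (Q q z) = inner ℝ (Q q (T q z v' v)) (Q q z) := by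
          rw [hQ.inner_apply hq, hQz']
      _ ≤ ‖Q q (T q z v' v)‖ * ‖Q q z‖ := real_inner_le_norm _ _
      _ ≤ ‖Q q (T q z v' v)‖ * 1 := by gcongr
      _ ≤ B * ‖z‖ * ‖v'‖ + B * ‖v'‖ * ‖z‖ := by
          rw [mul_one, hcomm]
          exact (norm_sub_le _ _).trans (add_le_add (hb _ _) (hb _ _))
      _ = 2 * B * ‖v'‖ := by rw [hz1]; ring
  have tri : ∀ (L : E3 →L[ℝ] E3 →L[ℝ] E3 →L[ℝ] E3) (a b : E3),
      ‖L z a b‖ ≤ ‖L‖ * ‖a‖ * ‖b‖ := fun L a b => by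
    calc ‖L z a b‖ ≤ ‖L z‖ * ‖a‖ * ‖b‖ := ContinuousLinearMap.le_opNorm₂ _ _ _
      _ ≤ (‖L‖ * ‖z‖) * ‖a‖ * ‖b‖ := by gcongr; exact L.le_opNorm z
      _ = _ := by rw [hz1, mul_one]
  clear_value T v v'
  -- The curvature at `p` is replaced by that at `q` one argument at a time; each error is small by
  -- continuity of `T` and `Q`.
  have hdec : inner ℝ (T p z v' v') z = inner ℝ (T q z v' v) (Q q z) -
      inner ℝ ((T q - T p) z v' v) (Q q z) - inner ℝ (T p z v' (v - v')) (Q q z) -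
      inner ℝ (T p z v' v') (Q q z - z) := by
    simp only [sub_apply, map_sub, inner_sub_left, inner_sub_right]
    ring
  have t1 : ‖(T q - T p) z v' v‖ ≤ ω * ‖v'‖ * ‖v‖ := tri (T q - T p) v' v
  have t2 : ‖T p z v' (v - v')‖ ≤ ‖T p‖ * ‖v'‖ * ‖v - v'‖ := tri (T p) v' (v - v')
  have t3 : ‖T p z v' v'‖ ≤ ‖T p‖ * ‖v'‖ * ‖v'‖ := tri (T p) v' v'
  have c1 : 0 ≤ ‖T p‖ * ‖v'‖ := by positivity
  have t2' := t2.trans (mul_le_mul_of_nonneg_left hvv' c1)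
  have t3' := t3.trans (mul_le_mul_of_nonneg_left hv'le c1)
  have e1 := neg_inner_le t1 hQz
  have e2 := neg_inner_le t2' hQz
  have e3 := neg_inner_le t3' hzq
  have hmain : κ * ‖v'‖ ^ 2 ≤ inner ℝ (T p z v' v') z := by
    rw [hκ, inv_mul_le_iff₀ (by positivity)]
    exact hzle
  rcases (norm_nonneg v).eq_or_lt with h0 | h0
  · rw [← h0]; positivity
  have hv'0 : 0 < ‖v'‖ := by linarith
  have hfin : ‖v'‖ * (κ * ‖v'‖) ≤ ‖v'‖ * (2 * B + (ω + 2 * ‖T p‖ * η) * ‖v‖) := by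
    linarith
  have hfin2 := le_of_mul_le_mul_left hfin hv'0
  have e4 : (ω + 2 * ‖T p‖ * η) * ‖v‖ ≤ κ / 4 * ‖v‖ := by gcongr
  have e5 : κ * (‖v‖ / 2) ≤ κ * ‖v'‖ := by gcongr
  -- From `κ ‖v‖ / 2 ≤ 2 B + κ ‖v‖ / 4`; with `κ = ‖p‖⁻²` this gives the constant `8 ‖p‖²`.
  have e6 : κ * ‖v‖ ≤ 8 * B := by linarith
  rw [hκ, inv_mul_le_iff₀ (by positivity)] at e6
  linarith

end Curvature

/-! ### Uniform surfaces and the energy estimate in small discs. -/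

section GlobalEstimate

variable {M : Set E3} {r C : ℝ} {Q : E3 → E3 →L[ℝ] E3} {K : ℝ} {V : E3 → E3}

/-- Uniform charts and bounds for a compact surface. -/
structure IsUniformSurface (M : Set E3) (r C : ℝ) (Q : E3 → E3 →L[ℝ] E3) (K : ℝ) : Prop where
  isCompact : IsCompact M
  r_pos : 0 < r
  one_le_C : 1 ≤ C
  one_le_K : 1 ≤ K
  finrank : ∀ x ∈ M, Module.finrank ℝ (tangentPlane M x) = 2
  chart : ∀ x ∈ M, ∃ g, IsGraphChart M x r C g
  ext : IsProjExtension M Q K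

theorem IsClosedC3Surface.exists_isUniformSurface (hM : IsClosedC3Surface M) :
    ∃ r C Q K, IsUniformSurface M r C Q K := by
  obtain ⟨r, C, hr, hC, hch⟩ := hM.exists_uniform_isGraphChart
  obtain ⟨Q, K, hK, hQ⟩ := hM.exists_isProjExtension
  exact ⟨r, C, Q, K, hM.1, hr, hC, hK, fun x hx => hM.finrank_tangentPlane hx, hch, hQ⟩

/-- The squared `L²` norm of `∇²V`. -/
def hessEnergy (M : Set E3) (V : E3 → E3) : ℝ≥0∞ := ∫⁻ q, ‖covDeriv₂ M V q‖ₑ ^ 2 ∂area M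

theorem setLIntegral_area_mono (hM : IsClosed M) {A B : Set E3} (h : A ∩ M ⊆ B) (f : E3 → ℝ≥0∞) :
    ∫⁻ q in A, f q ∂area M ≤ ∫⁻ q in B, f q ∂area M := by
  rw [area, Measure.restrict_restrict' hM.measurableSet,
    Measure.restrict_restrict' hM.measurableSet]
  exact lintegral_mono_set fun q hq => ⟨h hq, hq.2⟩

theorem ENNReal_le_two_mul_of_le_add_half {X A : ℝ≥0∞} (hX : X ≠ ⊤) (h : X ≤ A + X / 2) :
    X ≤ 2 * A := by
  have h1 : X / 2 + X / 2 ≤ A + X / 2 := by rwa [ENNReal.add_halves]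
  have h2 : X / 2 ≤ A := (ENNReal.add_le_add_iff_right (ENNReal.div_ne_top hX (by norm_num))).1 h1
  calc X = X / 2 + X / 2 := (ENNReal.add_halves X).symm
    _ ≤ A + A := add_le_add h2 h2
    _ = 2 * A := (two_mul A).symm

/-- The derivative of the chart is the inclusion at 0 and varies at rate at most `C`. The resulting
Lipschitz constant 2 is smaller than the factor 4 of the energy estimate, and this leaves the gain
by which control spreads to larger balls. -/
theorem IsGraphChart.norm_fderiv_le_two {x : E3} {g : tangentPlane M x → E3}
    (h : IsGraphChart M x r C g) (hx : x ∈ M) {v : tangentPlane M x} (hv : ‖v‖ < r)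
    (hCv : C * ‖v‖ ≤ 1) : ‖fderiv ℝ g v‖ ≤ 2 := by
  have hr : 0 < r := (norm_nonneg v).trans_lt hv
  have h0 : ‖fderiv ℝ g 0‖ ≤ 1 := by
    refine ContinuousLinearMap.opNorm_le_bound _ zero_le_one fun e => ?_
    rw [h.fderiv_zero hx hr, one_mul]
    rfl
  have hd : Differentiable ℝ (fderiv ℝ g) :=
    (h.contDiff.fderiv_right (m := 1) (by norm_num)).differentiable (by norm_num)
  have h1 : ‖fderiv ℝ g v - fderiv ℝ g 0‖ ≤ C * ‖v - 0‖ :=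
    (convex_ball (0 : tangentPlane M x) r).norm_image_sub_le_of_norm_fderiv_le (𝕜 := ℝ)
      (fun w _ => hd w) (fun w hw => h.norm_fderiv_fderiv_le w (mem_ball_zero_iff.1 hw))
      (Metric.mem_ball_self hr) (mem_ball_zero_iff.2 hv)
  rw [sub_zero] at h1
  calc ‖fderiv ℝ g v‖ = ‖fderiv ℝ g 0 + (fderiv ℝ g v - fderiv ℝ g 0)‖ := by
        rw [add_sub_cancel]
    _ ≤ 1 + 1 := (norm_add_le _ _).trans (add_le_add h0 (h1.trans hCv))
    _ = 2 := by norm_num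

theorem IsGraphChart.dist_base_le_two_mul {x : E3} {g : tangentPlane M x → E3}
    (h : IsGraphChart M x r C g) (hx : x ∈ M) (hC : 1 ≤ C) {v : tangentPlane M x} (hv : ‖v‖ < r)
    (hCv : C * ‖v‖ ≤ 1) : dist (g v) x ≤ 2 * ‖v‖ := by
  have hr : 0 < r := (norm_nonneg v).trans_lt hv
  have h1 : ‖g v - g 0‖ ≤ 2 * ‖v - 0‖ :=
    (convex_closedBall (0 : tangentPlane M x) ‖v‖).norm_image_sub_le_of_norm_fderiv_le (𝕜 := ℝ)
      (fun w _ => h.differentiable w)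
      (fun w hw => by
        have hwv := mem_closedBall_zero_iff.1 hw
        exact h.norm_fderiv_le_two hx (hwv.trans_lt hv) ((by gcongr : C * ‖w‖ ≤ C * ‖v‖).trans hCv))
      (by simp) (by simp)
  rwa [h.apply_zero hx hr, ← dist_eq_norm, sub_zero] at h1

namespace IsUniformSurface

variable (hS : IsUniformSurface M r C Q K)
include hS

theorem enorm_fderiv_fderiv_sq_le (hV : IsSmoothTangent M V) {x : E3} {g : tangentPlane M x → E3}
    (h : IsGraphChart M x r C g) {v : tangentPlane M x} (hv : ‖v‖ < r) :
    ‖fderiv ℝ (fderiv ℝ (fun v => V (g v))) v‖ₑ ^ 2 ≤ ENNReal.ofReal (48 * K ^ 4 * C ^ 4) *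
      (‖V (g v)‖ₑ ^ 2 + ‖covDeriv M V (g v)‖ₑ ^ 2 + ‖covDeriv₂ M V (g v)‖ₑ ^ 2) := by
  have h1 := h.norm_fderiv_fderiv_comp_le hS.ext hV hS.one_le_C hS.one_le_K hv
  rw [hS.ext.covDeriv_eq hV (h.mem v hv)]
  simp only [← ofReal_norm_sq]
  rw [← ENNReal.ofReal_add (by positivity) (by positivity),
    ← ENNReal.ofReal_add (by positivity) (by positivity),
    ← ENNReal.ofReal_mul (by positivity)]
  apply ENNReal.ofReal_le_ofReal
  set a := ‖V (g v)‖
  set b := ‖covExt Q V (g v)‖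
  set c := ‖covDeriv₂ M V (g v)‖
  calc _ ≤ (4 * K ^ 2 * C ^ 2 * (a + b + c)) ^ 2 := by gcongr
    _ = 16 * K ^ 4 * C ^ 4 * (a + b + c) ^ 2 := by ring
    _ ≤ 16 * K ^ 4 * C ^ 4 * (3 * (a ^ 2 + b ^ 2 + c ^ 2)) := by
        gcongr
        nlinarith [sq_nonneg (a - b), sq_nonneg (a - c), sq_nonneg (b - c)]
    _ = _ := by ring

theorem enorm_covDeriv_le (hV : IsSmoothTangent M V) {x : E3} (hx : x ∈ M)
    {g : tangentPlane M x → E3}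
    (h : IsGraphChart M x r C g) {v : tangentPlane M x} (hv : ‖v‖ < r / C) :
    ‖covDeriv M V (g v)‖ₑ ≤ ‖fderiv ℝ (fun v => V (g v)) v‖ₑ := by
  have hvr := (IsGraphChart.lt_of_lt_div hS.one_le_C (norm_nonneg v) hv).1
  rw [hS.ext.covDeriv_eq hV (h.mem v hvr), ← ofReal_norm, ← ofReal_norm]
  exact ENNReal.ofReal_le_ofReal (h.norm_covExt_le hS.ext hV hvr
    (h.dist_base_lt hx hS.one_le_C hv))

/-- In small discs of a chart, `V` and its derivative are controlled by `V` in a smaller disc and by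
`∇²V`. -/
theorem exists_energy_le : ∃ (ρ₀ : ℝ) (A : ℝ≥0∞), 0 < ρ₀ ∧ A ≠ ⊤ ∧ 4 * ρ₀ < r / C ∧ C * ρ₀ ≤ 1 ∧
    ∀ ρ, 0 < ρ → ρ ≤ ρ₀ → ∀ x ∈ M, ∀ g, IsGraphChart M x r C g → ∀ V, IsSmoothTangent M V →
      ∫⁻ v in Metric.closedBall 0 (4 * ρ), (‖V (g v)‖ₑ ^ 2 +
          ENNReal.ofReal ρ ^ 2 * ‖fderiv ℝ (fun v => V (g v)) v‖ₑ ^ 2) ∂planeArea M x ≤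
        A * (∫⁻ v in Metric.closedBall 0 ρ, ‖V (g v)‖ₑ ^ 2 ∂planeArea M x + hessEnergy M V) := by
  have hC := hS.one_le_C
  have hK := hS.one_le_K
  have hr := hS.r_pos
  set c : ℝ := 48 * K ^ 4 * C ^ 4 with hc
  have hc1 : 1 ≤ c := by
    have h1 : 1 ≤ K ^ 4 := one_le_pow₀ hK
    have h2 : 1 ≤ C ^ 4 := one_le_pow₀ hC
    nlinarith
  -- The first bound keeps the disc of radius `4 ρ` in the domain of the chart. The second gives
  -- `10⁹ c ρ ≤ 1/2`, which allows the lower order terms of the chart Hessian to be absorbed.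
  set ρ₀ : ℝ := min (r / C / 8) (1 / (10 ^ 9 * c * C * 2)) with hρ₀
  have hρ₀0 : 0 < ρ₀ := by positivity
  have hb1 : ρ₀ ≤ r / C / 8 := min_le_left _ _
  have hb2 : ρ₀ * (10 ^ 9 * c * C * 2) ≤ 1 := by
    rw [← le_div_iff₀ (by positivity)]; exact min_le_right _ _
  have hρ₀1 : ρ₀ * C ≤ 1 := by
    have : 0 < ρ₀ * C := by positivity
    nlinarith
  have hρ₀2 : ρ₀ ≤ 1 := by nlinarith
  have hρ₀3 : 10 ^ 9 * c * ρ₀ ≤ 1 / 2 := by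
    have : 0 < ρ₀ * c := by positivity
    nlinarith
  have hrC : 0 < r / C := by positivity
  refine ⟨ρ₀, 2 * (10 ^ 9 * ENNReal.ofReal c), hρ₀0, by finiteness, by linarith, by linarith,
    fun ρ hρ hρρ₀ x hx g h V hV => ?_⟩
  have := isAddHaarMeasure_planeArea (hS.finrank x hx)
  have hu := h.contDiff_comp hV
  set u : tangentPlane M x → E3 := fun v => V (g v) with hudef
  have hu1 : ContDiff ℝ 1 (fderiv ℝ u) := hu.fderiv_right (by norm_num)
  have hcu : Continuous u := hu.continuous
  have hcu1 : Continuous (fderiv ℝ u) := hu1.continuous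
  set D := Metric.closedBall (0 : tangentPlane M x) (4 * ρ) with hD
  have hDm : MeasurableSet D := Metric.isClosed_closedBall.measurableSet
  have hDr : ∀ v ∈ D, ‖v‖ < r / C := fun v hv => by
    have := mem_closedBall_zero_iff.1 hv
    linarith
  have hDr' : ∀ v ∈ D, ‖v‖ < r := fun v hv =>
    (IsGraphChart.lt_of_lt_div hC (norm_nonneg v) (hDr v hv)).1
  set X := ∫⁻ v in D, (‖u v‖ₑ ^ 2 + ENNReal.ofReal ρ ^ 2 * ‖fderiv ℝ u v‖ₑ ^ 2) ∂planeArea M x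
    with hX
  set S := ∫⁻ v in Metric.closedBall 0 ρ, ‖u v‖ₑ ^ 2 ∂planeArea M x with hSdef
  have hfc : Continuous fun v => ‖u v‖ₑ ^ 2 + ENNReal.ofReal ρ ^ 2 * ‖fderiv ℝ u v‖ₑ ^ 2 := by
    have hcst : ENNReal.ofReal ρ ^ 2 ≠ ⊤ := by finiteness
    have h1 : Continuous fun v => ‖fderiv ℝ u v‖ₑ ^ 2 := by fun_prop
    exact (by fun_prop : Continuous fun v => ‖u v‖ₑ ^ 2).add
      (ENNReal.continuous_const_mul hcst |>.comp h1)
  -- Absorbing `X / 2` in the extended nonnegative reals requires `X` to be finite.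
  have hXtop : X ≠ ⊤ := by
    have hcomp : IsCompact D := isCompact_closedBall _ _
    obtain ⟨v₀, hv₀, hmax⟩ := hcomp.exists_isMaxOn ⟨0, by simp [hD, hρ.le]⟩ hfc.continuousOn
    refine (setLIntegral_lt_top_of_le_nnreal hcomp.measure_lt_top.ne
      ⟨(‖u v₀‖ₑ ^ 2 + ENNReal.ofReal ρ ^ 2 * ‖fderiv ℝ u v₀‖ₑ ^ 2).toNNReal, fun v hv => ?_⟩).ne
    rw [ENNReal.coe_toNNReal (by finiteness)]
    exact hmax hv
  have hB := lintegral_closedBall_le (planeArea M x) (hS.finrank x hx) hu hρ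
  set κ : ℝ≥0∞ := 10 ^ 9 * ENNReal.ofReal ρ ^ 4 * ENNReal.ofReal c with hκ
  have hκreal : κ = ENNReal.ofReal (10 ^ 9 * ρ ^ 4 * c) := by
    rw [hκ, ENNReal.ofReal_mul (p := 10 ^ 9 * ρ ^ 4) (by positivity),
      ENNReal.ofReal_mul (p := 10 ^ 9) (by positivity), ENNReal.ofReal_pow hρ.le]
    norm_num
  have hκ1 : κ ≤ ENNReal.ofReal (1 / 2) * ENNReal.ofReal ρ ^ 2 := by
    rw [hκreal, ← ENNReal.ofReal_pow hρ.le, ← ENNReal.ofReal_mul (by norm_num)]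
    apply ENNReal.ofReal_le_ofReal
    have h1 : 10 ^ 9 * c * ρ ≤ 1 / 2 := (by gcongr : _ ≤ 10 ^ 9 * c * ρ₀).trans hρ₀3
    have h2 : ρ ≤ 1 := hρρ₀.trans hρ₀2
    calc 10 ^ 9 * ρ ^ 4 * c = (10 ^ 9 * c * ρ) * ρ * ρ ^ 2 := by ring
      _ ≤ (1 / 2) * 1 * ρ ^ 2 := by gcongr
      _ = _ := by ring
  have hρ1 : ENNReal.ofReal ρ ≤ 1 := by
    rw [← ENNReal.ofReal_one]; exact ENNReal.ofReal_le_ofReal (hρρ₀.trans hρ₀2)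
  have hhalf : ENNReal.ofReal (1 / 2) = 2⁻¹ := by
    rw [one_div, ENNReal.ofReal_inv_of_pos (by norm_num)]; norm_num
  have hκ2 : κ ≤ 2⁻¹ := by
    rw [hhalf] at hκ1
    refine hκ1.trans ?_
    calc (2⁻¹ : ℝ≥0∞) * ENNReal.ofReal ρ ^ 2 ≤ 2⁻¹ * 1 ^ 2 := by gcongr
      _ = 2⁻¹ := by simp
  have hκ3 : κ ≤ 10 ^ 9 * 1 ^ 4 * ENNReal.ofReal c := by rw [hκ]; gcongr
  -- The chart Hessian costs V, ∇V and ∇²V. The factor `ρ⁴` brings the first two below half of the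
  -- integrand of `X`, so that only ∇²V remains.
  have hpt : ∀ v ∈ D, 10 ^ 9 * ENNReal.ofReal ρ ^ 4 * ‖fderiv ℝ (fderiv ℝ u) v‖ₑ ^ 2 ≤
      2⁻¹ * (‖u v‖ₑ ^ 2 + ENNReal.ofReal ρ ^ 2 * ‖fderiv ℝ u v‖ₑ ^ 2) +
        10 ^ 9 * ENNReal.ofReal c * ‖covDeriv₂ M V (g v)‖ₑ ^ 2 := by
    intro v hv
    have h1 := hS.enorm_fderiv_fderiv_sq_le hV h (hDr' v hv)
    have h2 := hS.enorm_covDeriv_le hV hx h (hDr v hv)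
    calc _ ≤ 10 ^ 9 * ENNReal.ofReal ρ ^ 4 * (ENNReal.ofReal c * (‖u v‖ₑ ^ 2 +
          ‖fderiv ℝ u v‖ₑ ^ 2 + ‖covDeriv₂ M V (g v)‖ₑ ^ 2)) := by
          gcongr
          exact h1.trans (by gcongr)
      _ = κ * ‖u v‖ₑ ^ 2 + κ * ‖fderiv ℝ u v‖ₑ ^ 2 + κ * ‖covDeriv₂ M V (g v)‖ₑ ^ 2 := by
          rw [hκ]; ring
      _ ≤ 2⁻¹ * ‖u v‖ₑ ^ 2 + (ENNReal.ofReal (1 / 2) * ENNReal.ofReal ρ ^ 2) *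
            ‖fderiv ℝ u v‖ₑ ^ 2 +
          (10 ^ 9 * 1 ^ 4 * ENNReal.ofReal c) * ‖covDeriv₂ M V (g v)‖ₑ ^ 2 := by
          gcongr
      _ = _ := by rw [hhalf]; ring
  have hHD : ∫⁻ v in D, ‖covDeriv₂ M V (g v)‖ₑ ^ 2 ∂planeArea M x ≤ hessEnergy M V :=
    (h.lintegral_comp_le hS.isCompact.isClosed (isCompact_closedBall _ _) hDr'
      (fun q => ‖covDeriv₂ M V q‖ₑ ^ 2)).trans (setLIntegral_le_lintegral _ _)
  have hmain : X ≤ 10 ^ 9 * ENNReal.ofReal c * (S + hessEnergy M V) + X / 2 := by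
    calc X ≤ 10 ^ 9 * S + ∫⁻ v in D, 10 ^ 9 * ENNReal.ofReal ρ ^ 4 *
            ‖fderiv ℝ (fderiv ℝ u) v‖ₑ ^ 2 ∂planeArea M x := by
          rw [lintegral_const_mul' _ _ (by finiteness), mul_assoc, ← mul_add]
          exact hB
      _ ≤ 10 ^ 9 * S + ∫⁻ v in D, (2⁻¹ * (‖u v‖ₑ ^ 2 +
            ENNReal.ofReal ρ ^ 2 * ‖fderiv ℝ u v‖ₑ ^ 2) +
            10 ^ 9 * ENNReal.ofReal c * ‖covDeriv₂ M V (g v)‖ₑ ^ 2) ∂planeArea M x := by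
          gcongr 10 ^ 9 * S + ?_
          exact setLIntegral_mono' hDm hpt
      _ = 10 ^ 9 * S + (2⁻¹ * X + 10 ^ 9 * ENNReal.ofReal c *
            ∫⁻ v in D, ‖covDeriv₂ M V (g v)‖ₑ ^ 2 ∂planeArea M x) := by
          rw [lintegral_add_left (hfc.measurable.const_mul _),
            lintegral_const_mul' _ _ (by simp), lintegral_const_mul' _ _ (by finiteness)]
      _ ≤ (10 ^ 9 * ENNReal.ofReal c) * S + (2⁻¹ * X + 10 ^ 9 * ENNReal.ofReal c *
            hessEnergy M V) := by
          gcongr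
          · exact le_mul_of_one_le_right' (by
              rw [← ENNReal.ofReal_one]; exact ENNReal.ofReal_le_ofReal hc1)
      _ = _ := by rw [ENNReal.div_eq_inv_mul]; ring
  rw [mul_assoc]
  exact ENNReal_le_two_mul_of_le_add_half hXtop hmain

end IsUniformSurface

end GlobalEstimate

/-! ### The Poincaré inequality: ∇²V controls V in L² and uniformly, and ∇V in L². -/

section Poincare

variable {M : Set E3} {r C : ℝ} {Q : E3 → E3 →L[ℝ] E3} {K : ℝ} {V : E3 → E3}

/-- The `L²` norm of tangent fields on the ball of radius `ρ` around `x` is controlled by the `L²` norm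
of their second covariant derivatives on `M`. -/
def IsControlled (M : Set E3) (x : E3) (ρ : ℝ) : Prop :=
  ∃ A : ℝ≥0∞, A ≠ ⊤ ∧ ∀ V, IsSmoothTangent M V →
    ∫⁻ q in Metric.closedBall x ρ, ‖V q‖ₑ ^ 2 ∂area M ≤ A * hessEnergy M V

theorem IsControlled.mono (hM : IsClosed M) {x y : E3} {ρ σ : ℝ} (h : IsControlled M x ρ)
    (hyx : σ + dist y x ≤ ρ) : IsControlled M y σ := by
  obtain ⟨A, hA, hV⟩ := h
  refine ⟨A, hA, fun V hVt => (setLIntegral_area_mono hM ?_ _).trans (hV V hVt)⟩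
  exact Set.inter_subset_left.trans (Metric.closedBall_subset_closedBall' hyx)

theorem area_lt_top (hM : IsUniformSurface M r C Q K) : area M Set.univ < ⊤ := by
  have hr := hM.r_pos
  have hC := hM.one_le_C
  rw [area, Measure.restrict_apply_univ]
  refine hM.isCompact.induction_on (p := fun s => μHE[2] s < ⊤) (by simp)
    (fun s t hst ht => (measure_mono hst).trans_lt ht)
    (fun s t hs ht => (measure_union_le s t).trans_lt (ENNReal.add_lt_top.2 ⟨hs, ht⟩))
    fun x hx => ?_
  refine ⟨M ∩ Metric.ball x (r / 2),
    inter_mem_nhdsWithin _ (Metric.ball_mem_nhds x (by positivity)), ?_⟩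
  obtain ⟨g, h⟩ := hM.chart x hx
  have := isAddHaarMeasure_planeArea (hM.finrank x hx)
  have h1 := h.lintegral_image_le (s := Metric.closedBall 0 (r / 2))
    (fun v hv => by have := mem_closedBall_zero_iff.1 hv; linarith) (fun _ => 1)
  simp only [lintegral_const, one_mul, Measure.restrict_apply_univ] at h1
  have hsub : M ∩ Metric.ball x (r / 2) ⊆ g '' Metric.closedBall 0 (r / 2) ∩ M := by
    rintro q ⟨hq, hd⟩
    rw [Metric.mem_ball] at hd
    refine ⟨⟨tangentCoord M x (q - x), ?_, h.eq_of_mem q hq (by linarith)⟩, hq⟩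
    rw [mem_closedBall_zero_iff]
    exact (norm_tangentCoord_le M x _).trans (by rw [← dist_eq_norm]; exact hd.le)
  calc μHE[2] (M ∩ Metric.ball x (r / 2)) ≤ μHE[2] (g '' Metric.closedBall 0 (r / 2) ∩ M) :=
        measure_mono hsub
    _ = area M (g '' Metric.closedBall 0 (r / 2)) := by
        rw [area, Measure.restrict_apply' hM.isCompact.isClosed.measurableSet]
    _ ≤ _ := h1
    _ < ⊤ := by
        have : planeArea M x (Metric.closedBall 0 (r / 2)) < ⊤ :=
          (isCompact_closedBall _ _).measure_lt_top
        finiteness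

variable (hS : IsUniformSurface M r C Q K)
include hS

theorem IsUniformSurface.lintegral_closedBall_le_chart {x : E3}
    {g : tangentPlane M x → E3} (h : IsGraphChart M x r C g) {ρ : ℝ} (hρ : ρ < r)
    (f : E3 → ℝ≥0∞) : ∫⁻ q in Metric.closedBall x ρ, f q ∂area M ≤
      ENNReal.ofReal C ^ 2 * ∫⁻ v in Metric.closedBall 0 ρ, f (g v) ∂planeArea M x := by
  refine (setLIntegral_area_mono hS.isCompact.isClosed ?_ f).trans
    (h.lintegral_image_le (s := Metric.closedBall 0 ρ)
      (fun v hv => (mem_closedBall_zero_iff.1 hv).trans_lt hρ) f)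
  rintro q ⟨hd, hq⟩
  rw [Metric.mem_closedBall] at hd
  refine ⟨tangentCoord M x (q - x), ?_, h.eq_of_mem q hq (by linarith)⟩
  rw [mem_closedBall_zero_iff]
  exact (norm_tangentCoord_le M x _).trans (by rwa [← dist_eq_norm])

/-- Control passes from small balls to balls of a fixed radius. -/
theorem IsUniformSurface.exists_isControlled : ∃ ρ₀ > 0,
    (∀ x ∈ M, ∀ ρ > 0, IsControlled M x ρ → IsControlled M x ρ₀) ∧
    ∃ A : ℝ≥0∞, A ≠ ⊤ ∧ ∀ x ∈ M, ∀ V, IsSmoothTangent M V →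
      ∫⁻ q in Metric.closedBall x ρ₀, ‖covDeriv M V q‖ₑ ^ 2 ∂area M ≤
        A * (∫⁻ q, ‖V q‖ₑ ^ 2 ∂area M + hessEnergy M V) := by
  have hC := hS.one_le_C
  have hr := hS.r_pos
  obtain ⟨ρ₀, A, hρ₀, hA, hρr, hCρ, hE⟩ := hS.exists_energy_le
  have hclosed := hS.isCompact.isClosed
  have hsm : ∀ ρ, ρ ≤ ρ₀ → ∀ x ∈ M, ∀ g, IsGraphChart M x r C g → ∀ V : E3 → E3,
      ∫⁻ v in Metric.closedBall 0 ρ, ‖V (g v)‖ₑ ^ 2 ∂planeArea M x ≤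
        ∫⁻ q in Metric.closedBall x (2 * ρ), ‖V q‖ₑ ^ 2 ∂area M := by
    intro ρ hρ x hx g h V
    have hlt : ∀ v ∈ Metric.closedBall (0 : tangentPlane M x) ρ, ‖v‖ < r := fun v hv =>
      (IsGraphChart.lt_of_lt_div hC (norm_nonneg v)
        (by have := mem_closedBall_zero_iff.1 hv; have := norm_nonneg v; linarith)).1
    refine (h.lintegral_comp_le hclosed (isCompact_closedBall _ _) hlt
      (fun q => ‖V q‖ₑ ^ 2)).trans (lintegral_mono_set ?_)
    rintro _ ⟨v, hv, rfl⟩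
    have hv' := mem_closedBall_zero_iff.1 hv
    refine (h.dist_base_le_two_mul hx hC (hlt v hv) ?_).trans (by linarith)
    exact (by gcongr; linarith : C * ‖v‖ ≤ C * ρ₀).trans hCρ
  have h4 : ∀ ρ ≤ ρ₀, 4 * ρ < r := fun ρ hρ =>
    have : r / C ≤ r := div_le_self hr.le hC
    by linarith
  -- The ball of radius `2 ρ` contains the image of the chart disc of radius `ρ`; the energy
  -- estimate passes to the disc of radius `4 ρ`, whose image covers the ball of radius `4 ρ` in
  -- `M`.
  have hdouble : ∀ x ∈ M, ∀ ρ, 0 < ρ → ρ ≤ ρ₀ → IsControlled M x (2 * ρ) →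
      IsControlled M x (4 * ρ) := by
    rintro x hx ρ hρ hρρ ⟨B, hB, hBV⟩
    obtain ⟨g, h⟩ := hS.chart x hx
    refine ⟨ENNReal.ofReal C ^ 2 * (A * (B + 1)), by finiteness, fun V hV => ?_⟩
    refine (hS.lintegral_closedBall_le_chart h (h4 ρ hρρ) _).trans ?_
    rw [mul_assoc]
    gcongr
    calc _ ≤ ∫⁻ v in Metric.closedBall 0 (4 * ρ), (‖V (g v)‖ₑ ^ 2 +
          ENNReal.ofReal ρ ^ 2 * ‖fderiv ℝ (fun v => V (g v)) v‖ₑ ^ 2) ∂planeArea M x := by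
          gcongr; exact le_self_add
      _ ≤ _ := hE ρ hρ hρρ x hx g h V hV
      _ ≤ A * (B * hessEnergy M V + hessEnergy M V) := by
          gcongr
          exact (hsm ρ hρρ x hx g h V).trans (hBV V hV)
      _ = _ := by ring
  refine ⟨ρ₀, hρ₀, fun x hx ρ hρ hctl => ?_, ENNReal.ofReal C ^ 2 *
    ((ENNReal.ofReal ρ₀ ^ 2)⁻¹ * A), ?_, fun x hx V hV => ?_⟩
  -- Control on an arbitrarily small ball is doubled until the radius reaches `2 ρ₀`. The constant
  -- may depend on the number of doublings, since `IsControlled` only asks for some constant.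
  · have hind : ∀ n : ℕ, IsControlled M x (2 * (ρ₀ / 2 ^ n)) → IsControlled M x (2 * ρ₀) := by
      intro n
      induction n with
      | zero => intro h; simpa using h
      | succ n ih =>
        intro h
        refine ih ?_
        have := hdouble x hx (ρ₀ / 2 ^ (n + 1)) (by positivity)
          (div_le_self hρ₀.le (one_le_pow₀ (by norm_num))) h
        convert this using 1
        rw [pow_succ]; ring
    obtain ⟨n, hn⟩ := exists_pow_lt_of_lt_one (show 0 < ρ / (2 * ρ₀) by positivity)
      (show (1 / 2 : ℝ) < 1 by norm_num)
    refine (hind n (hctl.mono hclosed ?_)).mono hclosed (by simp; linarith)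
    rw [dist_self, add_zero]
    rw [lt_div_iff₀ (by positivity), one_div, inv_pow] at hn
    calc 2 * (ρ₀ / 2 ^ n) = ((2 : ℝ) ^ n)⁻¹ * (2 * ρ₀) := by rw [div_eq_mul_inv]; ring
      _ ≤ ρ := hn.le
  · have : ENNReal.ofReal ρ₀ ^ 2 ≠ 0 := by simp [hρ₀]
    finiteness
  · obtain ⟨g, h⟩ := hS.chart x hx
    have h0 : ENNReal.ofReal ρ₀ ^ 2 ≠ 0 := by simp [hρ₀]
    have hle : Metric.closedBall x ρ₀ ⊆ Metric.closedBall x (4 * ρ₀) :=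
      Metric.closedBall_subset_closedBall (by linarith)
    refine (lintegral_mono_set hle).trans
      ((hS.lintegral_closedBall_le_chart h (h4 ρ₀ le_rfl) _).trans ?_)
    rw [mul_assoc]
    gcongr
    rw [mul_assoc, ← ENNReal.mul_le_iff_le_inv h0 (by finiteness),
      ← lintegral_const_mul' _ _ (by finiteness)]
    calc _ ≤ ∫⁻ v in Metric.closedBall 0 (4 * ρ₀), (‖V (g v)‖ₑ ^ 2 +
          ENNReal.ofReal ρ₀ ^ 2 * ‖fderiv ℝ (fun v => V (g v)) v‖ₑ ^ 2) ∂planeArea M x := by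
          refine setLIntegral_mono' Metric.isClosed_closedBall.measurableSet fun v hv => ?_
          refine le_trans ?_ le_add_self
          gcongr
          exact hS.enorm_covDeriv_le hV hx h ((mem_closedBall_zero_iff.1 hv).trans_lt hρr)
      _ ≤ _ := hE ρ₀ hρ₀ le_rfl x hx g h V hV
      _ ≤ _ := by
          gcongr
          exact (hsm ρ₀ le_rfl x hx g h V).trans (setLIntegral_le_lintegral _ _)

/-- Control passes to all points within `ρ₀`, so the bad set `T` is open and closed in `M`. A point
of `T` farthest from the origin is then a local maximum of the norm on all of `M`, and there the
curvature gives control on a small ball. -/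
theorem IsUniformSurface.forall_isControlled : ∃ ρ₀ > 0, ∀ x ∈ M, IsControlled M x ρ₀ := by
  have hclosed := hS.isCompact.isClosed
  obtain ⟨ρ₀, hρ₀, hstep, -⟩ := hS.exists_isControlled
  refine ⟨ρ₀, hρ₀, ?_⟩
  by_contra! hne
  obtain ⟨x₀, hx₀, hbad⟩ := hne
  set T := {x ∈ M | ¬ IsControlled M x ρ₀} with hT
  -- The ball around `x` contains a small ball around `y`, and control there enlarges back to radius
  -- `ρ₀`.
  have hTgood : ∀ x ∈ M, x ∉ T → ∀ y ∈ M, dist y x < ρ₀ → y ∉ T := by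
    rintro x hx hxT y hy hyx ⟨-, hyT⟩
    have hc : IsControlled M x ρ₀ := by_contra fun h => hxT ⟨hx, h⟩
    exact hyT (hstep y hy (ρ₀ - dist y x) (by linarith) (hc.mono hclosed (by linarith)))
  have hTclosed : IsClosed T := by
    refine isClosed_of_closure_subset fun x hx => ?_
    have hxM : x ∈ M := closure_minimal (fun y hy => hy.1) hclosed hx
    by_contra hxT
    obtain ⟨y, hy, hd⟩ := Metric.mem_closure_iff.1 hx ρ₀ hρ₀
    exact hTgood x hxM hxT y hy.1 (by rwa [dist_comm]) hy
  have hTc : IsCompact T := hS.isCompact.of_isClosed_subset hTclosed fun x hx => hx.1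
  obtain ⟨p, hp, hpmax⟩ := hTc.exists_isMaxOn ⟨x₀, hx₀, hbad⟩ continuous_norm.continuousOn
  have hmax : ∀ᶠ y in 𝓝[M] p, ‖y‖ ≤ ‖p‖ := by
    filter_upwards [inter_mem_nhdsWithin M (Metric.ball_mem_nhds p hρ₀)] with y hy
    refine hpmax (by_contra fun hyT => ?_)
    exact hTgood y hy.1 hyT p hp.1 (by rw [dist_comm]; exact hy.2) hp
  obtain ⟨ρ, A, hρ, hA, hV⟩ := exists_norm_le_covDeriv₂ hS.ext hS.r_pos hS.chart hp.1
    (hS.finrank p hp.1) hmax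
  refine hp.2 (hstep p hp.1 (ρ / 2) (by positivity) ⟨ENNReal.ofReal A ^ 2, by finiteness,
    fun V hVt => ?_⟩)
  calc _ ≤ ∫⁻ q in Metric.closedBall p (ρ / 2),
        ENNReal.ofReal A ^ 2 * ‖covDeriv₂ M V q‖ₑ ^ 2 ∂area M := by
        refine lintegral_mono_ae ?_
        rw [area, Measure.restrict_restrict' hclosed.measurableSet]
        filter_upwards [ae_restrict_mem
          (Metric.isClosed_closedBall.measurableSet.inter hclosed.measurableSet)] with q hq
        have h1 := hV V hVt q hq.2
          ((Metric.mem_closedBall.1 hq.1).trans_lt (by linarith))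
        rw [← mul_pow]
        gcongr
        rw [← ofReal_norm, ← ofReal_norm, ← ENNReal.ofReal_mul hA]
        exact ENNReal.ofReal_le_ofReal h1
    _ = ENNReal.ofReal A ^ 2 *
        ∫⁻ q in Metric.closedBall p (ρ / 2), ‖covDeriv₂ M V q‖ₑ ^ 2 ∂area M :=
        lintegral_const_mul' _ _ (by finiteness)
    _ ≤ _ := by gcongr; exact setLIntegral_le_lintegral _ _

/-- Local bounds on a compact surface add up to a global one. -/
theorem IsUniformSurface.lintegral_le_of_forall_closedBall {ρ₀ : ℝ} (hρ₀ : 0 < ρ₀)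
    (F : (E3 → E3) → E3 → ℝ≥0∞) (N : (E3 → E3) → ℝ≥0∞)
    (h : ∀ x ∈ M, ∃ A : ℝ≥0∞, A ≠ ⊤ ∧ ∀ V, IsSmoothTangent M V →
      ∫⁻ q in Metric.closedBall x ρ₀, F V q ∂area M ≤ A * N V) :
    ∃ A : ℝ≥0∞, A ≠ ⊤ ∧ ∀ V, IsSmoothTangent M V → ∫⁻ q, F V q ∂area M ≤ A * N V := by
  set P : Set E3 → Prop := fun s => ∃ A : ℝ≥0∞, A ≠ ⊤ ∧ ∀ V, IsSmoothTangent M V →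
      ∫⁻ q in s, F V q ∂area M ≤ A * N V with hP
  have hPM : P M := by
    refine hS.isCompact.induction_on (p := P) ⟨0, by simp, by simp⟩ ?_ ?_ ?_
    · rintro s t hst ⟨A, hA, hV⟩
      exact ⟨A, hA, fun V hVt => (lintegral_mono_set hst).trans (hV V hVt)⟩
    · rintro s t ⟨A, hA, hV⟩ ⟨B, hB, hW⟩
      refine ⟨A + B, by finiteness, fun V hVt => (lintegral_union_le _ _ _).trans ?_⟩
      rw [add_mul]
      exact add_le_add (hV V hVt) (hW V hVt)
    · exact fun x hx => ⟨Metric.closedBall x ρ₀,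
        mem_nhdsWithin_of_mem_nhds (Metric.closedBall_mem_nhds x hρ₀), h x hx⟩
  obtain ⟨A, hA, hV⟩ := hPM
  refine ⟨A, hA, fun V hVt => ?_⟩
  have := hV V hVt
  rwa [area, Measure.restrict_restrict' hS.isCompact.isClosed.measurableSet, Set.inter_self] at this

/-- The field is controlled first, through `forall_isControlled`; the gradient bound then follows
from the energy estimate. No kernel has to be factored out, so the seminorm dominates the full norm.
-/
theorem IsUniformSurface.exists_lintegral_le_hessEnergy : ∃ A : ℝ≥0∞, A ≠ ⊤ ∧
    ∀ V, IsSmoothTangent M V →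
      ∫⁻ q, ‖V q‖ₑ ^ 2 ∂area M + ∫⁻ q, ‖covDeriv M V q‖ₑ ^ 2 ∂area M ≤ A * hessEnergy M V := by
  obtain ⟨ρ₀, hρ₀, h⟩ := hS.forall_isControlled
  obtain ⟨A, hA, hV⟩ := hS.lintegral_le_of_forall_closedBall hρ₀ (fun V q => ‖V q‖ₑ ^ 2)
    (hessEnergy M) h
  obtain ⟨ρ₁, hρ₁, -, B, hB, hgrad⟩ := hS.exists_isControlled
  obtain ⟨B', hB', hW⟩ := hS.lintegral_le_of_forall_closedBall hρ₁
    (fun V q => ‖covDeriv M V q‖ₑ ^ 2) (fun V => ∫⁻ q, ‖V q‖ₑ ^ 2 ∂area M + hessEnergy M V)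
    fun x hx => ⟨B, hB, hgrad x hx⟩
  refine ⟨A + B' * (A + 1), by finiteness, fun V hVt => ?_⟩
  calc _ ≤ A * hessEnergy M V + B' * (A * hessEnergy M V + hessEnergy M V) := by
        gcongr
        · exact hV V hVt
        · refine (hW V hVt).trans ?_
          gcongr
          exact hV V hVt
    _ = _ := by ring

/-- The integrand of the squared `H²` norm. -/
def sobolevDensity (M : Set E3) (V : E3 → E3) (q : E3) : ℝ≥0∞ :=
  ‖V q‖ₑ ^ 2 + ‖covDeriv M V q‖ₑ ^ 2 + ‖covDeriv₂ M V q‖ₑ ^ 2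

theorem IsUniformSurface.exists_lintegral_sobolevDensity_le : ∃ A : ℝ≥0∞, A ≠ ⊤ ∧
    ∀ V, IsSmoothTangent M V → ∫⁻ q, sobolevDensity M V q ∂area M ≤ A * hessEnergy M V := by
  obtain ⟨A, hA, hVA⟩ := hS.exists_lintegral_le_hessEnergy
  refine ⟨A + 1, by finiteness, fun V hV => ?_⟩
  have hm : AEMeasurable (fun q => ‖covDeriv M V q‖ₑ ^ 2) (area M) := by
    have h1 : Continuous (covExt Q V) := (hS.ext.contDiff_covExt hV).continuous
    refine AEMeasurable.congr (f := fun q => ‖covExt Q V q‖ₑ ^ 2) (by fun_prop) ?_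
    filter_upwards [ae_restrict_mem hS.isCompact.isClosed.measurableSet] with q hq
    rw [hS.ext.covDeriv_eq hV hq]
  have hm' : Measurable fun q => ‖V q‖ₑ ^ 2 := by
    have := hV.contDiff.continuous
    fun_prop
  unfold sobolevDensity
  rw [lintegral_add_left' (f := fun q => ‖V q‖ₑ ^ 2 + ‖covDeriv M V q‖ₑ ^ 2)
    (hm'.aemeasurable.add hm), lintegral_add_left hm', add_mul, one_mul]
  exact add_le_add (hVA V hV) le_rfl

/-- The sup norm is controlled by `∇²V`. -/
theorem IsUniformSurface.exists_enorm_sq_le_hessEnergy : ∃ A : ℝ≥0∞, A ≠ ⊤ ∧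
    ∀ V, IsSmoothTangent M V → ∀ x ∈ M, ‖V x‖ₑ ^ 2 ≤ A * hessEnergy M V := by
  obtain ⟨A, hA, hVA⟩ := hS.exists_lintegral_sobolevDensity_le
  have hC := hS.one_le_C
  have hclosed := hS.isCompact.isClosed
  obtain ⟨ρ, A₁, hρ, hA₁, hρr, hCρ, hE⟩ := hS.exists_energy_le
  set c : ℝ≥0∞ := ENNReal.ofReal (48 * K ^ 4 * C ^ 4) with hc
  set B : ℝ≥0∞ := 2 * (ENNReal.ofReal ρ ^ 4 * (c * A)) + 4 * (A₁ * (A + 1)) with hB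
  have hπ : ENNReal.ofReal (Real.pi * ρ ^ 2) ≠ 0 := by
    rw [Ne, ENNReal.ofReal_eq_zero, not_le]; positivity
  have hBtop : B ≠ ⊤ := by rw [hB, hc]; finiteness
  refine ⟨(ENNReal.ofReal (Real.pi * ρ ^ 2))⁻¹ * B, by finiteness, fun V hV x hx => ?_⟩
  obtain ⟨g, h⟩ := hS.chart x hx
  have := isAddHaarMeasure_planeArea (hS.finrank x hx)
  have hu := h.contDiff_comp hV
  set u : tangentPlane M x → E3 := fun v => V (g v) with hudef
  have hu0 : u 0 = V x := by simp only [hudef]; rw [h.apply_zero hx hS.r_pos]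
  have hu1 : ContDiff ℝ 1 (fderiv ℝ u) := hu.fderiv_right (by norm_num)
  have hcu1 : Continuous (fderiv ℝ u) := hu1.continuous
  set D := Metric.closedBall (0 : tangentPlane M x) ρ with hD
  have hDm : MeasurableSet D := Metric.isClosed_closedBall.measurableSet
  have hDr : ∀ v ∈ D, ‖v‖ < r / C := fun v hv => by
    have := mem_closedBall_zero_iff.1 hv
    linarith
  have hDr' : ∀ v ∈ D, ‖v‖ < r := fun v hv =>
    (IsGraphChart.lt_of_lt_div hC (norm_nonneg v) (hDr v hv)).1
  have hcomp : ∀ f : E3 → ℝ≥0∞, ∫⁻ v in D, f (g v) ∂planeArea M x ≤ ∫⁻ q, f q ∂area M :=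
    fun f => (h.lintegral_comp_le hclosed (isCompact_closedBall _ _) hDr' f).trans
      (setLIntegral_le_lintegral _ _)
  have hVV := hVA V hV
  have hrem : ∫⁻ v in D, ‖taylorRem u 0 v‖ₑ ^ 2 ∂planeArea M x ≤
      ENNReal.ofReal ρ ^ 4 * (c * A * hessEnergy M V) := by
    refine (lintegral_taylorRem_le (planeArea M x) (hS.finrank x hx) hu
      (convex_closedBall _ _) hDm (Metric.mem_closedBall_self hρ.le) (d := ρ)
      (fun v hv => by simpa using hv)).trans ?_
    gcongr
    calc _ ≤ ∫⁻ v in D, c * sobolevDensity M V (g v) ∂planeArea M x :=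
          setLIntegral_mono' hDm fun v hv => hS.enorm_fderiv_fderiv_sq_le hV h (hDr' v hv)
      _ ≤ ∫⁻ q, c * sobolevDensity M V q ∂area M := hcomp fun q => c * sobolevDensity M V q
      _ = c * ∫⁻ q, sobolevDensity M V q ∂area M := lintegral_const_mul' _ _ (by finiteness)
      _ ≤ c * (A * hessEnergy M V) := by gcongr
      _ = _ := by ring
  have hen : ∫⁻ v in D, (‖u v‖ₑ ^ 2 + ENNReal.ofReal ρ ^ 2 * ‖fderiv ℝ u v‖ₑ ^ 2)
      ∂planeArea M x ≤ A₁ * (A + 1) * hessEnergy M V := by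
    have hsub : D ⊆ Metric.closedBall (0 : tangentPlane M x) (4 * ρ) :=
      Metric.closedBall_subset_closedBall (by linarith)
    refine (lintegral_mono_set hsub).trans ((hE ρ hρ le_rfl x hx g h V hV).trans ?_)
    calc _ ≤ A₁ * (A * hessEnergy M V + hessEnergy M V) := by
          gcongr
          exact (hcomp fun q => ‖V q‖ₑ ^ 2).trans
            ((lintegral_mono fun q => le_self_add.trans le_self_add).trans hVV)
      _ = _ := by ring
  -- The Taylor expansion at `v` is evaluated at the centre of the chart; integrating over `v` turns
  -- the L² bounds into a bound at the point `x`.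
  have hpt : ∀ v ∈ D, ‖V x‖ₑ ^ 2 ≤ 2 * ‖taylorRem u 0 v‖ₑ ^ 2 +
      4 * (‖u v‖ₑ ^ 2 + ENNReal.ofReal ρ ^ 2 * ‖fderiv ℝ u v‖ₑ ^ 2) := by
    intro v hv
    have h1 : V x = taylorRem u 0 v + (u v + fderiv ℝ u v (0 - v)) := by
      rw [taylorRem, ← hu0]; abel
    have h2 : ‖fderiv ℝ u v (0 - v)‖ₑ ≤ ENNReal.ofReal ρ * ‖fderiv ℝ u v‖ₑ := by
      refine ((fderiv ℝ u v).le_opENorm _).trans ?_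
      rw [mul_comm]
      gcongr
      rw [← ofReal_norm]
      exact ENNReal.ofReal_le_ofReal (by
        rw [zero_sub, norm_neg]; exact mem_closedBall_zero_iff.1 hv)
    rw [h1]
    refine (enorm_add_sq_le _ _).trans ?_
    rw [mul_add]
    refine add_le_add le_rfl ?_
    calc _ ≤ 2 * (2 * (‖u v‖ₑ ^ 2 + ‖fderiv ℝ u v (0 - v)‖ₑ ^ 2)) := by
          gcongr; exact enorm_add_sq_le _ _
      _ ≤ 2 * (2 * (‖u v‖ₑ ^ 2 + (ENNReal.ofReal ρ * ‖fderiv ℝ u v‖ₑ) ^ 2)) := by gcongr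
      _ = _ := by ring
  have hfin : ‖V x‖ₑ ^ 2 * ENNReal.ofReal (Real.pi * ρ ^ 2) ≤ B * hessEnergy M V := by
    calc _ = ∫⁻ _ in D, ‖V x‖ₑ ^ 2 ∂planeArea M x := by
          rw [lintegral_const, Measure.restrict_apply_univ,
            planeArea_closedBall (hS.finrank x hx) hρ.le]
      _ ≤ _ := setLIntegral_mono' hDm hpt
      _ ≤ 2 * (ENNReal.ofReal ρ ^ 4 * (c * A * hessEnergy M V)) +
          4 * (A₁ * (A + 1) * hessEnergy M V) := by
          have hm : Continuous fun v => taylorRem u 0 v := by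
            have := hu.continuous
            unfold taylorRem; fun_prop
          rw [lintegral_add_left (by fun_prop), lintegral_const_mul' _ _ (by finiteness),
            lintegral_const_mul' _ _ (by finiteness)]
          gcongr
      _ = _ := by rw [hB]; ring
  rw [mul_assoc, ← ENNReal.mul_le_iff_le_inv hπ (by finiteness), mul_comm]
  exact hfin

end Poincare

/-! ### Hat functions and the circumradius of a triangle. -/

section Triangle

variable {E : Type*} [NormedAddCommGroup E] [InnerProductSpace ℝ E]

/-- A linear form taking a common value in `[-1, 1]` at two sides of a triangle issuing from a vertex is
bounded in terms of the circumradius and of the lengths of these sides. -/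
theorem abs_apply_le_of_circumradius {a b z : E} {ρ s α β c : ℝ} (hs : 0 < s) (ha : s ≤ ‖a‖)
    (hb : s ≤ ‖b‖) (hab : a ≠ b) (hz : ‖z‖ = ρ) (hza : ‖a - z‖ = ρ) (hzb : ‖b - z‖ = ρ)
    {α' β' : ℝ} (hzab : z = α' • a + β' • b) (L : E →ₗ[ℝ] ℝ)
    (hLa : L a = c) (hLb : L b = c) (hc : |c| ≤ 1) :
    |L (α • a + β • b)| ≤ 2 * ρ / s ^ 2 * ‖α • a + β • b‖ := by
  set A := inner ℝ a a with hA
  set B := inner ℝ b b with hB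
  set G := inner ℝ a b with hG
  have hba : inner ℝ b a = G := real_inner_comm _ _
  have hAn : ‖a‖ ^ 2 = A := (real_inner_self_eq_norm_sq a).symm
  have hBn : ‖b‖ ^ 2 = B := (real_inner_self_eq_norm_sq b).symm
  have hz2 : ρ ^ 2 = α' ^ 2 * A + 2 * α' * β' * G + β' ^ 2 * B := by
    rw [← hz, ← real_inner_self_eq_norm_sq, hzab]
    simp only [inner_add_left, inner_add_right, inner_smul_left, inner_smul_right, hba,
      ← hA, ← hB, ← hG, conj_trivial]
    ring
  have e1 : 2 * (α' * A + β' * G) = A := by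
    have h : ‖a - z‖ ^ 2 = ‖z‖ ^ 2 := by rw [hza, hz]
    rw [norm_sub_sq_real, hzab, inner_add_right, inner_smul_right, inner_smul_right] at h
    linarith
  have e2 : 2 * (α' * G + β' * B) = B := by
    have h : ‖b - z‖ ^ 2 = ‖z‖ ^ 2 := by rw [hzb, hz]
    rw [norm_sub_sq_real, hzab, inner_add_right, inner_smul_right, inner_smul_right, hba] at h
    linarith
  set Δ := A * B - G ^ 2 with hΔ
  -- The square of the formula circumradius = product of the sides / (4 area); the Gram determinant
  -- `Δ` is four times the squared area.
  have hρ : 4 * ρ ^ 2 * Δ = A * B * (A + B - 2 * G) := by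
    have h1 : 2 * α' * Δ = A * B - G * B := by rw [hΔ]; linear_combination B * e1 - G * e2
    have h2 : 2 * β' * Δ = A * B - G * A := by rw [hΔ]; linear_combination A * e2 - G * e1
    rw [hz2]
    linear_combination 2 * Δ * (α' * e1 + β' * e2) + A * h1 + B * h2
  set D := A + B - 2 * G with hD
  have hDpos : 0 < D := by
    have h : D = ‖a - b‖ ^ 2 := by
      rw [norm_sub_sq_real, hAn, hBn]; ring
    rw [h]
    have := norm_pos_iff.2 (sub_ne_zero.2 hab)
    positivity
  set v := α • a + β • b with hv
  have hN : ‖v‖ ^ 2 = α ^ 2 * A + 2 * α * β * G + β ^ 2 * B := by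
    rw [← real_inner_self_eq_norm_sq, hv]
    simp only [inner_add_left, inner_add_right, inner_smul_left, inner_smul_right, hba,
      ← hA, ← hB, ← hG, conj_trivial]
    ring
  have hgram : (α + β) ^ 2 * Δ ≤ D * ‖v‖ ^ 2 := by
    rw [hN]
    have : D * (α ^ 2 * A + 2 * α * β * G + β ^ 2 * B) - (α + β) ^ 2 * Δ =
        (α * (A - G) + β * (G - B)) ^ 2 := by rw [hD, hΔ]; ring
    nlinarith [sq_nonneg (α * (A - G) + β * (G - B))]
  -- Eliminating `Δ` cancels the third side: the inverse height is at most `2 ρ / (‖a‖ ‖b‖)`, and no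
  -- angle condition is required.
  have hAB : (α + β) ^ 2 * (A * B) ≤ 4 * ρ ^ 2 * ‖v‖ ^ 2 := by
    refine le_of_mul_le_mul_right ?_ hDpos
    calc (α + β) ^ 2 * (A * B) * D = 4 * ρ ^ 2 * ((α + β) ^ 2 * Δ) := by
          linear_combination -(α + β) ^ 2 * hρ
      _ ≤ 4 * ρ ^ 2 * (D * ‖v‖ ^ 2) := by gcongr
      _ = _ := by ring
  have hs4 : s ^ 2 * s ^ 2 ≤ A * B := by
    rw [← hAn, ← hBn]; gcongr
  have hρ0 : 0 ≤ ρ := hz ▸ norm_nonneg z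
  have hL : L v = c * (α + β) := by
    rw [hv, map_add, map_smul, map_smul, hLa, hLb, smul_eq_mul, smul_eq_mul]; ring
  have hkey : |α + β| * s ^ 2 ≤ 2 * ρ * ‖v‖ := by
    refine abs_le_of_sq_le_sq' ?_ (by positivity) |>.2
    calc (|α + β| * s ^ 2) ^ 2 = (α + β) ^ 2 * (s ^ 2 * s ^ 2) := by rw [mul_pow, sq_abs]; ring
      _ ≤ (α + β) ^ 2 * (A * B) := by gcongr
      _ ≤ _ := hAB
      _ = _ := by ring
  calc |L v| = |c| * |α + β| := by rw [hL, abs_mul]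
    _ ≤ 1 * |α + β| := by gcongr
    _ ≤ 2 * ρ * ‖v‖ / s ^ 2 := by rw [one_mul, le_div_iff₀ (by positivity)]; exact hkey
    _ = _ := by ring

/-- The properties of the hat functions of a triangle used for interpolation: they form a partition of
unity, reproduce affine functions, and their gradients are bounded by `Λ`. -/
structure IsHatFamily (t : Finset E) (Λ : ℝ) : Prop where
  sum_eq_one : ∀ v, ∑ w ∈ t, hat t w v = 1
  sum_smul : ∀ v, ∑ w ∈ t, hat t w v • w = v
  nonneg : ∀ v ∈ convexHull ℝ (t : Set E), ∀ w ∈ t, 0 ≤ hat t w v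
  le_one : ∀ v ∈ convexHull ℝ (t : Set E), ∀ w ∈ t, hat t w v ≤ 1
  linear_le : ∀ w ∈ t, ∀ v, |(hat t w).linear v| ≤ Λ * ‖v‖

/-- The hat functions are the barycentric coordinates. With the vertex `w` as origin, the linear
part of its hat function takes the value -1 at both sides issuing from `w`, and
`abs_apply_le_of_circumradius` bounds it. -/
theorem isHatFamily_of_circumradius (hE : Module.finrank ℝ E = 2) {t : Finset E}
    (ht : AffineIndependent ℝ ((↑) : t → E)) (hcard : t.card = 3) {z : E} {ρ s : ℝ} (hs : 0 < s)
    (hz : ∀ v ∈ t, dist v z = ρ) (hsep : ∀ v ∈ t, ∀ w ∈ t, v ≠ w → s ≤ dist v w) :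
    IsHatFamily t (2 * ρ / s ^ 2) := by
  classical
  have : FiniteDimensional ℝ E := Module.finite_of_finrank_pos (by omega)
  have htop : affineSpan ℝ (Set.range ((↑) : t → E)) = ⊤ := by
    rw [ht.affineSpan_eq_top_iff_card_eq_finrank_add_one, Fintype.card_coe, hcard, hE]
  let b : AffineBasis t ℝ E := ⟨(↑), ht, htop⟩
  have hb : ∀ i : t, b i = i := fun _ => rfl
  have hhat : ∀ w : t, hat t (w : E) = b.coord w := by
    intro w
    have hex : ∃ e : E →ᵃ[ℝ] ℝ, e w = 1 ∧ ∀ w' ∈ t, w' ≠ w → e w' = 0 := by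
      refine ⟨b.coord w, ?_, fun w' hw' hne => ?_⟩
      · rw [← hb w, b.coord_apply_eq]
      · have := b.coord_apply_ne (i := w) (j := ⟨w', hw'⟩) (fun h => hne (by rw [h]))
        exact this
    have hspec := Classical.epsilon_spec hex
    refine AffineMap.ext_on htop ?_
    rintro _ ⟨j, rfl⟩
    change hat t (w : E) (j : E) = b.coord w (b j)
    rw [b.coord_apply]
    split_ifs with h
    · rw [← h]; exact hspec.1
    · exact hspec.2 j j.2 fun h' => h (Subtype.ext h'.symm)
  have hrange : Set.range b = (t : Set E) := by
    ext v; exact ⟨fun ⟨i, hi⟩ => hi ▸ i.2, fun hv => ⟨⟨v, hv⟩, rfl⟩⟩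
  have hsum1 : ∀ v, ∑ w ∈ t, hat t w v = 1 := fun v => by
    rw [← Finset.sum_coe_sort, ← b.sum_coord_apply_eq_one v]
    exact Finset.sum_congr rfl fun i _ => by rw [hhat i]
  have hnn : ∀ v ∈ convexHull ℝ (t : Set E), ∀ w ∈ t, 0 ≤ hat t w v := fun v hv w hw => by
    rw [← hrange, b.convexHull_eq_nonneg_coord] at hv
    rw [hhat ⟨w, hw⟩]
    exact hv _
  refine ⟨hsum1, fun v => ?_, hnn, fun v hv w hw => ?_, fun w hw v => ?_⟩
  · rw [← Finset.sum_coe_sort]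
    refine Eq.trans (Finset.sum_congr rfl fun i _ => ?_) (b.linear_combination_coord_eq_self v)
    rw [hhat i, hb]
  · rw [← hsum1 v]
    exact Finset.single_le_sum (f := fun w => hat t w v) (fun i hi => hnn v hv i hi) hw
  · obtain ⟨w₁, w₂, h1, h2, h3, h12, ht'⟩ : ∃ w₁ w₂, w₁ ∈ t ∧ w₂ ∈ t ∧ w₁ ≠ w ∧ w₁ ≠ w₂ ∧ w₂ ≠ w := by
      have hc : (t.erase w).card = 2 := by rw [Finset.card_erase_of_mem hw, hcard]
      obtain ⟨w₁, w₂, hne, he⟩ := Finset.card_eq_two.1 hc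
      have m1 : w₁ ∈ t.erase w := by rw [he]; simp
      have m2 : w₂ ∈ t.erase w := by rw [he]; simp
      exact ⟨w₁, w₂, Finset.mem_of_mem_erase m1, Finset.mem_of_mem_erase m2,
        Finset.ne_of_mem_erase m1, hne, Finset.ne_of_mem_erase m2⟩
    have hspan : ∀ y : E, ∃ α β : ℝ, y = α • (w₁ - w) + β • (w₂ - w) := by
      intro y
      have e1 := b.linear_combination_coord_eq_self (w + y)
      have e2 := b.sum_coord_apply_eq_one (w + y)
      have hz' : ∑ i, b.coord i (w + y) • (b i - w) = y := by
        simp only [smul_sub, Finset.sum_sub_distrib, e1, ← Finset.sum_smul, e2, one_smul,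
          add_sub_cancel_left]
      have hset : (Finset.univ : Finset t) = {⟨w, hw⟩, ⟨w₁, h1⟩, ⟨w₂, h2⟩} := by
        symm
        apply Finset.eq_univ_of_card
        rw [Fintype.card_coe, hcard, Finset.card_eq_three]
        refine ⟨_, _, _, ?_, ?_, ?_, rfl⟩ <;> simp [h3.symm, h12, ht'.symm]
      rw [hset, Finset.sum_insert (by simp [h3.symm, ht'.symm]),
        Finset.sum_insert (by simp [h12]), Finset.sum_singleton] at hz'
      refine ⟨b.coord ⟨w₁, h1⟩ (w + y), b.coord ⟨w₂, h2⟩ (w + y), ?_⟩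
      rw [hb, hb, hb] at hz'
      simpa using hz'.symm
    have hval : ∀ w' ∈ t, w' ≠ w → (hat t w).linear (w' - w) = -1 := by
      intro w' hw' hne
      have h := (hat t w).linearMap_vsub w' w
      rw [vsub_eq_sub, vsub_eq_sub] at h
      rw [h, hhat ⟨w, hw⟩]
      have e1 := b.coord_apply_ne (i := ⟨w, hw⟩) (j := ⟨w', hw'⟩)
        (fun h => hne (by simpa using (congrArg Subtype.val h).symm))
      have e2 := b.coord_apply_eq ⟨w, hw⟩
      rw [hb] at e1 e2
      rw [e1, e2]; norm_num
    obtain ⟨α, β, hv⟩ := hspan v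
    obtain ⟨α', β', hzz⟩ := hspan (z - w)
    rw [hv]
    refine abs_apply_le_of_circumradius hs ?_ ?_ ?_ ?_ ?_ ?_ hzz (hat t w).linear
      (hval w₁ h1 h3) (hval w₂ h2 ht') (by simp)
    · rw [← dist_eq_norm]; exact hsep _ h1 _ hw h3
    · rw [← dist_eq_norm]; exact hsep _ h2 _ hw ht'
    · exact fun h => h12 (sub_left_injective h)
    · rw [← dist_eq_norm, dist_comm]; exact hz w hw
    · rw [sub_sub_sub_cancel_right, ← dist_eq_norm]; exact hz _ h1
    · rw [sub_sub_sub_cancel_right, ← dist_eq_norm]; exact hz _ h2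

/-- A nondegenerate triangle has a circumcircle. -/
theorem exists_forall_dist_eq {t : Finset E} (ht : AffineIndependent ℝ ((↑) : t → E))
    (hne : t.Nonempty) : ∃ (z : E) (ρ : ℝ), ∀ v ∈ t, dist v z = ρ := by
  have : Nonempty t := hne.to_subtype
  obtain ⟨cs, ⟨-, h⟩, -⟩ := ht.existsUnique_dist_eq
  exact ⟨cs.center, cs.radius, fun v hv => h ⟨⟨v, hv⟩, rfl⟩⟩

end Triangle

/-! ### Size, shape and overlap of the Delaunay rings. -/

section Mesh

variable {M : Set E3} {r C : ℝ} {Q : E3 → E3 →L[ℝ] E3} {K : ℝ} {X : Finset E3} {cq : ℝ}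

/-- A separated set in a ball has boundedly many points. -/
theorem exists_card_le_of_separated (R : ℝ) : ∃ N : ℕ, ∀ (F : Finset E3) (y : E3) (ρ : ℝ), 0 < ρ →
    (∀ p ∈ F, dist p y ≤ R * ρ) → (∀ p ∈ F, ∀ q ∈ F, p ≠ q → ρ ≤ dist p q) → F.card ≤ N := by
  obtain ⟨s, hs, hcov⟩ := Metric.totallyBounded_iff.1
    (isCompact_closedBall (0 : E3) R).totallyBounded (1 / 2) (by norm_num)
  refine ⟨hs.toFinset.card, fun F y ρ hρ hF hsep => ?_⟩
  have hex : ∀ p ∈ F, ∃ c ∈ s, dist (ρ⁻¹ • (p - y)) c < 1 / 2 := by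
    intro p hp
    have : ρ⁻¹ • (p - y) ∈ Metric.closedBall (0 : E3) R := by
      rw [mem_closedBall_zero_iff, norm_smul, Real.norm_of_nonneg (by positivity), ← dist_eq_norm,
        inv_mul_le_iff₀ hρ, mul_comm]
      exact hF p hp
    simpa using hcov this
  choose! c hc hcd using hex
  refine Finset.card_le_card_of_injOn c (fun p hp => by simpa using hc p hp) fun p hp q hq hpq => ?_
  by_contra hne
  have h1 : dist (ρ⁻¹ • (p - y)) (ρ⁻¹ • (q - y)) < 1 := by
    have h2 := hcd q hq
    rw [← hpq] at h2
    linarith [dist_triangle_right (ρ⁻¹ • (p - y)) (ρ⁻¹ • (q - y)) (c p), hcd p hp]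
  rw [dist_smul₀, dist_sub_right, Real.norm_of_nonneg (by positivity), inv_mul_lt_iff₀ hρ,
    mul_one] at h1
  exact (hsep p hp q hq hne).not_gt h1

theorem exists_dist_le_fillDist (hM : IsCompact M) (hXM : (X : Set E3) ⊆ M) (hX : X.Nonempty)
    {p : E3} (hp : p ∈ M) : ∃ y ∈ X, dist y p ≤ fillDist M X := by
  obtain ⟨y, hy, hd⟩ := X.finite_toSet.isCompact.exists_infDist_eq_dist hX p
  refine ⟨y, hy, ?_⟩
  rw [dist_comm, ← hd]
  refine le_ciSup (f := fun x : M => Metric.infDist (x : E3) (X : Set E3)) ?_ ⟨p, hp⟩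
  obtain ⟨x₀, hx₀⟩ := hX
  refine ⟨Metric.diam M, ?_⟩
  rintro _ ⟨q, rfl⟩
  exact (Metric.infDist_le_dist_of_mem (Finset.mem_coe.2 hx₀)).trans
    (Metric.dist_le_diam_of_mem hM.isBounded q.2 (hXM hx₀))

theorem sepDist_nonneg : 0 ≤ sepDist X := by
  have := Set.infsep_nonneg (s := (X : Set E3))
  unfold sepDist; positivity

theorem QuasiUniform.mono (h : QuasiUniform M X cq) {cq' : ℝ} (hc : cq ≤ cq') :
    QuasiUniform M X cq' :=
  ⟨h.1, h.2.trans (mul_le_mul_of_nonneg_right hc sepDist_nonneg)⟩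

theorem QuasiUniform.le_dist (h : QuasiUniform M X cq) (hc : 1 ≤ cq) {y z : E3} (hy : y ∈ X)
    (hz : z ∈ X) (hyz : y ≠ z) : 2 * fillDist M X / cq ≤ dist y z := by
  have h1 : Set.infsep (X : Set E3) ≤ dist y z :=
    Set.infsep_le_dist_of_mem (Finset.mem_coe.2 hy) (Finset.mem_coe.2 hz) hyz
  have h2 := h.2
  rw [div_le_iff₀ (by linarith)]
  unfold sepDist at h2
  nlinarith

/-- Two points are needed: `Set.infsep` is 0 on a set with a single point, and then the fill
distance may vanish. -/
theorem QuasiUniform.fillDist_pos (h : QuasiUniform M X cq) (hX : 2 ≤ X.card) :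
    0 < fillDist M X := by
  refine lt_of_lt_of_le ?_ h.1
  have : X.Nontrivial := Finset.one_lt_card_iff_nontrivial.1 hX
  have := X.infsep_pos_iff_nontrivial.2 this
  unfold sepDist; positivity

/-- The properties of the local meshes used for the interpolation estimate. -/
structure IsGoodMesh (M : Set E3) (X : Finset E3)
    (R : ∀ x : E3, Geometry.SimplicialComplex ℝ (tangentPlane M x)) (h Λ : ℝ) (N : ℕ) : Prop where
  subset : (X : Set E3) ⊆ M
  pos : 0 < h
  norm_le : ∀ x ∈ X, ∀ t ∈ firstRing (R x), ∀ w ∈ t, ‖w‖ ≤ 4 * h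
  isHatFamily : ∀ x ∈ X, ∀ t ∈ firstRing (R x), IsHatFamily t (Λ / h)
  finite : ∀ x ∈ X, (firstRing (R x)).Finite
  ncard_le : ∀ x ∈ X, (firstRing (R x)).ncard ≤ N
  card_le : ∀ q, ∀ F ⊆ X, (∀ x ∈ F, dist x q ≤ 8 * h) → F.card ≤ N

/-- A Delaunay triangle at the origin is small if the points are dense. -/
theorem norm_circumcenter_le {E : Type*} [NormedAddCommGroup E] [InnerProductSpace ℝ E] {P : Set E}
    {h : ℝ} (hh : 0 < h) (hP : ∀ v : E, ‖v‖ ≤ 2 * h → ∃ w ∈ P, dist w v ≤ h) {z : E}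
    (hz : ∀ w ∈ P, ‖z‖ ≤ dist w z) : ‖z‖ ≤ 2 * h := by
  by_contra! hlt
  have hz0 : 0 < ‖z‖ := by linarith
  -- The point at distance `2 h` from the origin towards the circumcentre. A point of `P` within `h`
  -- of it would have distance at most `‖z‖ - h` to `z`, inside the circle.
  set v := (2 * h / ‖z‖) • z with hv
  have hvn : ‖v‖ = 2 * h := by
    rw [hv, norm_smul, Real.norm_of_nonneg (by positivity), div_mul_cancel₀ _ hz0.ne']
  have hvz : dist v z = ‖z‖ - 2 * h := by
    have : v - z = -((1 - 2 * h / ‖z‖) • z) := by rw [hv]; module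
    rw [dist_eq_norm, this, norm_neg, norm_smul, Real.norm_of_nonneg, sub_mul, one_mul,
      div_mul_cancel₀ _ hz0.ne']
    rw [sub_nonneg, div_le_one hz0]; exact hlt.le
  obtain ⟨w, hw, hwv⟩ := hP v hvn.le
  linarith [hz w hw, dist_triangle w v z]

/-- A large number of neighbours forces `X` to be large, hence `h` small by packing, and forces
every point of `X` within `8 h` to be a neighbour. The bound `δ` on the projections excludes far
neighbours, whose projections need not belong to the chart. The Delaunay property then bounds the
circumradius by `2 h`. -/
theorem IsUniformSurface.exists_isGoodMesh (hS : IsUniformSurface M r C Q K) (hcq : 1 ≤ cq)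
    {h₀ : ℝ} (hh₀ : 0 < h₀) : ∃ (δ : ℝ) (k₀ : ℕ) (Λ : ℝ) (N : ℕ), 0 < δ ∧ 0 ≤ Λ ∧
      ∀ (X : Finset E3) (k : ℕ) (κ : E3 → Finset E3)
        (R : ∀ x : E3, Geometry.SimplicialComplex ℝ (tangentPlane M x)),
        (X : Set E3) ⊆ M → X.Nonempty → QuasiUniform M X cq → k₀ ≤ k →
        (∀ x ∈ X, IsNearest X k x (κ x)) →
        (∀ x ∈ X, ∀ v ∈ projected M x (κ x), ‖v‖ ≤ δ) →
        (∀ x ∈ X, IsDelaunay (projected M x (κ x)) (R x)) →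
        IsGoodMesh M X R (fillDist M X) Λ N ∧ fillDist M X ≤ h₀ := by
  have hC := hS.one_le_C
  have hr := hS.r_pos
  set r₁ := min (r / C) (1 / C) with hr₁def
  have hr₁ : 0 < r₁ := by positivity
  have hr₁r : r₁ ≤ r / C := min_le_left _ _
  have hrC : r / C ≤ r := div_le_self hr.le hC
  have hr₁C : C * r₁ ≤ 1 := by
    have := min_le_right (r / C) (1 / C)
    rw [mul_comm, ← le_div_iff₀ (by linarith)]; exact this
  set h₁ := min h₀ (r₁ / 32) with hh₁def
  have hh₁ : 0 < h₁ := by positivity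
  obtain ⟨R₀, hR₀⟩ := hS.isCompact.isBounded.subset_closedBall (0 : E3)
  -- `4 cq` is the ratio of the radius `8 h` to the separation `2 h / cq`. The second packing bound
  -- concerns all of `M`, with separation `2 h₁ / cq`; exceeding it forces `h ≤ h₁`.
  obtain ⟨N, hN⟩ := exists_card_le_of_separated (4 * cq)
  obtain ⟨N', hN'⟩ := exists_card_le_of_separated (R₀ / (2 * h₁ / cq))
  have hcq0 : 0 < cq := by linarith
  refine ⟨r₁ / 8, max (max (N + 1) (N' + 1)) 2, C ^ 2 * cq ^ 2, 2 ^ N, by positivity, by positivity,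
    fun X k κ R hXM hX hqu hk hκ hδ hdel => ?_⟩
  have hk1 : N < k := by have := le_max_left (N + 1) (N' + 1); omega
  have hk2 : N' < k := by have := le_max_right (N + 1) (N' + 1); omega
  have hk3 : 2 ≤ k := (le_max_right _ _).trans hk
  set h := fillDist M X with hhdef
  have hXk : k ≤ X.card := by
    obtain ⟨x, hx⟩ := hX
    rw [← (hκ x hx).2.2.1]
    exact Finset.card_le_card (hκ x hx).1
  have hh : 0 < h := hqu.fillDist_pos (hk3.trans hXk)
  have hsep : ∀ y ∈ X, ∀ z ∈ X, y ≠ z → 2 * h / cq ≤ dist y z :=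
    fun y hy z hz hyz => hqu.le_dist hcq hy hz hyz
  have hfill : ∀ p ∈ M, ∃ y ∈ X, dist y p ≤ h :=
    fun p hp => exists_dist_le_fillDist hS.isCompact hXM hX hp
  have hhh₁ : h ≤ h₁ := by
    by_contra! hlt
    have := hN' X 0 (2 * h₁ / cq) (by positivity)
      (fun p hp => by
        rw [div_mul_cancel₀ _ (by positivity)]
        exact hR₀ (hXM hp))
      (fun p hp q hq hpq => le_trans (by gcongr) (hsep p hp q hq hpq))
    omega
  have hhr : h ≤ r₁ / 32 := hhh₁.trans (min_le_right _ _)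
  have hpack : ∀ q, ∀ F ⊆ X, (∀ x ∈ F, dist x q ≤ 8 * h) → F.card ≤ N := fun q F hF hd =>
    hN F q (2 * h / cq) (by positivity)
      (fun p hp => by
        have : 4 * cq * (2 * h / cq) = 8 * h := by field_simp; ring
        rw [this]; exact hd p hp)
      fun p hp q hq hpq => hsep p (hF hp) q (hF hq) hpq
  -- facts about the points near one node
  have hloc : ∀ x ∈ X, ∀ t ∈ firstRing (R x), IsHatFamily t (C ^ 2 * cq ^ 2 / h) ∧
      ∀ w ∈ t, ‖w‖ ≤ 4 * h ∧ ∃ y ∈ X, dist y x ≤ 8 * h ∧ w = tangentCoord M x (y - x) := by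
    intro x hx t ht
    have hxM := hXM hx
    obtain ⟨g, hg⟩ := hS.chart x hxM
    have h2 := hS.finrank x hxM
    have hlt : ∀ v : tangentPlane M x, ‖v‖ < r₁ → ‖v‖ < r ∧ dist (g v) x ≤ 2 * ‖v‖ := fun v hv =>
      have hvr : ‖v‖ < r := by linarith
      ⟨hvr, hg.dist_base_le_two_mul hxM hC hvr ((by gcongr : C * ‖v‖ ≤ C * r₁).trans hr₁C)⟩
    -- the neighbours are near
    have hnear : ∀ y ∈ κ x, dist y x < r₁ := by
      by_contra! hfar
      obtain ⟨y, hy, hyfar⟩ := hfar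
      have : Nontrivial (tangentPlane M x) := Module.nontrivial_of_finrank_pos (R := ℝ) (by omega)
      -- If a neighbour lies beyond `r₁`, every point of `X` closer than `r₁` is a neighbour. One of
      -- them is within `h` of the point over `v`, so its projection has norm at least `r₁ / 4 - h`,
      -- exceeding `δ = r₁ / 8`.
      obtain ⟨v, hv⟩ := exists_norm_eq (tangentPlane M x) (show 0 ≤ r₁ / 4 by positivity)
      obtain ⟨hvr, hvx⟩ := hlt v (by linarith)
      obtain ⟨z, hz, hzd⟩ := hfill (g v) (hg.mem v hvr)
      have hzx : dist z x < r₁ := by linarith [dist_triangle z (g v) x]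
      have hzκ : z ∈ κ x := by
        by_contra hzκ
        linarith [(hκ x hx).2.2.2 y hy z hz hzκ]
      have h3 := hδ x hx _ ⟨z, hzκ, rfl⟩
      have h4 : ‖tangentCoord M x (z - x) - v‖ ≤ h := by
        rw [← hg.coord v hvr, ← map_sub, sub_sub_sub_cancel_right]
        exact (norm_tangentCoord_le M x _).trans (by rwa [← dist_eq_norm])
      have h5 := norm_sub_norm_le v (v - tangentCoord M x (z - x))
      rw [sub_sub_cancel, norm_sub_rev v] at h5
      simp only at h3
      linarith
    -- all close points are neighbours
    have hclose : ∀ z ∈ X, dist z x ≤ 8 * h → z ∈ κ x := by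
      intro z hz hzd
      by_contra hzκ
      -- All `k` neighbours would be within `8 h` of `x`, contradicting the packing bound `N < k`.
      have := hpack x (κ x) (hκ x hx).1 fun y hy => ((hκ x hx).2.2.2 y hy z hz hzκ).trans hzd
      have := (hκ x hx).2.2.1
      omega
    obtain ⟨hface, hcard, h0⟩ := ht
    have hind := (R x).indep hface
    obtain ⟨z, ρ, hzρ⟩ := exists_forall_dist_eq hind ⟨0, h0⟩
    have hρz : ρ = ‖z‖ := by rw [← hzρ 0 h0, dist_zero_left]
    have hempty := (hdel x hx).2.2 t hface hcard z ρ hzρ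
    have hz2 : ‖z‖ ≤ 2 * h := by
      refine norm_circumcenter_le hh (P := projected M x (κ x)) (fun v hv => ?_)
        (fun w hw => hρz ▸ hempty w hw)
      obtain ⟨hvr, hvx⟩ := hlt v (by linarith)
      obtain ⟨y, hy, hyd⟩ := hfill (g v) (hg.mem v hvr)
      refine ⟨_, ⟨y, hclose y hy ?_, rfl⟩, ?_⟩
      · linarith [dist_triangle y (g v) x]
      · rw [dist_eq_norm]
        simp only
        rw [← hg.coord v hvr, ← map_sub, sub_sub_sub_cancel_right]
        exact (norm_tangentCoord_le M x _).trans (by rwa [← dist_eq_norm])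
    have hw4 : ∀ w ∈ t, ‖w‖ ≤ 4 * h := fun w hw => by
      have := hzρ w hw
      rw [← dist_zero_right]
      linarith [dist_triangle w z 0, dist_zero_right z]
    have hwP : ∀ w ∈ t, ∃ y ∈ X, y = g w ∧ w = tangentCoord M x (y - x) := by
      intro w hw
      have : w ∈ projected M x (κ x) := by
        rw [← (hdel x hx).1]
        exact (R x).down_closed hface (Finset.singleton_subset_iff.2 hw)
          (Finset.singleton_nonempty w)
      obtain ⟨y, hy, rfl⟩ := this
      have hyX := (hκ x hx).1 hy
      exact ⟨y, hyX, (hg.eq_of_mem y (hXM hyX) (by linarith [hnear y hy])).symm, rfl⟩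
    refine ⟨?_, fun w hw => ⟨hw4 w hw, ?_⟩⟩
    -- The chart is `C`-Lipschitz, so projecting the points divides their separation by at most `C`.
    · have hs : 0 < 2 * h / (C * cq) := by positivity
      have hH := isHatFamily_of_circumradius h2 hind hcard hs hzρ fun v hv w hw hvw => by
        obtain ⟨y, hyX, hy, hvy⟩ := hwP v hv
        obtain ⟨y', hyX', hy', hvy'⟩ := hwP w hw
        have hne : y ≠ y' := fun he => hvw (by rw [hvy, hvy', he])
        have h3 := hsep y hyX y' hyX' hne
        have h4 := hg.dist_le hC (hlt v (by linarith [hw4 v hv])).1 (hlt w (by linarith [hw4 w hw])).1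
        rw [← hy, ← hy'] at h4
        rw [div_le_iff₀ (by positivity)] at h3 ⊢
        nlinarith
      refine ⟨hH.sum_eq_one, hH.sum_smul, hH.nonneg, hH.le_one, fun w hw v =>
        (hH.linear_le w hw v).trans ?_⟩
      refine mul_le_mul_of_nonneg_right ?_ (norm_nonneg v)
      calc 2 * ρ / (2 * h / (C * cq)) ^ 2 ≤ 2 * (2 * h) / (2 * h / (C * cq)) ^ 2 := by
            rw [hρz]; gcongr
        _ = _ := by field_simp
    · obtain ⟨y, hyX, hy, hwy⟩ := hwP w hw
      refine ⟨y, hyX, ?_, hwy⟩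
      have := (hlt w (by linarith [hw4 w hw])).2
      rw [hy]
      linarith [hw4 w hw]
  have hsub : ∀ x ∈ X, firstRing (R x) ⊆ (((X.filter fun y => dist y x ≤ 8 * h).image
      fun y => tangentCoord M x (y - x)).powerset : Set (Finset (tangentPlane M x))) := by
    intro x hx t ht
    rw [Finset.mem_coe, Finset.mem_powerset]
    intro w hw
    obtain ⟨-, y, hy, hd, hwy⟩ := (hloc x hx t ht).2 w hw
    exact Finset.mem_image.2 ⟨y, Finset.mem_filter.2 ⟨hy, hd⟩, hwy.symm⟩
  refine ⟨⟨hXM, hh, fun x hx t ht w hw => ((hloc x hx t ht).2 w hw).1,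
    fun x hx t ht => (hloc x hx t ht).1, fun x hx => (Finset.finite_toSet _).subset (hsub x hx),
    fun x hx => ?_, fun q F hF hd => (hpack q F hF hd).trans Nat.lt_two_pow_self.le⟩,
    hhh₁.trans (min_le_left _ _)⟩
  -- Every triangle of the ring is a subset of the at most `N` projected points within `8 h`, whence
  -- the bound `2 ^ N`.
  refine (Set.ncard_le_ncard (hsub x hx) (Finset.finite_toSet _)).trans ?_
  rw [Set.ncard_coe_finset, Finset.card_powerset]
  refine Nat.pow_le_pow_right (by norm_num) (Finset.card_image_le.trans ?_)
  exact hpack x _ (Finset.filter_subset _ _) fun y hy => (Finset.mem_filter.1 hy).2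

end Mesh

/-! ### The interpolation error at a point in terms of errors at the nodes. -/

section Pointwise

variable {M : Set E3} {r C : ℝ} {Q : E3 → E3 →L[ℝ] E3} {K : ℝ} {x : E3}
  {g : tangentPlane M x → E3} {t : Finset (tangentPlane M x)} {Λ : ℝ} {V : E3 → E3}

theorem AffineMap_hasFDerivAt {E : Type*} [NormedAddCommGroup E] [InnerProductSpace ℝ E]
    [FiniteDimensional ℝ E] (f : E →ᵃ[ℝ] ℝ) (v : E) :
    HasFDerivAt f (LinearMap.toContinuousLinearMap f.linear) v := by
  have h : (f : E → ℝ) = fun v => LinearMap.toContinuousLinearMap f.linear v + f 0 := by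
    conv_lhs => rw [f.decomp]
    rfl
  rw [h]
  exact (LinearMap.toContinuousLinearMap f.linear).hasFDerivAt.add_const _

theorem IsHatFamily.sum_linear_eq_zero {E : Type*} [NormedAddCommGroup E] [InnerProductSpace ℝ E]
    {t : Finset E} (h : IsHatFamily t Λ) (d : E) : ∑ w ∈ t, (hat t w).linear d = 0 := by
  have h1 : ∀ w, (hat t w).linear d = hat t w (d + 0) - hat t w 0 := fun w => by
    have := (hat t w).map_vadd 0 d
    rw [vadd_eq_add, vadd_eq_add] at this
    rw [this]; ring
  simp only [h1, Finset.sum_sub_distrib, h.sum_eq_one, sub_self]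

theorem IsHatFamily.sum_linear_smul {E : Type*} [NormedAddCommGroup E] [InnerProductSpace ℝ E]
    {t : Finset E} (h : IsHatFamily t Λ) (d : E) : ∑ w ∈ t, (hat t w).linear d • w = d := by
  have h1 : ∀ w, (hat t w).linear d = hat t w (d + 0) - hat t w 0 := fun w => by
    have := (hat t w).map_vadd 0 d
    rw [vadd_eq_add, vadd_eq_add] at this
    rw [this]; ring
  simp only [h1, sub_smul, Finset.sum_sub_distrib, h.sum_smul, add_zero, sub_zero]

/-- The components of the difference between the interpolant of `W` and `V`. -/
def coordError (M : Set E3) (x : E3) (g : tangentPlane M x → E3) (t : Finset (tangentPlane M x))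
    (W V : E3 → E3) (v : tangentPlane M x) : tangentPlane M x :=
  ∑ w ∈ t, hat t w v • tangentCoord M x (W (g w)) - tangentCoord M x (V (g v))

/-- The error at the node `w` of the Taylor expansion of `V` at `v`, as an approximation of `W`. -/
def nodeError {x : E3} (g : tangentPlane M x → E3) (W V : E3 → E3) (w v : tangentPlane M x) : E3 :=
  W (g w) - V (g w) + taylorRem (fun v => V (g v)) w v

theorem eq_add_nodeError (W : E3 → E3) (w v : tangentPlane M x) : W (g w) =
    V (g v) + fderiv ℝ (fun v => V (g v)) v (w - v) + nodeError g W V w v := by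
  unfold nodeError taylorRem; abel

/-- The nodal values are expanded at `v`. Interpolation reproduces the affine part, whose value at
`v` is `V (g v)`, so only the node errors remain. -/
theorem IsHatFamily.coordError_eq (h : IsHatFamily t Λ) (W : E3 → E3) (v : tangentPlane M x) :
    coordError M x g t W V v = ∑ w ∈ t, hat t w v • tangentCoord M x (nodeError g W V w v) := by
  set L := fderiv ℝ (fun v => V (g v)) v with hL
  have h0 : ∑ w ∈ t, hat t w v • (w - v) = 0 := by
    simp only [smul_sub, Finset.sum_sub_distrib, h.sum_smul, ← Finset.sum_smul, h.sum_eq_one,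
      one_smul, sub_self]
  have h1 : ∑ w ∈ t, hat t w v • tangentCoord M x (L (w - v)) = 0 := by
    have := congrArg (fun y => tangentCoord M x (L y)) h0
    simpa only [map_sum, map_smul, map_zero] using this
  have h2 : ∑ w ∈ t, hat t w v • tangentCoord M x (V (g v)) = tangentCoord M x (V (g v)) := by
    rw [← Finset.sum_smul, h.sum_eq_one, one_smul]
  unfold coordError
  simp only [eq_add_nodeError (V := V) W _ v, map_add, smul_add, Finset.sum_add_distrib]
  rw [h1, h2]
  simp only [nodeError, map_add, smul_add, Finset.sum_add_distrib]
  abel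

/-- The same cancellation with gradients of hat functions: they sum to zero and reproduce linear
maps, so the derivative of `V ∘ g` drops out. The node errors appear undifferentiated although they
depend on `v`. -/
theorem IsHatFamily.hasFDerivAt_coordError (h : IsHatFamily t Λ) (hg : IsGraphChart M x r C g)
    (hV : IsSmoothTangent M V) (W : E3 → E3) (v : tangentPlane M x) :
    ∃ L : tangentPlane M x →L[ℝ] tangentPlane M x, HasFDerivAt (coordError M x g t W V) L v ∧
      ∀ d, L d = ∑ w ∈ t, (hat t w).linear d • tangentCoord M x (nodeError g W V w v) := by
  have hu : HasFDerivAt (fun v => V (g v)) (fderiv ℝ (fun v => V (g v)) v) v :=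
    ((hg.contDiff_comp hV).differentiable (by norm_num) v).hasFDerivAt
  have h1 : HasFDerivAt (fun v => ∑ w ∈ t, hat t w v • tangentCoord M x (W (g w)))
      (∑ w ∈ t, (LinearMap.toContinuousLinearMap (hat t w).linear).smulRight
        (tangentCoord M x (W (g w)))) v :=
    HasFDerivAt.fun_sum fun w _ => (AffineMap_hasFDerivAt (hat t w) v).smul_const _
  refine ⟨_, h1.sub ((tangentCoord M x).hasFDerivAt.comp v hu), fun d => ?_⟩
  set L := fderiv ℝ (fun v => V (g v)) v with hL
  have h0 : ∑ w ∈ t, (hat t w).linear d • (w - v) = d := by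
    simp only [smul_sub, Finset.sum_sub_distrib, h.sum_linear_smul, ← Finset.sum_smul,
      h.sum_linear_eq_zero, zero_smul, sub_zero]
  have h2 : ∑ w ∈ t, (hat t w).linear d • tangentCoord M x (L (w - v)) = tangentCoord M x (L d) := by
    have := congrArg (fun y => tangentCoord M x (L y)) h0
    simpa only [map_sum, map_smul] using this
  have h3 : ∑ w ∈ t, (hat t w).linear d • tangentCoord M x (V (g v)) = 0 := by
    rw [← Finset.sum_smul, h.sum_linear_eq_zero, zero_smul]
  simp only [sub_apply, sum_apply, ContinuousLinearMap.smulRight_apply,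
    LinearMap.coe_toContinuousLinearMap', ContinuousLinearMap.comp_apply]
  simp only [eq_add_nodeError (V := V) W _ v, map_add, smul_add, Finset.sum_add_distrib]
  rw [h2, h3]
  simp only [nodeError, map_add, smul_add, Finset.sum_add_distrib]
  abel

theorem IsHatFamily.norm_coordError_le (h : IsHatFamily t Λ) (W : E3 → E3) {v : tangentPlane M x}
    (hv : v ∈ convexHull ℝ (t : Set (tangentPlane M x))) :
    ‖coordError M x g t W V v‖ ≤ ∑ w ∈ t, ‖nodeError g W V w v‖ := by
  rw [h.coordError_eq]
  refine (norm_sum_le _ _).trans (Finset.sum_le_sum fun w hw => ?_)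
  rw [norm_smul, Real.norm_of_nonneg (h.nonneg v hv w hw)]
  calc _ ≤ 1 * ‖nodeError g W V w v‖ := by
        gcongr
        · exact h.le_one v hv w hw
        · exact norm_tangentCoord_le M x _
    _ = _ := one_mul _

theorem IsHatFamily.norm_sum_linear_le (h : IsHatFamily t Λ) (hΛ : 0 ≤ Λ) (W : E3 → E3)
    (v d : tangentPlane M x) :
    ‖∑ w ∈ t, (hat t w).linear d • tangentCoord M x (nodeError g W V w v)‖ ≤
      Λ * (∑ w ∈ t, ‖nodeError g W V w v‖) * ‖d‖ := by
  refine (norm_sum_le _ _).trans ?_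
  rw [Finset.mul_sum, Finset.sum_mul]
  refine Finset.sum_le_sum fun w hw => ?_
  rw [norm_smul, Real.norm_eq_abs]
  calc _ ≤ (Λ * ‖d‖) * ‖nodeError g W V w v‖ := by
        gcongr
        · exact h.linear_le w hw d
        · exact norm_tangentCoord_le M x _
    _ = _ := by ring

theorem IsGraphChart.interp_eq (hg : IsGraphChart M x r C g) (hx : x ∈ M) (hC : 1 ≤ C)
    (ht : ∀ w ∈ t, ‖w‖ < r / C) (W : E3 → E3) {q : E3} (hq : ‖tangentCoord M x (q - x)‖ < r / C) :
    interp M x t W q = fderiv ℝ g (tangentCoord M x (q - x))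
      (∑ w ∈ t, hat t w (tangentCoord M x (q - x)) • tangentCoord M x (W (g w))) := by
  unfold interp
  rw [(hg.graphParam_eventuallyEq hx hC hq).fderiv_eq]
  congr 1
  exact Finset.sum_congr rfl fun w hw => by rw [coeff, hg.graphParam_eq hx hC (ht w hw)]

/-- A tangent vector is recovered by `Dg` from its projection to `T_x M`, so the components of `V`
in the chart basis are those of that projection. -/
theorem IsGraphChart.interp_sub_eq (hg : IsGraphChart M x r C g) (hx : x ∈ M) (hC : 1 ≤ C)
    (hV : IsSmoothTangent M V) (ht : ∀ w ∈ t, ‖w‖ < r / C) (W : E3 → E3) {v : tangentPlane M x}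
    (hv : ‖v‖ < r / C) :
    interp M x t W (g v) - V (g v) = fderiv ℝ g v (coordError M x g t W V v) := by
  have hvr := (lt_of_lt_div hC (norm_nonneg v) hv).1
  have hc := hg.coord v hvr
  rw [hg.interp_eq hx hC ht W (by rwa [hc]), hc, coordError, map_sub,
    hg.fderiv_tangentCoord hvr (hg.dist_base_lt hx hC hv) (hV.tangent _ (hg.mem v hvr))]

theorem IsGraphChart.norm_interp_sub_le (hg : IsGraphChart M x r C g) (hx : x ∈ M) (hC : 1 ≤ C)
    (h : IsHatFamily t Λ)
    (hV : IsSmoothTangent M V) (ht : ∀ w ∈ t, ‖w‖ < r / C) (W : E3 → E3) {v : tangentPlane M x}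
    (hvt : v ∈ convexHull ℝ (t : Set (tangentPlane M x))) (hv : ‖v‖ < r / C) :
    ‖interp M x t W (g v) - V (g v)‖ ≤ C * ∑ w ∈ t, ‖nodeError g W V w v‖ := by
  rw [hg.interp_sub_eq hx hC hV ht W hv]
  refine ((fderiv ℝ g v).le_opNorm _).trans ?_
  gcongr
  · exact hg.norm_fderiv_le v (lt_of_lt_div hC (norm_nonneg v) hv).1
  · exact h.norm_coordError_le W hvt

/-- By the product rule, the derivative of `Dg (coordError)` has a term with `D²g`, bounded by `C`
times the sum of node errors, and a term with the gradients of the hat functions, which costs a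
further factor `Λ`. -/
theorem IsGraphChart.norm_covDeriv_interp_sub_le (hg : IsGraphChart M x r C g) (hx : x ∈ M)
    (hC : 1 ≤ C) (h : IsHatFamily t Λ) (hΛ : 0 ≤ Λ)
    (hV : IsSmoothTangent M V) (ht : ∀ w ∈ t, ‖w‖ < r / C) (W : E3 → E3) {v : tangentPlane M x}
    (hvt : v ∈ convexHull ℝ (t : Set (tangentPlane M x))) (hv : ‖v‖ < r / C) :
    ‖covDeriv M (interp M x t W) (g v) - covDeriv M V (g v)‖ ≤
      C * (1 + Λ) * ∑ w ∈ t, ‖nodeError g W V w v‖ := by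
  have hvr := (lt_of_lt_div hC (norm_nonneg v) hv).1
  have hc := hg.coord v hvr
  set q := g v with hq
  obtain ⟨L, hL, hLd⟩ := h.hasFDerivAt_coordError hg hV W v
  have hDg : HasFDerivAt (fderiv ℝ g) (fderiv ℝ (fderiv ℝ g) v) v :=
    ((hg.contDiff.fderiv_right (m := 1) (by norm_num)).differentiable (by norm_num) v).hasFDerivAt
  have hprod := hDg.clm_apply hL
  set D := (fderiv ℝ g v).comp L + (fderiv ℝ (fderiv ℝ g) v).flip (coordError M x g t W V v)
    with hD
  have htc : HasFDerivAt (fun p => tangentCoord M x (p - x)) (tangentCoord M x) q :=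
    (tangentCoord M x).hasFDerivAt.comp q ((hasFDerivAt_id q).sub_const x)
  have hprod' : HasFDerivAt (fderiv ℝ g) (fderiv ℝ (fderiv ℝ g) v) (tangentCoord M x (q - x)) := by
    rwa [hc]
  have hcomp : HasFDerivAt (fun p => fderiv ℝ g (tangentCoord M x (p - x))
      (coordError M x g t W V (tangentCoord M x (p - x)))) (D.comp (tangentCoord M x)) q := by
    have : HasFDerivAt (fun v => fderiv ℝ g v (coordError M x g t W V v)) D
        (tangentCoord M x (q - x)) := by rwa [hc]
    exact this.comp q htc
  have hVd : HasFDerivAt V (fderiv ℝ V q) q :=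
    (hV.contDiff.differentiable (by norm_num) q).hasFDerivAt
  have hev : ∀ᶠ p in 𝓝 q, ‖tangentCoord M x (p - x)‖ < r / C ∧ dist p x < r := by
    refine (htc.continuousAt.norm.eventually_lt_const (by simpa only [hc] using hv)).and ?_
    exact (continuous_id.dist continuous_const).continuousAt.eventually_lt_const
      (hg.dist_base_lt hx hC hv)
  -- The formula for the interpolant through `V` is established on `M` only; a derivative within `M`
  -- is all that `covDeriv` sees.
  have hint : HasFDerivWithinAt (interp M x t W) (D.comp (tangentCoord M x) + fderiv ℝ V q) M q := by
    refine (hcomp.add hVd).hasFDerivWithinAt.congr_of_eventuallyEq ?_ ?_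
    · filter_upwards [nhdsWithin_le_nhds hev, self_mem_nhdsWithin] with p hp hpM
      have := hg.interp_sub_eq hx hC hV ht W hp.1
      rw [hg.eq_of_mem p hpM hp.2] at this
      simp only [Pi.add_apply, ← this, sub_add_cancel]
    · have := hg.interp_sub_eq hx hC hV ht W hv
      simp only [Pi.add_apply, hc, ← this, ← hq, sub_add_cancel]
  have hdiff : covDeriv M (interp M x t W) q - covDeriv M V q =
      (tangentProj M q).comp ((D.comp (tangentCoord M x)).comp (tangentProj M q)) := by
    rw [covDeriv, covDeriv, tangentialDeriv_eq hint, tangentialDeriv_eq hVd.hasFDerivWithinAt,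
      ContinuousLinearMap.add_comp, ContinuousLinearMap.comp_add, add_sub_cancel_right]
  rw [hdiff]
  set S := ∑ w ∈ t, ‖nodeError g W V w v‖ with hS
  have hS0 : 0 ≤ S := Finset.sum_nonneg fun w _ => norm_nonneg _
  have hD' : ∀ d, ‖D d‖ ≤ C * (1 + Λ) * S * ‖d‖ := by
    intro d
    have e1 : ‖fderiv ℝ g v (L d)‖ ≤ C * (Λ * S * ‖d‖) := by
      refine ((fderiv ℝ g v).le_opNorm _).trans ?_
      gcongr
      · exact hg.norm_fderiv_le v hvr
      · rw [hLd]; exact h.norm_sum_linear_le hΛ W v d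
    have e2 : ‖fderiv ℝ (fderiv ℝ g) v d (coordError M x g t W V v)‖ ≤ C * ‖d‖ * S := by
      refine (ContinuousLinearMap.le_opNorm₂ _ _ _).trans ?_
      gcongr
      · exact hg.norm_fderiv_fderiv_le v hvr
      · exact h.norm_coordError_le W hvt
    calc ‖D d‖ = ‖fderiv ℝ g v (L d) + fderiv ℝ (fderiv ℝ g) v d (coordError M x g t W V v)‖ := rfl
      _ ≤ C * (Λ * S * ‖d‖) + C * ‖d‖ * S := (norm_add_le _ _).trans (add_le_add e1 e2)
      _ = _ := by ring
  refine ContinuousLinearMap.opNorm_le_bound _ (by positivity) fun e => ?_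
  simp only [ContinuousLinearMap.comp_apply]
  refine (norm_tangentProj_apply_le M q _).trans ((hD' _).trans ?_)
  gcongr
  exact (norm_tangentCoord_le M x _).trans (norm_tangentProj_apply_le M q e)

end Pointwise

/-! ### Integration over curved triangles and summation over the mesh. -/

section MeshEstimate

variable {M : Set E3} {r C : ℝ} {Q : E3 → E3 →L[ℝ] E3} {K : ℝ} {V W : E3 → E3}

/-- Sets with bounded overlap. -/
theorem sum_setLIntegral_le_of_overlap {α ι : Type*} [MeasurableSpace α] (μ : Measure α)
    (X : Finset ι) (B : ι → Set α) (hB : ∀ i, MeasurableSet (B i)) (N : ℕ)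
    (h : ∀ q, ∀ F ⊆ X, (∀ i ∈ F, q ∈ B i) → F.card ≤ N) (F : α → ℝ≥0∞) :
    ∑ i ∈ X, ∫⁻ q in B i, F q ∂μ ≤ N * ∫⁻ q, F q ∂μ := by
  classical
  rw [← lintegral_finsetSum_measure]
  have hle : ∑ i ∈ X, μ.restrict (B i) ≤ (N : ℝ≥0∞) • μ := by
    refine Measure.le_iff.2 fun s hs => ?_
    rw [Measure.finsetSum_apply, Measure.smul_apply, smul_eq_mul]
    calc ∑ i ∈ X, μ.restrict (B i) s = ∑ i ∈ X, ∫⁻ q in s, (B i).indicator 1 q ∂μ := by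
          refine Finset.sum_congr rfl fun i _ => ?_
          rw [Measure.restrict_apply hs, lintegral_indicator_one (hB i),
            Measure.restrict_apply (hB i), Set.inter_comm]
      _ = ∫⁻ q in s, ∑ i ∈ X, (B i).indicator 1 q ∂μ :=
          (lintegral_finsetSum _ fun i _ => measurable_one.indicator (hB i)).symm
      _ ≤ ∫⁻ _ in s, N ∂μ := by
          refine lintegral_mono fun q => ?_
          have : ∑ i ∈ X, (B i).indicator (1 : α → ℝ≥0∞) q = (X.filter fun i => q ∈ B i).card := by
            rw [Finset.card_filter, Nat.cast_sum]
            refine Finset.sum_congr rfl fun i _ => ?_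
            by_cases hq : q ∈ B i <;> simp [hq]
          simp only [this]
          exact_mod_cast h q _ (Finset.filter_subset _ _) fun i hi => (Finset.mem_filter.1 hi).2
      _ = _ := by rw [lintegral_const, Measure.restrict_apply_univ]
  refine (lintegral_mono' hle le_rfl).trans ?_
  rw [lintegral_smul_measure, smul_eq_mul]

theorem IsGraphChart.element_eq {x : E3} {g : tangentPlane M x → E3} (hg : IsGraphChart M x r C g)
    (hx : x ∈ M) (hC : 1 ≤ C) {t : Finset (tangentPlane M x)}
    (ht : ∀ v ∈ convexHull ℝ (t : Set (tangentPlane M x)), ‖v‖ < r / C) :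
    element M x t = g '' convexHull ℝ (t : Set (tangentPlane M x)) :=
  Set.image_congr fun v hv => hg.graphParam_eq hx hC (ht v hv)

theorem measurable_enorm_sq_taylorRem {E F : Type*} [NormedAddCommGroup E]
    [InnerProductSpace ℝ E] [MeasurableSpace E] [BorelSpace E] [NormedAddCommGroup F] [NormedSpace ℝ F] [MeasurableSpace F]
    [BorelSpace F] {u : E → F} (hu : ContDiff ℝ 2 u) (w : E) :
    Measurable fun v => ‖taylorRem u w v‖ₑ ^ 2 := by
  have h0 := hu.continuous
  have h1 : Continuous (fderiv ℝ u) := hu.continuous_fderiv (by norm_num)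
  have : Continuous fun v => taylorRem u w v := by
    unfold taylorRem; fun_prop
  exact this.measurable.enorm.pow_const 2

/-- Cauchy–Schwarz over three nodes gives a factor 3, the splitting of each node error a factor 2,
and the three copies of `ε ^ 2` give 18. -/
theorem ofReal_sq_sum_nodeError_le {x : E3} {g : tangentPlane M x → E3}
    {t : Finset (tangentPlane M x)} (ht : t.card = 3) {ε : ℝ≥0∞}
    (hε : ∀ w ∈ t, ‖W (g w) - V (g w)‖ₑ ≤ ε) (v : tangentPlane M x) :
    ENNReal.ofReal ((∑ w ∈ t, ‖nodeError g W V w v‖) ^ 2) ≤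
      18 * ε ^ 2 + 6 * ∑ w ∈ t, ‖taylorRem (fun v => V (g v)) w v‖ₑ ^ 2 := by
  have h1 : (∑ w ∈ t, ‖nodeError g W V w v‖) ^ 2 ≤ 3 * ∑ w ∈ t, ‖nodeError g W V w v‖ ^ 2 := by
    have := sq_sum_le_card_mul_sum_sq (s := t) (f := fun w => ‖nodeError g W V w v‖)
    rw [ht] at this
    exact_mod_cast this
  calc _ ≤ 3 * ∑ w ∈ t, ‖nodeError g W V w v‖ₑ ^ 2 := by
        refine (ENNReal.ofReal_le_ofReal h1).trans_eq ?_
        rw [ENNReal.ofReal_mul (by norm_num), ENNReal.ofReal_sum_of_nonneg fun _ _ => by positivity]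
        simp only [ofReal_norm_sq]
        norm_num
    _ ≤ 3 * ∑ w ∈ t, 2 * (ε ^ 2 + ‖taylorRem (fun v => V (g v)) w v‖ₑ ^ 2) := by
        gcongr with w hw
        refine (enorm_add_sq_le _ _).trans ?_
        gcongr
        exact hε w hw
    _ = _ := by
        rw [← Finset.mul_sum, Finset.sum_add_distrib, Finset.sum_const, ht, nsmul_eq_mul]
        push_cast
        ring

variable (hS : IsUniformSurface M r C Q K)
include hS

theorem IsUniformSurface.lintegral_taylorRem_le (hV : IsSmoothTangent M V) {x : E3} (hx : x ∈ M)
    {g : tangentPlane M x → E3} (hg : IsGraphChart M x r C g) {h : ℝ}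
    (hhr : 4 * h < r / C) (hhC : C * (4 * h) ≤ 1) {w : tangentPlane M x} (hw : ‖w‖ ≤ 4 * h) :
    ∫⁻ v in Metric.closedBall 0 (4 * h), ‖taylorRem (fun v => V (g v)) w v‖ₑ ^ 2 ∂planeArea M x ≤
      ENNReal.ofReal (8 * h) ^ 4 * (ENNReal.ofReal (48 * K ^ 4 * C ^ 4) *
        ∫⁻ q in Metric.closedBall x (8 * h), sobolevDensity M V q ∂area M) := by
  have hC := hS.one_le_C
  have := isAddHaarMeasure_planeArea (hS.finrank x hx)
  have hlt : ∀ v ∈ Metric.closedBall (0 : tangentPlane M x) (4 * h), ‖v‖ < r := fun v hv =>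
    (IsGraphChart.lt_of_lt_div hC (norm_nonneg v) ((mem_closedBall_zero_iff.1 hv).trans_lt hhr)).1
  refine (CurvedMesh.lintegral_taylorRem_le (planeArea M x) (hS.finrank x hx) (hg.contDiff_comp hV)
    (convex_closedBall 0 (4 * h)) Metric.isClosed_closedBall.measurableSet
    (mem_closedBall_zero_iff.2 hw) (d := 8 * h) fun v hv => ?_).trans ?_
  · have := mem_closedBall_zero_iff.1 hv
    linarith [norm_sub_le v w]
  gcongr
  calc _ ≤ ∫⁻ v in Metric.closedBall 0 (4 * h), ENNReal.ofReal (48 * K ^ 4 * C ^ 4) *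
        sobolevDensity M V (g v) ∂planeArea M x :=
        setLIntegral_mono' Metric.isClosed_closedBall.measurableSet fun v hv =>
          hS.enorm_fderiv_fderiv_sq_le hV hg (hlt v hv)
    _ = ENNReal.ofReal (48 * K ^ 4 * C ^ 4) *
        ∫⁻ v in Metric.closedBall 0 (4 * h), sobolevDensity M V (g v) ∂planeArea M x :=
        lintegral_const_mul' _ _ (by finiteness)
    _ ≤ _ := by
        gcongr
        refine (hg.lintegral_comp_le hS.isCompact.isClosed (isCompact_closedBall _ _) hlt _).trans
          (lintegral_mono_set ?_)
        rintro _ ⟨v, hv, rfl⟩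
        have hv' := mem_closedBall_zero_iff.1 hv
        refine (hg.dist_base_le_two_mul hx hC (hlt v hv) ?_).trans (by linarith)
        exact (by gcongr : C * ‖v‖ ≤ C * (4 * h)).trans hhC

/-- Enlarging the triangle to the disc of radius `4 h` makes the bound the same for all triangles of
a ring. The hypothesis on `f` is general enough to cover both k = 0 and k = 1. -/
theorem IsUniformSurface.setLIntegral_element_le (hV : IsSmoothTangent M V) {x : E3} (hx : x ∈ M)
    {g : tangentPlane M x → E3} (hg : IsGraphChart M x r C g) {h : ℝ} (hh : 0 < h)
    (hhr : 4 * h < r / C) (hhC : C * (4 * h) ≤ 1) {t : Finset (tangentPlane M x)} (ht : t.card = 3)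
    (hw : ∀ w ∈ t, ‖w‖ ≤ 4 * h) {ε β : ℝ≥0∞} (hβ : β ≠ ⊤) (hε : ∀ q ∈ M, ‖W q - V q‖ₑ ≤ ε)
    {f : E3 → ℝ≥0∞}
    (hf : ∀ v ∈ convexHull ℝ (t : Set (tangentPlane M x)),
      f (g v) ≤ β * ENNReal.ofReal ((∑ w ∈ t, ‖nodeError g W V w v‖) ^ 2)) :
    ∫⁻ q in element M x t, f q ∂area M ≤ ENNReal.ofReal C ^ 2 * (β *
      (18 * ε ^ 2 * ENNReal.ofReal (Real.pi * (4 * h) ^ 2) + 18 * (ENNReal.ofReal (8 * h) ^ 4 *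
        (ENNReal.ofReal (48 * K ^ 4 * C ^ 4) *
        ∫⁻ q in Metric.closedBall x (8 * h), sobolevDensity M V q ∂area M)))) := by
  have hC := hS.one_le_C
  set T := convexHull ℝ (t : Set (tangentPlane M x)) with hT
  set D := Metric.closedBall (0 : tangentPlane M x) (4 * h) with hD
  have hTD : T ⊆ D := convexHull_min (fun w hwt => mem_closedBall_zero_iff.2 (hw w hwt))
    (convex_closedBall _ _)
  have hlt : ∀ v ∈ D, ‖v‖ < r / C := fun v hv => (mem_closedBall_zero_iff.1 hv).trans_lt hhr
  have hlt' : ∀ v ∈ D, ‖v‖ < r := fun v hv =>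
    (IsGraphChart.lt_of_lt_div hC (norm_nonneg v) (hlt v hv)).1
  have hTm : MeasurableSet T := (t.finite_toSet.isCompact_convexHull (𝕜 := ℝ)).isClosed.measurableSet
  rw [hg.element_eq hx hC fun v hv => hlt v (hTD hv)]
  refine (hg.lintegral_image_le (fun v hv => hlt' v (hTD hv)) f).trans ?_
  gcongr
  have hcont := fun w => measurable_enorm_sq_taylorRem (hg.contDiff_comp hV) w
  calc ∫⁻ v in T, f (g v) ∂planeArea M x ≤ ∫⁻ v in T, β * (18 * ε ^ 2 +
        6 * ∑ w ∈ t, ‖taylorRem (fun v => V (g v)) w v‖ₑ ^ 2) ∂planeArea M x := by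
        refine setLIntegral_mono' hTm fun v hv => (hf v hv).trans ?_
        gcongr
        exact ofReal_sq_sum_nodeError_le ht
          (fun w hwt => hε _ (hg.mem w (hlt' w (mem_closedBall_zero_iff.2 (hw w hwt))))) v
    _ ≤ ∫⁻ v in D, β * (18 * ε ^ 2 +
        6 * ∑ w ∈ t, ‖taylorRem (fun v => V (g v)) w v‖ₑ ^ 2) ∂planeArea M x :=
        lintegral_mono_set hTD
    _ = β * (18 * ε ^ 2 * ENNReal.ofReal (Real.pi * (4 * h) ^ 2) + 6 * ∑ w ∈ t,
        ∫⁻ v in D, ‖taylorRem (fun v => V (g v)) w v‖ₑ ^ 2 ∂planeArea M x) := by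
        rw [lintegral_const_mul' _ _ hβ, lintegral_add_left measurable_const,
          lintegral_const_mul' 6 _ (by simp), lintegral_finsetSum _ fun w _ => hcont w,
          lintegral_const, Measure.restrict_apply_univ,
          planeArea_closedBall (hS.finrank x hx) (by positivity)]
    _ ≤ β * (18 * ε ^ 2 * ENNReal.ofReal (Real.pi * (4 * h) ^ 2) + 6 * ∑ w ∈ t,
        (ENNReal.ofReal (8 * h) ^ 4 * (ENNReal.ofReal (48 * K ^ 4 * C ^ 4) *
        ∫⁻ q in Metric.closedBall x (8 * h), sobolevDensity M V q ∂area M))) := by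
        gcongr with w hwt
        exact hS.lintegral_taylorRem_le hV hx hg hhr hhC (hw w hwt)
    _ = _ := by
        rw [Finset.sum_const, ht, nsmul_eq_mul]
        push_cast
        ring

/-- The balls of radius `8 h` around the nodes overlap at most `N` times, so the Sobolev terms add
up with a constant independent of `X`. The term with `ε` keeps the cardinality of `X`; it vanishes
in the limit. -/
theorem IsUniformSurface.sum_setLIntegral_element_le {X : Finset E3}
    {R : ∀ x : E3, Geometry.SimplicialComplex ℝ (tangentPlane M x)} {h Λ : ℝ} {N : ℕ}
    (hm : IsGoodMesh M X R h Λ N) (hV : IsSmoothTangent M V)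
    (hhr : 4 * h < r / C) (hhC : C * (4 * h) ≤ 1)
    {ε β : ℝ≥0∞} (hβ : β ≠ ⊤) (hε : ∀ q ∈ M, ‖W q - V q‖ₑ ≤ ε)
    {f : ∀ x : E3, Finset (tangentPlane M x) → E3 → ℝ≥0∞}
    (hf : ∀ x ∈ X, ∀ g, IsGraphChart M x r C g → ∀ t ∈ firstRing (R x),
      ∀ v ∈ convexHull ℝ (t : Set (tangentPlane M x)),
      f x t (g v) ≤ β * ENNReal.ofReal ((∑ w ∈ t, ‖nodeError g W V w v‖) ^ 2)) :
    ∑ x ∈ X, ∑' t : firstRing (R x), ∫⁻ q in element M x t, f x t q ∂area M ≤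
      18 * ENNReal.ofReal C ^ 2 * N * β * (X.card * ENNReal.ofReal (Real.pi * (4 * h) ^ 2) * ε ^ 2 +
        ENNReal.ofReal (8 * h) ^ 4 * (ENNReal.ofReal (48 * K ^ 4 * C ^ 4) *
        (N * ∫⁻ q, sobolevDensity M V q ∂area M))) := by
  set J : E3 → ℝ≥0∞ := fun x => ENNReal.ofReal C ^ 2 * (β *
      (18 * ε ^ 2 * ENNReal.ofReal (Real.pi * (4 * h) ^ 2) + 18 * (ENNReal.ofReal (8 * h) ^ 4 *
        (ENNReal.ofReal (48 * K ^ 4 * C ^ 4) *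
        ∫⁻ q in Metric.closedBall x (8 * h), sobolevDensity M V q ∂area M)))) with hJ
  have h1 : ∀ x ∈ X, ∑' t : firstRing (R x), ∫⁻ q in element M x t, f x t q ∂area M ≤ N * J x := by
    intro x hx
    obtain ⟨g, hg⟩ := hS.chart x (hm.subset hx)
    have := (hm.finite x hx).fintype
    rw [tsum_fintype]
    refine (Finset.sum_le_card_nsmul _ _ (J x) fun t _ => ?_).trans ?_
    · exact hS.setLIntegral_element_le hV (hm.subset hx) hg hm.pos hhr hhC t.2.2.1
        (hm.norm_le x hx t t.2) hβ hε (hf x hx g hg t t.2)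
    · rw [nsmul_eq_mul]
      gcongr
      rw [Finset.card_univ, ← Nat.card_eq_fintype_card]
      exact hm.ncard_le x hx
  have h2 := sum_setLIntegral_le_of_overlap (area M) X (fun x => Metric.closedBall x (8 * h))
    (fun x => Metric.isClosed_closedBall.measurableSet) N
    (fun q F hF hq => hm.card_le q F hF fun x hx => by
      rw [dist_comm]; exact hq x hx) (sobolevDensity M V)
  calc _ ≤ ∑ x ∈ X, N * J x := Finset.sum_le_sum h1
    _ = 18 * ENNReal.ofReal C ^ 2 * N * β *
        (X.card * ENNReal.ofReal (Real.pi * (4 * h) ^ 2) * ε ^ 2 +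
        ENNReal.ofReal (8 * h) ^ 4 * (ENNReal.ofReal (48 * K ^ 4 * C ^ 4) *
        ∑ x ∈ X, ∫⁻ q in Metric.closedBall x (8 * h), sobolevDensity M V q ∂area M)) := by
        simp only [hJ]
        simp only [← Finset.mul_sum, Finset.sum_add_distrib, Finset.sum_const, nsmul_eq_mul]
        ring
    _ ≤ _ := by gcongr

end MeshEstimate

/-! ### Passage from smooth fields to H² fields. -/

section Limit

variable {M : Set E3} {r C : ℝ} {Q : E3 → E3 →L[ℝ] E3} {K : ℝ} {V V' W : E3 → E3}

theorem lintegral_enorm_sq_eq {α F : Type*} [MeasurableSpace α] [NormedAddCommGroup F]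
    (μ : Measure α) (f : α → F) : ∫⁻ q, ‖f q‖ₑ ^ 2 ∂μ = eLpNorm f 2 μ ^ 2 := by
  rw [eLpNorm_eq_lintegral_rpow_enorm_toReal (by norm_num) (by norm_num), ENNReal.toReal_ofNat,
    ← ENNReal.rpow_natCast, ← ENNReal.rpow_mul]
  simp

theorem tendsto_lintegral_enorm_sq {α F : Type*} [MeasurableSpace α] [NormedAddCommGroup F]
    {μ : Measure α} {f : ℕ → α → F} (h : Tendsto (fun m => eLpNorm (f m) 2 μ) atTop (𝓝 0)) :
    Tendsto (fun m => ∫⁻ q, ‖f m q‖ₑ ^ 2 ∂μ) atTop (𝓝 0) := by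
  simp only [lintegral_enorm_sq_eq]
  simpa using ENNReal.Tendsto.pow (n := 2) h

theorem lintegral_enorm_add_sq_le {α F : Type*} [MeasurableSpace α] [NormedAddCommGroup F]
    {μ : Measure α} {f : α → F} (hf : AEStronglyMeasurable f μ) (g : α → F) :
    ∫⁻ q, ‖f q + g q‖ₑ ^ 2 ∂μ ≤ 2 * (∫⁻ q, ‖f q‖ₑ ^ 2 ∂μ + ∫⁻ q, ‖g q‖ₑ ^ 2 ∂μ) := by
  rw [← lintegral_add_left' (hf.enorm.pow_const 2), ← lintegral_const_mul' _ _ (by simp)]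
  exact lintegral_mono fun q => enorm_add_sq_le _ _

theorem IsSmoothTangent.sub (hV : IsSmoothTangent M V) (hV' : IsSmoothTangent M V') :
    IsSmoothTangent M (fun q => V q - V' q) :=
  ⟨hV.contDiff.sub hV'.contDiff, fun p hp => sub_mem (hV.tangent p hp) (hV'.tangent p hp)⟩

namespace IsProjExtension

theorem covDeriv₂_eq (hQ : IsProjExtension M Q K) (hV : IsSmoothTangent M V) {q : E3} (hq : q ∈ M) :
    covDeriv₂ M V q = (ContinuousLinearMap.compL ℝ E3 E3 E3 (Q q)).comp
      (((ContinuousLinearMap.compL ℝ E3 E3 E3).flip (Q q)).comp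
        ((fderiv ℝ (covExt Q V) q).comp (Q q))) := by
  ext1 u; ext1 w
  rw [hQ.covDeriv₂_apply_eq hV hq]
  rfl

theorem continuousOn_covDeriv₂ (hQ : IsProjExtension M Q K) (hV : IsSmoothTangent M V) :
    ContinuousOn (covDeriv₂ M V) M := by
  have h1 : Continuous (fderiv ℝ (covExt Q V)) :=
    (hQ.contDiff_covExt hV).continuous_fderiv (by norm_num)
  have h2 : Continuous Q := hQ.contDiff.continuous
  refine ContinuousOn.congr (Continuous.continuousOn ?_) fun q hq => hQ.covDeriv₂_eq hV hq
  exact ((ContinuousLinearMap.compL ℝ E3 E3 E3).continuous.comp h2).clm_comp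
    ((((ContinuousLinearMap.compL ℝ E3 E3 E3).flip).continuous.comp h2).clm_comp (h1.clm_comp h2))

theorem continuousOn_covDeriv (hQ : IsProjExtension M Q K) (hV : IsSmoothTangent M V) :
    ContinuousOn (covDeriv M V) M :=
  (hQ.contDiff_covExt hV).continuous.continuousOn.congr fun _ hq => hQ.covDeriv_eq hV hq

theorem covDeriv₂_sub (hQ : IsProjExtension M Q K) (hV : IsSmoothTangent M V)
    (hV' : IsSmoothTangent M V') {q : E3} (hq : q ∈ M) :
    covDeriv₂ M (fun q => V q - V' q) q = covDeriv₂ M V q - covDeriv₂ M V' q := by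
  have h1 : covExt Q (fun q => V q - V' q) = fun q => covExt Q V q - covExt Q V' q := by
    ext1 p
    unfold covExt
    rw [fderiv_fun_sub (hV.contDiff.differentiable (by norm_num) p)
      (hV'.contDiff.differentiable (by norm_num) p), ContinuousLinearMap.sub_comp,
      ContinuousLinearMap.comp_sub]
  ext1 u; ext1 w
  rw [sub_apply, sub_apply, hQ.covDeriv₂_apply_eq (hV.sub hV') hq, hQ.covDeriv₂_apply_eq hV hq,
    hQ.covDeriv₂_apply_eq hV' hq, h1,
    fderiv_fun_sub ((hQ.contDiff_covExt hV).differentiable (by norm_num) q)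
      ((hQ.contDiff_covExt hV').differentiable (by norm_num) q), sub_apply, sub_apply, map_sub]

end IsProjExtension

theorem normSq₁_le (A : E3 →L[ℝ] E3) : normSq₁ A ≤ 3 * ‖A‖ ^ 2 := by
  unfold normSq₁
  calc _ ≤ ∑ _i : Fin 3, ‖A‖ ^ 2 := by
        refine Finset.sum_le_sum fun i _ => ?_
        gcongr
        simpa using A.le_opNorm (EuclideanSpace.single i 1)
    _ = _ := by simp

theorem norm_sq_le_normSq₁ (A : E3 →L[ℝ] E3) : ‖A‖ ^ 2 ≤ normSq₁ A := by
  have h0 : 0 ≤ normSq₁ A := Finset.sum_nonneg fun _ _ => by positivity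
  rw [← Real.le_sqrt (norm_nonneg _) h0]
  refine ContinuousLinearMap.opNorm_le_bound _ (Real.sqrt_nonneg _) fun u => ?_
  have hu : A u = ∑ i, u i • A (EuclideanSpace.single i 1) := by
    conv_lhs => rw [← (EuclideanSpace.basisFun (Fin 3) ℝ).sum_repr u]
    simp
  rw [hu]
  refine (norm_sum_le _ _).trans ?_
  simp only [norm_smul]
  refine (Real.sum_mul_le_sqrt_mul_sqrt _ _ _).trans ?_
  rw [mul_comm, EuclideanSpace.norm_eq]
  rfl

theorem norm_sq_le_normSq₂ (B : E3 →L[ℝ] E3 →L[ℝ] E3) : ‖B‖ ^ 2 ≤ normSq₂ B := by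
  have h0 : 0 ≤ normSq₂ B :=
    Finset.sum_nonneg fun _ _ => Finset.sum_nonneg fun _ _ => by positivity
  rw [← Real.le_sqrt (norm_nonneg _) h0]
  refine ContinuousLinearMap.opNorm_le_bound _ (Real.sqrt_nonneg _) fun u => ?_
  have hu : B u = ∑ i, u i • B (EuclideanSpace.single i 1) := by
    conv_lhs => rw [← (EuclideanSpace.basisFun (Fin 3) ℝ).sum_repr u]
    simp
  rw [hu]
  refine (norm_sum_le _ _).trans ?_
  simp only [norm_smul]
  refine (Real.sum_mul_le_sqrt_mul_sqrt _ _ _).trans ?_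
  rw [mul_comm, EuclideanSpace.norm_eq]
  gcongr
  exact Finset.sum_le_sum fun i _ => norm_sq_le_normSq₁ _

theorem hessEnergy_le {B : E3 → E3 →L[ℝ] E3 →L[ℝ] E3} (hB : AEStronglyMeasurable B (area M)) :
    hessEnergy M V ≤
      2 * (∫⁻ q, ‖B q‖ₑ ^ 2 ∂area M + ∫⁻ q, ‖covDeriv₂ M V q - B q‖ₑ ^ 2 ∂area M) := by
  refine le_of_eq_of_le ?_ (lintegral_enorm_add_sq_le hB _)
  simp only [add_sub_cancel]
  rfl

variable (hS : IsUniformSurface M r C Q K)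
include hS

theorem IsUniformSurface.hessEnergy_sub_le (hV : IsSmoothTangent M V) (hV' : IsSmoothTangent M V')
    {B : E3 → E3 →L[ℝ] E3 →L[ℝ] E3} (hB : AEStronglyMeasurable B (area M)) :
    hessEnergy M (fun q => V q - V' q) ≤ 2 * (∫⁻ q, ‖covDeriv₂ M V q - B q‖ₑ ^ 2 ∂area M +
      ∫⁻ q, ‖covDeriv₂ M V' q - B q‖ₑ ^ 2 ∂area M) := by
  have hm := hS.isCompact.isClosed.measurableSet
  have h1 : AEStronglyMeasurable (covDeriv₂ M V) (area M) :=
    (hS.ext.continuousOn_covDeriv₂ hV).aestronglyMeasurable hm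
  have h2 := lintegral_enorm_add_sq_le (h1.sub hB) fun q => -(covDeriv₂ M V' q - B q)
  simp only [enorm_neg] at h2
  refine le_of_eq_of_le (setLIntegral_congr_fun hm fun q hq => ?_) h2
  simp only [Pi.sub_apply]
  rw [hS.ext.covDeriv₂_sub hV hV' hq, ← sub_eq_add_neg, sub_sub_sub_cancel_right]

/-- An `H²` Cauchy sequence of tangent fields converges uniformly. -/
theorem IsUniformSurface.exists_uniform_limit {V : ℕ → E3 → E3} (hV : ∀ m, IsSmoothTangent M (V m))
    {B : E3 → E3 →L[ℝ] E3 →L[ℝ] E3} (hB : AEStronglyMeasurable B (area M))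
    (h : Tendsto (fun m => ∫⁻ q, ‖covDeriv₂ M (V m) q - B q‖ₑ ^ 2 ∂area M) atTop (𝓝 0)) :
    ∃ W' : E3 → E3, ContinuousOn W' M ∧ IsTangentField M W' ∧ ∃ e : ℕ → ℝ≥0∞,
      Tendsto e atTop (𝓝 0) ∧ ∀ m, ∀ q ∈ M, ‖W' q - V m q‖ₑ ≤ e m := by
  obtain ⟨A, hA, hVA⟩ := hS.exists_enorm_sq_le_hessEnergy
  have hcauchy : UniformCauchySeqOn V atTop M := by
    rw [Metric.uniformCauchySeqOn_iff]
    intro ε hε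
    have hlim : Tendsto (fun m => A * (4 * ∫⁻ q, ‖covDeriv₂ M (V m) q - B q‖ₑ ^ 2 ∂area M)) atTop
        (𝓝 0) := by
      have := ENNReal.Tendsto.const_mul (a := A) (ENNReal.Tendsto.const_mul (a := 4) h
        (Or.inr (by simp))) (Or.inr hA)
      simpa using this
    have hε2 : 0 < ENNReal.ofReal ε ^ 2 := ENNReal.pow_pos (ENNReal.ofReal_pos.2 hε) 2
    obtain ⟨N, hN⟩ := eventually_atTop.1 (hlim.eventually_lt_const hε2)
    refine ⟨N, fun m hm n hn x hx => ?_⟩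
    have h1 := hVA _ ((hV m).sub (hV n)) x hx
    have h2 : ‖V m x - V n x‖ₑ ^ 2 < ENNReal.ofReal ε ^ 2 := by
      refine (h1.trans (mul_le_mul_right (hS.hessEnergy_sub_le (hV m) (hV n) hB) _)).trans_lt ?_
      set a := ∫⁻ q, ‖covDeriv₂ M (V m) q - B q‖ₑ ^ 2 ∂area M
      set b := ∫⁻ q, ‖covDeriv₂ M (V n) q - B q‖ₑ ^ 2 ∂area M
      -- The sup norm estimate has been applied to the difference of two members of the sequence;
      -- bounding the sum by a maximum lets each term be compared with `ε` separately.
      have hab : A * (2 * (a + b)) ≤ max (A * (4 * a)) (A * (4 * b)) := by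
        rcases le_total a b with hab | hab
        · refine le_max_of_le_right ?_
          calc A * (2 * (a + b)) ≤ A * (2 * (b + b)) := by gcongr
            _ = _ := by ring
        · refine le_max_of_le_left ?_
          calc A * (2 * (a + b)) ≤ A * (2 * (a + a)) := by gcongr
            _ = _ := by ring
      exact hab.trans_lt (max_lt (hN m hm) (hN n hn))
    have h3 : ‖V m x - V n x‖ₑ < ENNReal.ofReal ε :=
      lt_of_not_ge fun h3 => (pow_le_pow_left' h3 2).not_gt h2
    rw [← ofReal_norm, ENNReal.ofReal_lt_ofReal_iff hε] at h3
    rwa [dist_eq_norm]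
  have hex : ∀ x ∈ M, ∃ y, Tendsto (fun m => V m x) atTop (𝓝 y) := fun x hx =>
    cauchySeq_tendsto_of_complete (hcauchy.cauchySeq hx)
  choose! W' hW' using hex
  have hunif : TendstoUniformlyOn V W' atTop M := hcauchy.tendstoUniformlyOn_of_tendsto hW'
  refine ⟨W', hunif.continuousOn (Frequently.of_forall fun m =>
    (hV m).contDiff.continuous.continuousOn), fun p hp => ?_,
    fun m => ⨆ q ∈ M, ‖W' q - V m q‖ₑ, ?_, fun m q hq => le_iSup₂ (f := fun q _ => ‖W' q - V m q‖ₑ) q hq⟩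
  · exact (tangentPlane M p).closed_of_finiteDimensional.mem_of_tendsto (hW' p hp)
      (Eventually.of_forall fun m => (hV m).tangent p hp)
  · rw [ENNReal.tendsto_nhds_zero]
    intro ε hε
    by_cases hεt : ε = ⊤
    · simp [hεt]
    have hε' : 0 < ε.toReal := ENNReal.toReal_pos hε.ne' hεt
    filter_upwards [Metric.tendstoUniformlyOn_iff.1 hunif _ hε'] with m hm
    refine iSup₂_le fun q hq => ?_
    rw [← ofReal_norm, ← dist_eq_norm]
    exact ENNReal.ofReal_le_of_le_toReal (hm q hq).le

/-- The area of `M` is finite, so the uniform limit is also the L² limit. -/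
theorem IsUniformSurface.ae_eq_of_uniform_limit {V : ℕ → E3 → E3} {W W' : E3 → E3}
    (hV : ∀ m, IsSmoothTangent M (V m)) (hW' : ContinuousOn W' M) {e : ℕ → ℝ≥0∞}
    (he : Tendsto e atTop (𝓝 0)) (heV : ∀ m, ∀ q ∈ M, ‖W' q - V m q‖ₑ ≤ e m)
    (hW : AEStronglyMeasurable W (area M))
    (h : Tendsto (fun m => ∫⁻ q, ‖V m q - W q‖ₑ ^ 2 ∂area M) atTop (𝓝 0)) :
    W' =ᵐ[area M] W := by
  have hm := hS.isCompact.isClosed.measurableSet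
  have hW'm : AEStronglyMeasurable W' (area M) := hW'.aestronglyMeasurable hm
  have hbound : ∀ m, ∫⁻ q, ‖W' q - W q‖ₑ ^ 2 ∂area M ≤
      2 * (e m ^ 2 * area M Set.univ + ∫⁻ q, ‖V m q - W q‖ₑ ^ 2 ∂area M) := by
    intro m
    have hVm : AEStronglyMeasurable (V m) (area M) :=
      (hV m).contDiff.continuous.aestronglyMeasurable
    have h1 := lintegral_enorm_add_sq_le (hW'm.sub hVm) fun q => V m q - W q
    simp only [Pi.sub_apply, sub_add_sub_cancel] at h1
    refine h1.trans ?_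
    gcongr
    rw [← lintegral_const]
    refine setLIntegral_mono' hm fun q hq => ?_
    gcongr
    exact heV m q hq
  have hlim : Tendsto (fun m => 2 * (e m ^ 2 * area M Set.univ +
      ∫⁻ q, ‖V m q - W q‖ₑ ^ 2 ∂area M)) atTop (𝓝 0) := by
    have h1 := ENNReal.Tendsto.mul_const (b := area M Set.univ) (ENNReal.Tendsto.pow (n := 2) he)
      (Or.inr (area_lt_top hS).ne)
    have := ENNReal.Tendsto.const_mul (a := 2) (h1.add h) (Or.inr (by simp))
    simpa using this
  have h0 : ∫⁻ q, ‖W' q - W q‖ₑ ^ 2 ∂area M = 0 :=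
    le_antisymm (ge_of_tendsto' hlim hbound) zero_le
  have hmeas : AEMeasurable (fun q => ‖W' q - W q‖ₑ ^ 2) (area M) :=
    (hW'm.sub hW).enorm.pow_const 2
  rw [lintegral_eq_zero_iff' hmeas] at h0
  filter_upwards [h0] with q hq
  simpa [sub_eq_zero] using hq

/-- The mesh is fixed while `m` tends to infinity. The cost `e m` of replacing nodal values of `W`
by those of `V m`, and the cost `d m` of replacing `W` or its gradient on the elements, carry
factors depending on `X` and `h`, but they disappear in the limit; the surviving constant is
uniform. -/
theorem IsUniformSurface.sum_setLIntegral_le_of_tendsto {X : Finset E3}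
    {R : ∀ x : E3, Geometry.SimplicialComplex ℝ (tangentPlane M x)} {h Λ : ℝ} {N : ℕ}
    (hm : IsGoodMesh M X R h Λ N) (hhr : 4 * h < r / C) (hhC : C * (4 * h) ≤ 1)
    {V : ℕ → E3 → E3} (hV : ∀ m, IsSmoothTangent M (V m)) {e a d : ℕ → ℝ≥0∞}
    (he : Tendsto e atTop (𝓝 0)) (ha : Tendsto a atTop (𝓝 0)) (hd : Tendsto d atTop (𝓝 0))
    (heV : ∀ m, ∀ q ∈ M, ‖W q - V m q‖ₑ ≤ e m) {b : ℝ≥0∞}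
    (haV : ∀ m, hessEnergy M (V m) ≤ 2 * (b + a m)) {A : ℝ≥0∞} (hA : A ≠ ⊤)
    (hAV : ∀ V, IsSmoothTangent M V → ∫⁻ q, sobolevDensity M V q ∂area M ≤ A * hessEnergy M V)
    {β : ℝ≥0∞} (hβ : β ≠ ⊤) {f : ℕ → ∀ x : E3, Finset (tangentPlane M x) → E3 → ℝ≥0∞}
    (hf : ∀ m, ∀ x ∈ X, ∀ g, IsGraphChart M x r C g → ∀ t ∈ firstRing (R x),
      ∀ v ∈ convexHull ℝ (t : Set (tangentPlane M x)),
      f m x t (g v) ≤ β * ENNReal.ofReal ((∑ w ∈ t, ‖nodeError g W (V m) w v‖) ^ 2))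
    {F : ∀ x : E3, Finset (tangentPlane M x) → E3 → ℝ≥0∞}
    (hF : ∀ m, ∀ x ∈ X, ∀ t ∈ firstRing (R x), ∫⁻ q in element M x t, F x t q ∂area M ≤
      6 * (∫⁻ q in element M x t, f m x t q ∂area M + d m)) :
    ∑ x ∈ X, ∑' t : firstRing (R x), ∫⁻ q in element M x t, F x t q ∂area M ≤
      216 * ENNReal.ofReal C ^ 2 * N ^ 2 * ENNReal.ofReal (48 * K ^ 4 * C ^ 4) * A *
        (β * ENNReal.ofReal (8 * h) ^ 4) * b := by
  set c := ENNReal.ofReal (48 * K ^ 4 * C ^ 4) with hc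
  have hbound : ∀ m, ∑ x ∈ X, ∑' t : firstRing (R x), ∫⁻ q in element M x t, F x t q ∂area M ≤
      (108 * ENNReal.ofReal C ^ 2 * N * β * (X.card * ENNReal.ofReal (Real.pi * (4 * h) ^ 2))) *
        e m ^ 2 + (216 * ENNReal.ofReal C ^ 2 * N ^ 2 * c * A *
        (β * ENNReal.ofReal (8 * h) ^ 4)) * (b + a m) + (6 * X.card * N) * d m := by
    intro m
    have h1 : ∀ x ∈ X, ∑' t : firstRing (R x), ∫⁻ q in element M x t, F x t q ∂area M ≤
        6 * (∑' t : firstRing (R x), ∫⁻ q in element M x t, f m x t q ∂area M) + 6 * (N * d m) := by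
      intro x hx
      have := (hm.finite x hx).fintype
      have h2 : ∀ t : firstRing (R x), ∫⁻ q in element M x t, F x t q ∂area M ≤
          6 * (∫⁻ q in element M x t, f m x t q ∂area M + d m) := fun t => hF m x hx t t.2
      rw [tsum_fintype, tsum_fintype]
      refine (Finset.sum_le_sum fun t _ => h2 t).trans ?_
      rw [← Finset.mul_sum, Finset.sum_add_distrib, mul_add, Finset.sum_const, nsmul_eq_mul]
      gcongr
      rw [Finset.card_univ, ← Nat.card_eq_fintype_card]
      exact hm.ncard_le x hx
    have h2 := hS.sum_setLIntegral_element_le hm (hV m) hhr hhC hβ (heV m) (hf m)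
    calc _ ≤ ∑ x ∈ X, (6 * (∑' t : firstRing (R x), ∫⁻ q in element M x t, f m x t q ∂area M) +
          6 * (N * d m)) := Finset.sum_le_sum h1
      _ = 6 * (∑ x ∈ X, ∑' t : firstRing (R x), ∫⁻ q in element M x t, f m x t q ∂area M) +
          6 * (X.card * (N * d m)) := by
          rw [Finset.sum_add_distrib, ← Finset.mul_sum, Finset.sum_const, nsmul_eq_mul]
          ring
      _ ≤ 6 * (18 * ENNReal.ofReal C ^ 2 * N * β *
          (X.card * ENNReal.ofReal (Real.pi * (4 * h) ^ 2) * e m ^ 2 +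
          ENNReal.ofReal (8 * h) ^ 4 * (c * (N * (A * (2 * (b + a m))))))) +
          6 * (X.card * (N * d m)) := by
          gcongr
          refine h2.trans ?_
          gcongr
          exact (hAV _ (hV m)).trans (by gcongr; exact haV m)
      _ = _ := by ring
  have hlim : Tendsto (fun m => (108 * ENNReal.ofReal C ^ 2 * N * β *
      (X.card * ENNReal.ofReal (Real.pi * (4 * h) ^ 2))) *
        e m ^ 2 + (216 * ENNReal.ofReal C ^ 2 * N ^ 2 * c * A *
        (β * ENNReal.ofReal (8 * h) ^ 4)) * (b + a m) + (6 * X.card * N) * d m) atTop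
      (𝓝 ((108 * ENNReal.ofReal C ^ 2 * N * β *
      (X.card * ENNReal.ofReal (Real.pi * (4 * h) ^ 2))) *
        0 ^ 2 + (216 * ENNReal.ofReal C ^ 2 * N ^ 2 * c * A *
        (β * ENNReal.ofReal (8 * h) ^ 4)) * (b + 0) + (6 * X.card * N) * 0)) :=
    ((ENNReal.Tendsto.const_mul (ENNReal.Tendsto.pow he) (Or.inr (by finiteness))).add
      (ENNReal.Tendsto.const_mul (tendsto_const_nhds.add ha) (Or.inr (by finiteness)))).add
      (ENNReal.Tendsto.const_mul hd (Or.inr (by finiteness)))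
  have := ge_of_tendsto' hlim hbound
  simpa using this

end Limit

/-! ### The two error norms. -/

section Error

variable {M : Set E3} {r C : ℝ} {Q : E3 → E3 →L[ℝ] E3} {K : ℝ} {V : ℕ → E3 → E3} {W : E3 → E3}
  {A : E3 → E3 →L[ℝ] E3} {B : E3 → E3 →L[ℝ] E3 →L[ℝ] E3} {e : ℕ → ℝ≥0∞}

/-- `C²` tangent fields `V m` converging to `W` uniformly with rate `e` and in `H²(TM)`. -/
structure IsApproximation (M : Set E3) (V : ℕ → E3 → E3) (W : E3 → E3) (A : E3 → E3 →L[ℝ] E3)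
    (B : E3 → E3 →L[ℝ] E3 →L[ℝ] E3) (e : ℕ → ℝ≥0∞) : Prop where
  smooth : ∀ m, IsSmoothTangent M (V m)
  continuousOn : ContinuousOn W M
  aestronglyMeasurable_grad : AEStronglyMeasurable A (area M)
  aestronglyMeasurable_hess : AEStronglyMeasurable B (area M)
  tendsto : Tendsto e atTop (𝓝 0)
  le : ∀ m, ∀ q ∈ M, ‖W q - V m q‖ₑ ≤ e m
  tendsto_grad : Tendsto (fun m => ∫⁻ q, ‖covDeriv M (V m) q - A q‖ₑ ^ 2 ∂area M) atTop (𝓝 0)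
  tendsto_hess : Tendsto (fun m => ∫⁻ q, ‖covDeriv₂ M (V m) q - B q‖ₑ ^ 2 ∂area M) atTop (𝓝 0)

theorem enorm_sq_le_normSq₂ (B : E3 →L[ℝ] E3 →L[ℝ] E3) : ‖B‖ₑ ^ 2 ≤ ENNReal.ofReal (normSq₂ B) := by
  rw [← ofReal_norm_sq]
  exact ENNReal.ofReal_le_ofReal (norm_sq_le_normSq₂ _)

theorem rpow_half_le_of_le {S b : ℝ≥0∞} {y : ℝ} (h : S ≤ ENNReal.ofReal y ^ 2 * b) :
    S ^ (1 / 2 : ℝ) ≤ ENNReal.ofReal y * b ^ (1 / 2 : ℝ) := by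
  calc S ^ (1 / 2 : ℝ) ≤ (ENNReal.ofReal y ^ 2 * b) ^ (1 / 2 : ℝ) := by gcongr
    _ = _ := by
      rw [ENNReal.mul_rpow_of_nonneg _ _ (by norm_num), ← ENNReal.rpow_natCast, ← ENNReal.rpow_mul]
      norm_num

theorem enorm_sq_le_mul_ofReal {F : Type*} [NormedAddCommGroup F] {y : F} {k S : ℝ}
    (h : ‖y‖ ≤ k * S) : ‖y‖ₑ ^ 2 ≤ ENNReal.ofReal (k ^ 2) * ENNReal.ofReal (S ^ 2) := by
  rw [← ofReal_norm_sq, ← ENNReal.ofReal_mul (by positivity), ← mul_pow]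
  exact ENNReal.ofReal_le_ofReal (by gcongr)

variable {X : Finset E3} {R : ∀ x : E3, Geometry.SimplicialComplex ℝ (tangentPlane M x)} {h Λ : ℝ}
  {N : ℕ}

theorem IsGoodMesh.norm_le_of_mem_convexHull (hm : IsGoodMesh M X R h Λ N) {x : E3} (hx : x ∈ X)
    {t : Finset (tangentPlane M x)} (ht : t ∈ firstRing (R x)) {v : tangentPlane M x}
    (hv : v ∈ convexHull ℝ (t : Set (tangentPlane M x))) : ‖v‖ ≤ 4 * h :=
  mem_closedBall_zero_iff.1 (convexHull_min
    (fun w hw => mem_closedBall_zero_iff.2 (hm.norm_le x hx t ht w hw)) (convex_closedBall _ _) hv)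

variable (hS : IsUniformSurface M r C Q K) (happ : IsApproximation M V W A B e)
  (hm : IsGoodMesh M X R h Λ N) (hhr : 4 * h < r / C) (hhC : C * (4 * h) ≤ 1)
  {D : ℝ≥0∞} (hD : D ≠ ⊤)
  (hDV : ∀ V, IsSmoothTangent M V → ∫⁻ q, sobolevDensity M V q ∂area M ≤ D * hessEnergy M V)
include hS happ hm hhr hhC hD hDV

theorem IsUniformSurface.lintegral_interp_sub_le :
    ∑ x ∈ X, ∑' t : firstRing (R x), ∫⁻ q in element M x t,
      ENNReal.ofReal (‖interp M x t W q - W q‖ ^ 2) ∂area M ≤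
      216 * ENNReal.ofReal C ^ 2 * N ^ 2 * ENNReal.ofReal (48 * K ^ 4 * C ^ 4) * D *
        (ENNReal.ofReal (C ^ 2) * ENNReal.ofReal (8 * h) ^ 4) *
          ∫⁻ q, ENNReal.ofReal (normSq₂ (B q)) ∂area M := by
  have hMm := hS.isCompact.isClosed.measurableSet
  refine (hS.sum_setLIntegral_le_of_tendsto (W := W) (e := e) hm hhr hhC happ.smooth
    (d := fun m => e m ^ 2 * area M Set.univ)
    (f := fun m x t q => ‖interp M x t W q - V m q‖ₑ ^ 2)
    (F := fun x t q => ENNReal.ofReal (‖interp M x t W q - W q‖ ^ 2)) happ.tendsto happ.tendsto_hess ?_ happ.le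
    (fun m => hessEnergy_le happ.aestronglyMeasurable_hess) hD hDV
    (β := ENNReal.ofReal (C ^ 2)) (by finiteness) ?_ ?_).trans ?_
  · have := ENNReal.Tendsto.mul_const (b := area M Set.univ)
      (ENNReal.Tendsto.pow (n := 2) happ.tendsto) (Or.inr (area_lt_top hS).ne)
    simpa using this
  · intro m x hx g hg t ht v hv
    exact enorm_sq_le_mul_ofReal (hg.norm_interp_sub_le (hm.subset hx) hS.one_le_C
      (hm.isHatFamily x hx t ht) (happ.smooth m)
      (fun w hw => (hm.norm_le x hx t ht w hw).trans_lt hhr) W hv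
      ((hm.norm_le_of_mem_convexHull hx ht hv).trans_lt hhr))
  · intro m x hx t ht
    have hVW : AEStronglyMeasurable (fun q => V m q - W q) (area M) :=
      (happ.smooth m).contDiff.continuous.aestronglyMeasurable.sub
        (happ.continuousOn.aestronglyMeasurable hMm)
    have h1 := lintegral_enorm_add_sq_le (hVW.restrict (s := element M x t))
      fun q => interp M x t W q - V m q
    simp only [ofReal_norm_sq]
    refine le_trans (le_of_eq ?_) (h1.trans ?_)
    · refine lintegral_congr fun q => ?_
      rw [add_comm, sub_add_sub_cancel]
    · rw [add_comm]
      gcongr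
      · norm_num
      · refine (setLIntegral_le_lintegral _ _).trans ?_
        rw [← lintegral_const]
        refine setLIntegral_mono' hMm fun q hq => ?_
        rw [← neg_sub, enorm_neg]
        gcongr
        exact happ.le m q hq
  · gcongr
    exact enorm_sq_le_normSq₂ _

/-- Here the gradient bound `Λ / h` of the hat functions enters squared and reduces the factor `h⁴`
to order `h²`. The interpolant depends on nodal values only, so it is differentiable on an element
although `W` is merely continuous. -/
theorem IsUniformSurface.lintegral_covDeriv_interp_sub_le (hΛ : 0 ≤ Λ) :
    ∑ x ∈ X, ∑' t : firstRing (R x), ∫⁻ q in element M x t,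
      ENNReal.ofReal (normSq₁ (covDeriv M (interp M x t W) q - A q)) ∂area M ≤
      216 * ENNReal.ofReal C ^ 2 * N ^ 2 * ENNReal.ofReal (48 * K ^ 4 * C ^ 4) * D *
        (ENNReal.ofReal ((C * (1 + Λ / h)) ^ 2) * ENNReal.ofReal (8 * h) ^ 4) *
          ∫⁻ q, ENNReal.ofReal (normSq₂ (B q)) ∂area M := by
  have hMm := hS.isCompact.isClosed.measurableSet
  refine (hS.sum_setLIntegral_le_of_tendsto (W := W) (e := e) hm hhr hhC happ.smooth
    (f := fun m x t q => ‖covDeriv M (interp M x t W) q - covDeriv M (V m) q‖ₑ ^ 2)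
    (F := fun x t q => ENNReal.ofReal (normSq₁ (covDeriv M (interp M x t W) q - A q))) happ.tendsto
    happ.tendsto_hess happ.tendsto_grad happ.le
    (fun m => hessEnergy_le happ.aestronglyMeasurable_hess) hD hDV
    (β := ENNReal.ofReal ((C * (1 + Λ / h)) ^ 2)) (by finiteness) ?_ ?_).trans ?_
  · intro m x hx g hg t ht v hv
    exact enorm_sq_le_mul_ofReal (hg.norm_covDeriv_interp_sub_le (hm.subset hx) hS.one_le_C
      (hm.isHatFamily x hx t ht) (div_nonneg hΛ hm.pos.le) (happ.smooth m)
      (fun w hw => (hm.norm_le x hx t ht w hw).trans_lt hhr) W hv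
      ((hm.norm_le_of_mem_convexHull hx ht hv).trans_lt hhr))
  · intro m x hx t ht
    have hVA : AEStronglyMeasurable (fun q => covDeriv M (V m) q - A q) (area M) :=
      ((hS.ext.continuousOn_covDeriv (happ.smooth m)).aestronglyMeasurable hMm).sub
        happ.aestronglyMeasurable_grad
    have h1 := lintegral_enorm_add_sq_le (hVA.restrict (s := element M x t))
      fun q => covDeriv M (interp M x t W) q - covDeriv M (V m) q
    calc _ ≤ ∫⁻ q in element M x t, 3 * ‖(covDeriv M (V m) q - A q) +
          (covDeriv M (interp M x t W) q - covDeriv M (V m) q)‖ₑ ^ 2 ∂area M := by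
          refine lintegral_mono fun q => ?_
          rw [add_comm (covDeriv M (V m) q - A q), sub_add_sub_cancel, ← ofReal_norm_sq]
          refine (ENNReal.ofReal_le_ofReal (normSq₁_le _)).trans_eq ?_
          rw [ENNReal.ofReal_mul (by norm_num)]
          norm_num
      _ = 3 * ∫⁻ q in element M x t, ‖(covDeriv M (V m) q - A q) +
          (covDeriv M (interp M x t W) q - covDeriv M (V m) q)‖ₑ ^ 2 ∂area M :=
          lintegral_const_mul' _ _ (by simp)
      _ ≤ 3 * (2 * (∫⁻ q, ‖covDeriv M (V m) q - A q‖ₑ ^ 2 ∂area M +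
          ∫⁻ q in element M x t,
            ‖covDeriv M (interp M x t W) q - covDeriv M (V m) q‖ₑ ^ 2 ∂area M)) := by
          gcongr
          exact h1.trans (by gcongr; exact Measure.restrict_le_self)
      _ = _ := by ring
  · gcongr
    exact enorm_sq_le_normSq₂ _

end Error

/-! ### Assembly of the estimates. -/

section Main

variable {M : Set E3}

theorem MemH2.exists_isApproximation {r C K : ℝ} {Q : E3 → E3 →L[ℝ] E3} {W : E3 → E3}
    {A : E3 → E3 →L[ℝ] E3} {B : E3 → E3 →L[ℝ] E3 →L[ℝ] E3} (hS : IsUniformSurface M r C Q K)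
    (hW : MemH2 M W A B) : ∃ (W' : E3 → E3) (V : ℕ → E3 → E3) (e : ℕ → ℝ≥0∞),
      IsTangentField M W' ∧ W' =ᵐ[area M] W ∧ IsApproximation M V W' A B e := by
  obtain ⟨V, hV, h0, h1, h2⟩ := hW.approx
  have hsm : ∀ m, IsSmoothTangent M (V m) := fun m => ⟨(hV m).1, (hV m).2⟩
  have hB := hW.memLp_hess.aestronglyMeasurable
  have hess := tendsto_lintegral_enorm_sq h2
  obtain ⟨W', hc, ht, e, he, heV⟩ := hS.exists_uniform_limit hsm hB hess
  exact ⟨W', V, e, ht, hS.ae_eq_of_uniform_limit hsm hc he heV hW.memLp.aestronglyMeasurable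
    (tendsto_lintegral_enorm_sq h0), hsm, hc, hW.memLp_grad.aestronglyMeasurable, hB, he, heV,
    tendsto_lintegral_enorm_sq h1, hess⟩

/-- A bound by `k h²ⁿ` of the squared error yields a bound of the error. -/
theorem rpow_half_le_seminormH2 {B : E3 → E3 →L[ℝ] E3 →L[ℝ] E3} {S k β : ℝ≥0∞} {D h : ℝ} {n : ℕ}
    (hk : k ≠ ⊤) (hh : 0 ≤ h) (hD : 0 ≤ D) (hβ : β ≤ ENNReal.ofReal (D * (h ^ n) ^ 2))
    (hS : S ≤ k * β * ∫⁻ q, ENNReal.ofReal (normSq₂ (B q)) ∂area M) :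
    S ^ (1 / 2 : ℝ) ≤ ENNReal.ofReal ((Real.sqrt (k.toReal * D) + 1) * h ^ n) * seminormH2 M B := by
  refine rpow_half_le_of_le (hS.trans ?_)
  gcongr
  calc k * β ≤ ENNReal.ofReal k.toReal * ENNReal.ofReal (D * (h ^ n) ^ 2) := by
        rw [ENNReal.ofReal_toReal hk]; gcongr
    _ = ENNReal.ofReal (k.toReal * D * (h ^ n) ^ 2) := by
        rw [← ENNReal.ofReal_mul ENNReal.toReal_nonneg]; congr 1; ring
    _ ≤ ENNReal.ofReal (((Real.sqrt (k.toReal * D) + 1) * h ^ n) ^ 2) := by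
        apply ENNReal.ofReal_le_ofReal
        have h0 : 0 ≤ k.toReal * D := mul_nonneg ENNReal.toReal_nonneg hD
        rw [mul_pow]
        gcongr
        nlinarith [Real.sq_sqrt h0, Real.sqrt_nonneg (k.toReal * D)]
    _ = _ := ENNReal.ofReal_pow (by positivity) 2

end Main

end CurvedMesh
end

open CurvedMesh
theorem mainTheorem5 (M : Set E3) (hM : IsClosedC3Surface M) (cq : ℝ) :
    ∃ (c δ : ℝ) (k₀ : ℕ), 0 < c ∧ 0 < δ ∧
      ∀ (W : E3 → E3) (A : E3 → E3 →L[ℝ] E3) (B : E3 → E3 →L[ℝ] E3 →L[ℝ] E3),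
        MemH2 M W A B →
        -- the continuous representative of `W`, whose nodal values are interpolated
        ∃ W' : E3 → E3, ContinuousOn W' M ∧ IsTangentField M W' ∧
          W' =ᵐ[area M] W ∧
          ∀ (X : Finset E3) (k : ℕ) (K : E3 → Finset E3)
            (R : ∀ x : E3, Geometry.SimplicialComplex ℝ (tangentPlane M x)),
            (X : Set E3) ⊆ M →
            QuasiUniform M X cq →
            k₀ ≤ k →
            (∀ x ∈ X, IsNearest X k x (K x)) →
            (∀ x ∈ X, ∀ v ∈ projected M x (K x), ‖v‖ ≤ δ) →
            (∀ x ∈ X, IsDelaunay (projected M x (K x)) (R x)) →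
            errorH0 M X R W' ≤ ENNReal.ofReal (c * fillDist M X ^ 2) * seminormH2 M B ∧
            errorH1 M X R W' A ≤ ENNReal.ofReal (c * fillDist M X) * seminormH2 M B := by
  obtain ⟨r, C, Q, L, hS⟩ := hM.exists_isUniformSurface
  obtain ⟨D, hD, hDV⟩ := hS.exists_lintegral_sobolevDensity_le
  have hr := hS.r_pos
  have hC := hS.one_le_C
  -- The bound 1 on `h` absorbs lower powers in the k = 1 estimate; the other two keep the discs of
  -- radius `4 h` in the chart and in the region where it is 2-Lipschitz.
  have hh₀ : 0 < min 1 (min (r / C / 8) (1 / (4 * C))) := by positivity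
  -- Enlarging `cq` to at least 1 weakens quasi-uniformity, so nothing is lost.
  obtain ⟨δ, k₀, Λ, N, hδ, hΛ, hmesh⟩ := hS.exists_isGoodMesh (le_max_right cq 1) hh₀
  set k : ENNReal := 216 * ENNReal.ofReal C ^ 2 * N ^ 2 * ENNReal.ofReal (48 * L ^ 4 * C ^ 4) * D
    with hk
  have hktop : k ≠ ⊤ := by rw [hk]; finiteness
  -- One constant for both cases: `8⁴` comes from `(8 h)⁴`, and `C (h + Λ)`, after a factor `h` is
  -- taken from `C (1 + Λ / h)`, is at most `C (1 + Λ)`.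
  set D' : ℝ := 8 ^ 4 * (C * (1 + Λ)) ^ 2 with hD'
  refine ⟨Real.sqrt (k.toReal * D') + 1, δ, k₀, by positivity, hδ, fun W A B hW => ?_⟩
  obtain ⟨W', V, e, htan, hae, happ⟩ := hW.exists_isApproximation hS
  refine ⟨W', happ.continuousOn, htan, hae, fun X n K R hXM hqu hn hK hδK hdel => ?_⟩
  rcases X.eq_empty_or_nonempty with rfl | hX
  · simp [errorH0, errorH1, elementwise]
  obtain ⟨hm, hh⟩ := hmesh X n K R hXM hX (hqu.mono (le_max_left _ _)) hn hK hδK hdel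
  set h := fillDist M X
  have hpos := hm.pos
  have hh1 : h ≤ 1 := hh.trans (min_le_left _ _)
  have hh2 : h ≤ r / C / 8 := hh.trans ((min_le_right _ _).trans (min_le_left _ _))
  have hh3 : h ≤ 1 / (4 * C) := hh.trans ((min_le_right _ _).trans (min_le_right _ _))
  have hrC : 0 < r / C := by positivity
  have hhr : 4 * h < r / C := by linarith
  have hhC : C * (4 * h) ≤ 1 := by
    rw [le_div_iff₀ (by positivity)] at hh3; linarith
  constructor
  · refine rpow_half_le_seminormH2 hktop hpos.le (by positivity) ?_
      (hS.lintegral_interp_sub_le happ hm hhr hhC hD hDV)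
    rw [← ENNReal.ofReal_pow (by positivity), ← ENNReal.ofReal_mul (by positivity)]
    apply ENNReal.ofReal_le_ofReal
    calc C ^ 2 * (8 * h) ^ 4 = 8 ^ 4 * (C * (1 + 0)) ^ 2 * (h ^ 2) ^ 2 := by ring
      _ ≤ 8 ^ 4 * (C * (1 + Λ)) ^ 2 * (h ^ 2) ^ 2 := by gcongr
  · have h1 : errorH1 M X R W' A ≤
        ENNReal.ofReal ((Real.sqrt (k.toReal * D') + 1) * h ^ 1) * seminormH2 M B := by
      refine rpow_half_le_seminormH2 hktop hpos.le (by positivity) ?_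
        (hS.lintegral_covDeriv_interp_sub_le happ hm hhr hhC hD hDV hΛ)
      rw [← ENNReal.ofReal_pow (by positivity), ← ENNReal.ofReal_mul (by positivity)]
      apply ENNReal.ofReal_le_ofReal
      calc (C * (1 + Λ / h)) ^ 2 * (8 * h) ^ 4 = 8 ^ 4 * (C * (h + Λ)) ^ 2 * (h ^ 1) ^ 2 := by
            field_simp
        _ ≤ 8 ^ 4 * (C * (1 + Λ)) ^ 2 * (h ^ 1) ^ 2 := by gcongr
    rwa [pow_one] at h1
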